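/- Let $m\ge 1$, $s\ge 2$ and $n\ge 3$ be integers, and let $r\in\mathbb{Z}_n^*$ be a unit of the ring $\mathbb{Z}_n$ such that $r^{ms}=1$ or $r^{ms}=-1$. Let $\overline{\mathrm{CPM}}(m,s,n;r)$ be the simple graph whose vertices are all pairs $\langle i;\mathbf v\rangle$ with $i\in\mathbb{Z}_{ms}$ and $\mathbf v\in\mathbb{Z}_n^s$, and whose edges are given by $$\langle i;\mathbf v\rangle\sim\langle i+1;\mathbf v\pm r^i\mathbf e_\ell\rangle,$$ where $\ell\in\{0,\dots,s-1\}$ is the residue of $i$ modulo $s$ and $\mathbf e_\ell$ is the $\ell$-th standard vector. Let $\Gamma=\mathrm{CPM}(m,s,n;r)$ be the connected component of this graph that contains the vertex $\langle 0;\mathbf 0\rangle$. A 2-arc of a graph is a triple $(a,b,c)$ of vertices with $a\sim b\sim c$ and $a\neq c$, and a graph is 2-arc-transitive if its automorphism group acts transitively on its 2-arcs. Then $\Gamma$ is 2-arc-transitive if and only if $s=2$ and one of the following holds: (i) $n=4$ and $m=1$; (ii) $n=m$, $n$ is odd and $r^2=\pm1$ in $\mathbb{Z}_n$; (iii) $n=2m$,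 $m\equiv 2\pmod 4$ and $1+r^2\equiv m\pmod n$. Moreover, if $s=2$, $n=4$ and $m=1$, then $\Gamma\cong\mathrm{CPM}(1,2,4;1)\cong\mathrm{CPM}(2,2,4;1)$, and this graph is the 4-cube. -/

import Mathlib

/-- The graph `CPM̄(m,s,n;r)` on all pairs `⟨i; v⟩` with `i ∈ ℤ_{ms}` and `v ∈ ℤ_n^s`, in which
`⟨i; v⟩` is adjacent to `⟨i+1; v + r^i e_ℓ⟩` and to `⟨i+1; v - r^i e_ℓ⟩`, where `ℓ = i mod s` and
`e_ℓ` is the `ℓ`-th standard vector. (`SimpleGraph.fromRel` symmetrises the relation.) -/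
def CPMBar (m s n : ℕ) (r : (ZMod n)ˣ) : SimpleGraph (ZMod (m * s) × (Fin s → ZMod n)) :=
  SimpleGraph.fromRel fun x y =>
    y.1 = x.1 + 1 ∧
      ∃ δ : ZMod n, (δ = 1 ∨ δ = -1) ∧
        ∀ j : Fin s, y.2 j = x.2 j +
          if (j : ℕ) = x.1.val % s then δ * (r : ZMod n) ^ x.1.val else 0

/-- The vertex set of `CPM(m,s,n;r)`: the connected component of `⟨0; 0⟩` in `CPM̄(m,s,n;r)`. -/
abbrev CPMComponent (m s n : ℕ) (r : (ZMod n)ˣ) : (CPMBar m s n r).ConnectedComponent :=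
  (CPMBar m s n r).connectedComponentMk (0, 0)

/-- The graph `CPM(m,s,n;r)`. -/
abbrev CPM (m s n : ℕ) (r : (ZMod n)ˣ) : SimpleGraph (CPMComponent m s n r) :=
  (CPMComponent m s n r).toSimpleGraph

/-- `(a, b, c)` is a 2-arc: `a ∼ b ∼ c` and `a ≠ c`. -/
def IsTwoArc {V : Type*} (G : SimpleGraph V) (a b c : V) : Prop :=
  G.Adj a b ∧ G.Adj b c ∧ a ≠ c

/-- A graph is 2-arc-transitive if its automorphism group is transitive on its 2-arcs. -/
def IsTwoArcTransitive {V : Type*} (G : SimpleGraph V) : Prop :=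
  ∀ a b c a' b' c' : V, IsTwoArc G a b c → IsTwoArc G a' b' c' →
    ∃ φ : G ≃g G, φ a = a' ∧ φ b = b' ∧ φ c = c'

/-- The 4-cube: binary strings of length 4, adjacent when they differ in exactly one place. -/
def fourCube : SimpleGraph (Fin 4 → Bool) where
  Adj x y := hammingDist x y = 1
  symm := ⟨fun x y h => by rwa [hammingDist_comm]⟩
  loopless := ⟨fun x h => by simp at h⟩

/-!
The vertices of `CPMBar m s n r` are handled as pairs of an integral level and a vector in
`ℤ_n ^ s`. A vertex has four neighbours, and a walk is described by a word of letters "up or down,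
with sign `±`". A word is non-backtracking when no letter is followed by its inverse, and whether
it is closed does not depend on the starting vertex (`proj_run_eq_iff`): its height has to be
divisible by `m s`, and for every class of levels modulo `s` the signed sum of the powers `r ^ j`
met has to vanish. Automorphisms preserve the existence and the uniqueness of the non-backtracking
walks of given length that close up a given path (`closings_map`). A 2-arc has three prolongations
by one step, one that turns and two that go straight on, so if the graph is 2-arc-transitive, any
two 2-arcs have equally many prolongations with such a property. The closed words of length at
most 8 are found by enumeration: the parameters enter a word only through a short list of integral
coefficients.

*The case `s ≥ 3`.* Compare the 2-arc that goes up twice with the one that goes up and down. For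
each of them a reflection of the graph in a coordinate hyperplane fixes the 2-arc and swaps its
straight prolongations, so a 2-arc-transitive graph cannot distinguish the two turning
prolongations (`closings_iff_of_three_le`). But walks that turn at every vertex close up after 4
or 6 steps if `n = 4` or `n ∣ 6`, and for other `n` there are closed 8-walks that go up twice and
then turn, but, except for `n = 8`, none that begin with two turns. For `n = 8` the numbers of
closed 8-walks differ.

*The case `s = 2`, `2 r ^ 2 ≠ ±2`.* Counting the prolongations on closed 8-walks first shows that
no closed 8-walk begins with two turns, and then that of the two straight prolongations of an
upward 2-arc exactly one lies on such a walk. This forces `m = 4` and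
`(1 ± r ^ 2) (1 + r ^ 4) = 0` (`exists_relation_of_not_closable`). An automorphism that maps the
turning 2-arc to the straight one must then map the walk that turns all the time to the upward
walk that always avoids the closed 8-walks. The first walk closes up after `n` or `2 n` steps,
while the second one does not: its level returns only after a multiple of 8 steps, and the
displacement would give `4 ∣ 1 + r ^ 4` (`not_isTwoArcTransitive_of_not_isDiamond`).

*The case `s = 2`, `2 r ^ 2 = ±2`.* Here `r ^ 2 = ±1 + κ` with `κ` equal to 0 or `n / 2`, and
`CPM m 2 n r` is a quotient of the diamond lattice, the graph on the integral vectors with four coordinates of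
sum 0 or 1 in which neighbours differ by a unit vector (`exists_cover`). The fibres are the cosets
of a lattice of translations. The symmetries of the diamond lattice induce all permutations of the
four directions at a node. If the translations of the fibres are exactly the vectors of sum 0 that
are divisible by some integer `d`, all these symmetries descend to it, and it is hence
2-arc-transitive (`isTwoArcTransitive_of_cover`). Conversely, apart from small `n`, a path of
length 3 lies on a hexagon exactly when its first and third edge have different directions, so the
automorphisms permute the directions everywhere in the same way and the lattice of
translations has to be invariant under these permutations. This leaves only the listed parameters
(`parameters_of_isTwoArcTransitive`).

The 4-cube is also a quotient of the diamond lattice, in two ways: by reduction modulo 2, and as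
the product of two 4-cycles. Quotients with the same fibres are isomorphic
(`exists_iso_of_covers`), which identifies it with the graphs for `n = 4` and `m = 2` or `m = 1`.
-/

/-! ### Automorphisms and non-backtracking closed walks -/

/-- `IsNBWalk G u v L`: the list `L` continues the arc `(u, v)` to a non-backtracking walk. -/
def IsNBWalk {V : Type*} (G : SimpleGraph V) : V → V → List V → Prop
  | _, _, [] => True
  | u, v, w :: L => G.Adj v w ∧ w ≠ u ∧ IsNBWalk G v w L

/-- The non-backtracking continuations of the arc `(u, v)` by `k` further steps that end in `a`.
For `a = u` these are the closed walks of length `k + 1` through the arc, and for a path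
`(a, …, u, v)` they are the ways to close the path up. No condition is imposed at `a`, so the
closed walk may backtrack there. -/
def closings {V : Type*} (G : SimpleGraph V) (k : ℕ) (a u v : V) : Set (List V) :=
  {L | L.length = k ∧ IsNBWalk G u v L ∧ L.getLastD v = a}

section Automorphisms

variable {V W : Type*} {G : SimpleGraph V} {H : SimpleGraph W}

theorem isNBWalk_map (φ : G ≃g H) (u v : V) (L : List V) :
    IsNBWalk H (φ u) (φ v) (L.map φ) ↔ IsNBWalk G u v L := by
  induction L generalizing u v with
  | nil => simp [IsNBWalk]
  | cons w L ih => simp [IsNBWalk, ih, φ.map_adj_iff]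

theorem closings_map (φ : G ≃g H) (k : ℕ) (a u v : V) :
    closings H k (φ a) (φ u) (φ v) = List.map φ '' closings G k a u v := by
  ext L
  constructor
  · rintro ⟨h1, h2, h3⟩
    have hL : L = (L.map φ.symm).map φ := by simp [List.map_map, Function.comp_def]
    refine ⟨L.map φ.symm, ⟨by simpa using h1, ?_, ?_⟩, hL.symm⟩
    · rw [hL] at h2
      exact (isNBWalk_map φ u v _).1 h2
    · apply φ.injective
      rw [← h3]
      conv_rhs => rw [hL]
      rw [List.getLastD_map]
  · rintro ⟨L, ⟨h1, h2, h3⟩, rfl⟩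
    refine ⟨by simpa using h1, (isNBWalk_map φ u v _).2 h2, ?_⟩
    rw [List.getLastD_map, h3]

theorem closings_map_nonempty (φ : G ≃g H) (k : ℕ) (a u v : V) :
    (closings H k (φ a) (φ u) (φ v)).Nonempty ↔ (closings G k a u v).Nonempty := by
  rw [closings_map, Set.image_nonempty]

theorem closings_map_subsingleton (φ : G ≃g H) (k : ℕ) (a u v : V) :
    (closings H k (φ a) (φ u) (φ v)).Subsingleton ↔ (closings G k a u v).Subsingleton := by
  rw [closings_map]
  refine ⟨fun h => ?_, fun h => h.image _⟩
  exact Set.subsingleton_of_image (List.map_injective_iff.2 φ.injective) _ h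

/-- An automorphism of a connected component extends by the identity to the whole graph. -/
theorem exists_iso_of_isTwoArcTransitive {C : G.ConnectedComponent}
    (h : IsTwoArcTransitive C.toSimpleGraph) {a b c a' b' c' : V}
    (hb : b ∈ C.supp) (hb' : b' ∈ C.supp)
    (h1 : IsTwoArc G a b c) (h2 : IsTwoArc G a' b' c') :
    ∃ φ : G ≃g G, φ a = a' ∧ φ b = b' ∧ φ c = c' := by
  classical
  have ha := (C.mem_supp_congr_adj h1.1).2 hb
  have ha' := (C.mem_supp_congr_adj h2.1).2 hb'
  have hc := (C.mem_supp_congr_adj h1.2.1).1 hb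
  have hc' := (C.mem_supp_congr_adj h2.2.1).1 hb'
  obtain ⟨ψ, e1, e2, e3⟩ := h ⟨a, ha⟩ ⟨b, hb⟩ ⟨c, hc⟩ ⟨a', ha'⟩ ⟨b', hb'⟩ ⟨c', hc'⟩
    ⟨h1.1, h1.2.1, fun e => h1.2.2 (congrArg Subtype.val e)⟩
    ⟨h2.1, h2.2.1, fun e => h2.2.2 (congrArg Subtype.val e)⟩
  have hin : ∀ x (hx : x ∈ C.supp), Equiv.Perm.ofSubtype (p := (· ∈ C.supp)) ψ.toEquiv x
      = (ψ ⟨x, hx⟩).1 := fun x hx =>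
    Equiv.Perm.ofSubtype_apply_of_mem (p := (· ∈ C.supp)) ψ.toEquiv hx
  have hout : ∀ x, x ∉ C.supp → Equiv.Perm.ofSubtype (p := (· ∈ C.supp)) ψ.toEquiv x = x :=
    fun x hx => Equiv.Perm.ofSubtype_apply_of_not_mem (p := (· ∈ C.supp)) ψ.toEquiv hx
  refine ⟨⟨Equiv.Perm.ofSubtype (p := (· ∈ C.supp)) ψ.toEquiv, ?_⟩, ?_, ?_, ?_⟩
  · intro x y
    by_cases hx : x ∈ C.supp <;> by_cases hy : y ∈ C.supp
    · rw [hin x hx, hin y hy]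
      exact ψ.map_adj_iff (v := ⟨x, hx⟩) (w := ⟨y, hy⟩)
    · rw [hin x hx, hout y hy]
      exact iff_of_false (fun e => hy ((C.mem_supp_congr_adj e).1 (ψ ⟨x, hx⟩).2))
        (fun e => hy ((C.mem_supp_congr_adj e).1 hx))
    · rw [hout x hx, hin y hy]
      exact iff_of_false (fun e => hx ((C.mem_supp_congr_adj e).2 (ψ ⟨y, hy⟩).2))
        (fun e => hx ((C.mem_supp_congr_adj e).2 hy))
    · rw [hout x hx, hout y hy]
  · exact (hin a ha).trans (congrArg Subtype.val e1)
  · exact (hin b hb).trans (congrArg Subtype.val e2)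
  · exact (hin c hc).trans (congrArg Subtype.val e3)

/-- `x` lists without repetition the three neighbours of `c` other than `b`. -/
def IsExtensions (G : SimpleGraph V) (b c : V) (x : Fin 3 → V) : Prop :=
  Function.Injective x ∧ ∀ w, (G.Adj c w ∧ w ≠ b) ↔ ∃ i, x i = w

/-- An automorphism taking one 2-arc to another permutes the three ways to prolong them. -/
theorem exists_perm_extensions {b c b' c' : V} {x y : Fin 3 → V} (hx : IsExtensions G b c x)
    (hy : IsExtensions G b' c' y) (φ : G ≃g G) (hb : φ b = b') (hc : φ c = c') :
    ∃ σ : Equiv.Perm (Fin 3), ∀ i, φ (x i) = y (σ i) := by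
  have h1 : ∀ i, ∃ j, y j = φ (x i) := by
    intro i
    have := (hx.2 (x i)).2 ⟨i, rfl⟩
    refine (hy.2 _).1 ⟨?_, ?_⟩
    · rw [← hc]; exact φ.map_adj_iff.2 this.1
    · rw [← hb]; exact fun e => this.2 (φ.injective e)
  choose σ hσ using h1
  have hinj : Function.Injective σ := by
    intro i j hij
    apply hx.1
    apply φ.injective
    rw [← hσ, ← hσ, hij]
  exact ⟨Equiv.ofBijective σ (Finite.injective_iff_bijective.1 hinj), fun i => (hσ i).symm⟩

end Automorphisms

/-- Two triples of truth values that agree up to a permutation contain equally many truths. -/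
theorem sum_ite_eq_of_perm {p q : Fin 3 → Prop} [DecidablePred p] [DecidablePred q]
    (σ : Equiv.Perm (Fin 3)) (h : ∀ i, p i ↔ q (σ i)) :
    (∑ i, if p i then 1 else 0) = ∑ i, if q i then 1 else 0 := by
  rw [← Equiv.sum_comp σ (fun i => if q i then 1 else 0)]
  exact Finset.sum_congr rfl fun i _ => by simp [h i]

/-- Two triples of truth values that agree up to a permutation, and whose last two entries agree,
agree in every entry. -/
theorem iff_of_perm_of_iff {p q : Fin 3 → Prop} (σ : Equiv.Perm (Fin 3))
    (h : ∀ i, p i ↔ q (σ i)) (hp : p 1 ↔ p 2) (hq : q 1 ↔ q 2) :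
    (p 0 ↔ q 0) ∧ (p 1 ↔ q 1) := by
  classical
  have := sum_ite_eq_of_perm σ h
  simp only [Fin.sum_univ_three] at this
  by_cases a : p 0 <;> by_cases b : p 1 <;> by_cases c : q 0 <;> by_cases d : q 1 <;>
    simp_all

/-! ### The graph `CPMBar` in integer coordinates -/

/-- The standing hypotheses on the parameters of `CPM(m,s,n;r)`. -/
structure Admissible (m s n : ℕ) (r : (ZMod n)ˣ) : Prop where
  one_le : 1 ≤ m
  two_le : 2 ≤ s
  three_le : 3 ≤ n
  pow_eq : (r : ZMod n) ^ (m * s) = 1 ∨ (r : ZMod n) ^ (m * s) = -1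

/-- The sign `±1` encoded by a truth value. -/
def sgn (b : Bool) : ℤ := if b then 1 else -1

theorem sgn_not (b : Bool) : sgn (!b) = -sgn b := by cases b <;> rfl

/-- The vector `r ^ j • e_ℓ`, `ℓ = j mod s`, along which the edges between the levels `j` and
`j + 1` run; here `j` is any integer. -/
def levelVec {s n : ℕ} (r : (ZMod n)ˣ) (j : ℤ) : Fin s → ZMod n :=
  fun i => if (i : ℤ) = j % s then ((r ^ j : (ZMod n)ˣ) : ZMod n) else 0

/-- A letter `(u, e)` describes a step: up or down according to `u`, with sign `e`. -/
abbrev Letter := Bool × Bool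

/-- The lower level of the edge traversed from level `l` when going up or down. -/
def edgeLevel (l : ℤ) (u : Bool) : ℤ := if u then l else l - 1

/-- The step described by a letter, on vertices with an integral level. -/
def move {s n : ℕ} (r : (ZMod n)ˣ) (x : ℤ × (Fin s → ZMod n)) (c : Letter) :
    ℤ × (Fin s → ZMod n) :=
  (x.1 + sgn c.1, x.2 + sgn c.2 • levelVec r (edgeLevel x.1 c.1))

/-- Reduction of the level modulo `m * s`. -/
def proj (m : ℕ) {s n : ℕ} (x : ℤ × (Fin s → ZMod n)) : ZMod (m * s) × (Fin s → ZMod n) :=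
  ((x.1 : ZMod (m * s)), x.2)

section LocalStructure

variable {m s n : ℕ} {r : (ZMod n)ˣ}

theorem Admissible.mul_pos (h : Admissible m s n r) : 0 < m * s :=
  Nat.mul_pos h.one_le (by have := h.two_le; omega)

theorem Admissible.zpow_eq (h : Admissible m s n r) (k : ℤ) :
    (r : (ZMod n)ˣ) ^ (((m * s : ℕ) : ℤ) * k) = 1 ∨ r ^ (((m * s : ℕ) : ℤ) * k) = -1 := by
  rw [zpow_mul, zpow_natCast]
  have h1 : r ^ (m * s) = 1 ∨ r ^ (m * s) = -1 := by
    rcases h.pow_eq with h | h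
    · left; ext; simpa using h
    · right; ext; simpa using h
  rcases h1 with h1 | h1 <;> rw [h1]
  · left; simp
  · rcases Int.even_or_odd k with hk | hk
    · left; exact hk.neg_one_zpow
    · right; exact hk.neg_one_zpow

/-- The edge direction computed from a residue `j mod m * s` agrees up to sign with the one computed
from the integer `j`, since `r ^ (m * s) = ±1`. -/
theorem exists_sign_iff (h : Admissible m s n r) (j : ℤ) (f : Fin s → ZMod n) :
    (∃ δ : ZMod n, (δ = 1 ∨ δ = -1) ∧ ∀ i : Fin s, f i =
      if (i : ℕ) = ((j : ZMod (m * s))).val % s then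
        δ * (r : ZMod n) ^ ((j : ZMod (m * s))).val else 0) ↔
    ∃ b : Bool, f = sgn b • levelVec r j := by
  have : NeZero (m * s) := ⟨h.mul_pos.ne'⟩
  set k := ((j : ZMod (m * s))).val with hk
  have hkj : (k : ℤ) = j % ((m * s : ℕ) : ℤ) := by
    rw [hk, ZMod.val_intCast]
  have hmod : ((k % s : ℕ) : ℤ) = j % s := by
    rw [Int.natCast_mod, hkj, Int.emod_emod_of_dvd]
    exact ⟨m, by push_cast; ring⟩
  have hcond : ∀ i : Fin s, (i : ℕ) = k % s ↔ (i : ℤ) = j % s := by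
    intro i
    rw [← hmod]; norm_cast
  have hpow : (r : ZMod n) ^ k = ((r ^ j : (ZMod n)ˣ) : ZMod n) ∨
      (r : ZMod n) ^ k = -((r ^ j : (ZMod n)ˣ) : ZMod n) := by
    have e : (k : ℤ) = j + ((m * s : ℕ) : ℤ) * (-(j / ((m * s : ℕ) : ℤ))) := by
      rw [hkj, Int.emod_def]; ring
    have e2 : (r : ZMod n) ^ k = ((r ^ (k : ℤ) : (ZMod n)ˣ) : ZMod n) := by simp
    rw [e2, e, zpow_add]
    rcases h.zpow_eq (-(j / ((m * s : ℕ) : ℤ))) with h | h <;> rw [h] <;> simp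
  constructor
  · rintro ⟨δ, hδ, hf⟩
    have : δ * (r : ZMod n) ^ k = ((r ^ j : (ZMod n)ˣ) : ZMod n) ∨
        δ * (r : ZMod n) ^ k = -((r ^ j : (ZMod n)ˣ) : ZMod n) := by
      rcases hδ with rfl | rfl <;> rcases hpow with e | e <;> rw [e] <;> simp
    rcases this with e | e
    · refine ⟨true, funext fun i => ?_⟩
      rw [hf, e]; simp [levelVec, sgn, hcond]
    · refine ⟨false, funext fun i => ?_⟩
      rw [hf, e]
      by_cases hi : (i : ℤ) = j % s <;> simp [hcond, levelVec, sgn, hi]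
  · rintro ⟨b, rfl⟩
    have : ∃ δ : ZMod n, (δ = 1 ∨ δ = -1) ∧
        δ * (r : ZMod n) ^ k = sgn b • ((r ^ j : (ZMod n)ˣ) : ZMod n) := by
      cases b <;> rcases hpow with e | e <;> rw [e]
      · exact ⟨-1, by simp, by simp [sgn]⟩
      · exact ⟨1, by simp, by simp [sgn]⟩
      · exact ⟨1, by simp, by simp [sgn]⟩
      · exact ⟨-1, by simp, by simp [sgn]⟩
    obtain ⟨δ, hδ, e⟩ := this
    refine ⟨δ, hδ, fun i => ?_⟩
    simp only [hcond, e, levelVec, Pi.smul_apply]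
    split_ifs <;> simp

theorem levelVec_apply_self (hs : 0 < s) (j : ℤ) :
    ∃ i : Fin s, (i : ℤ) = j % s ∧
      levelVec r j i = ((r ^ j : (ZMod n)ˣ) : ZMod n) := by
  have h0 : 0 ≤ j % s := Int.emod_nonneg _ (by omega)
  have h1 : j % s < s := Int.emod_lt_of_pos _ (by omega)
  refine ⟨⟨(j % s).toNat, by omega⟩, by simp [h0], ?_⟩
  simp [levelVec, h0]

theorem intCast_mul_unit_ne_zero {c : ℤ} (hc : ¬ (n : ℤ) ∣ c)
    (u : (ZMod n)ˣ) : (c : ZMod n) * (u : ZMod n) ≠ 0 := by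
  intro e
  rw [Units.mul_left_eq_zero] at e
  exact hc ((ZMod.intCast_zmod_eq_zero_iff_dvd c n).1 e)

/-- Distinct letters lead to distinct neighbours. -/
theorem proj_move_injective (h : Admissible m s n r) (x : ℤ × (Fin s → ZMod n)) :
    Function.Injective fun c => proj m (move r x c) := by
  rintro ⟨u, e⟩ ⟨u', e'⟩ hh
  have hs := h.two_le
  have h2 : sgn e • levelVec r (edgeLevel x.1 u) =
      sgn e' • (levelVec r (edgeLevel x.1 u') : Fin s → ZMod n) := by
    have := congrArg Prod.snd hh
    simpa [proj, move] using this
  obtain ⟨i, hi, hv⟩ := levelVec_apply_self (r := r) (s := s) (by omega) (edgeLevel x.1 u)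
  have h3 := congrFun h2 i
  simp only [Pi.smul_apply, hv] at h3
  have hu : u = u' := by
    by_contra hne
    have : levelVec r (edgeLevel x.1 u') i = 0 := by
      simp only [levelVec]
      rw [if_neg]
      rw [hi]
      intro e
      have hd : (s : ℤ) ∣ edgeLevel x.1 u - edgeLevel x.1 u' :=
        Int.dvd_of_emod_eq_zero (Int.emod_eq_emod_iff_emod_sub_eq_zero.1 e)
      have : edgeLevel x.1 u - edgeLevel x.1 u' = 1 ∨
          edgeLevel x.1 u - edgeLevel x.1 u' = -1 := by
        cases u <;> cases u' <;> simp [edgeLevel] at hne ⊢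
      have h4 : (s : ℤ) ∣ 1 := by
        rcases this with e | e <;> rw [e] at hd
        · exact hd
        · exact (Int.dvd_neg).1 hd
      have := Int.le_of_dvd one_pos h4
      omega
    rw [this, smul_zero, zsmul_eq_mul] at h3
    refine intCast_mul_unit_ne_zero (c := sgn e) ?_ _ h3
    intro hd
    have := h.three_le
    cases e <;> have := Int.le_of_dvd one_pos (by simpa [sgn] using hd) <;> omega
  subst hu
  congr 1
  by_contra hne
  rw [hv] at h3
  have : ((sgn e - sgn e' : ℤ) : ZMod n) *
      ((r ^ (edgeLevel x.1 u) : (ZMod n)ˣ) : ZMod n) = 0 := by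
    simp only [zsmul_eq_mul] at h3
    push_cast
    rw [sub_mul, h3, sub_self]
  refine intCast_mul_unit_ne_zero ?_ _ this
  intro hd
  have := h.three_le
  have h2 : (n : ℤ) ∣ 2 := by
    cases e <;> cases e' <;> simp [sgn] at hne hd <;> exact hd
  have := Int.le_of_dvd two_pos h2
  omega

theorem proj_move_ne (h : Admissible m s n r) (x : ℤ × (Fin s → ZMod n)) (c : Letter) :
    proj m (move r x c) ≠ proj m x := by
  intro hh
  have hs := h.two_le
  have h2 : sgn c.2 • levelVec r (edgeLevel x.1 c.1) = (0 : Fin s → ZMod n) := by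
    have := congrArg Prod.snd hh
    simpa [proj, move] using this
  obtain ⟨i, hi, hv⟩ := levelVec_apply_self (r := r) (s := s) (by omega) (edgeLevel x.1 c.1)
  have h3 := congrFun h2 i
  simp only [Pi.smul_apply, hv, Pi.zero_apply, zsmul_eq_mul] at h3
  refine intCast_mul_unit_ne_zero (c := sgn c.2) ?_ _ h3
  intro hd
  have := h.three_le
  cases h : c.2 <;> have := Int.le_of_dvd one_pos (by simpa [sgn, h] using hd) <;> omega

theorem adj_proj_iff (h : Admissible m s n r) (x : ℤ × (Fin s → ZMod n))
    (y : ZMod (m * s) × (Fin s → ZMod n)) :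
    (CPMBar m s n r).Adj (proj m x) y ↔ ∃ c, proj m (move r x c) = y := by
  rw [CPMBar, SimpleGraph.fromRel_adj]
  constructor
  · rintro ⟨-, ⟨h1, δ, hδ, h2⟩ | ⟨h1, δ, hδ, h2⟩⟩
    · obtain ⟨b, hb⟩ := (exists_sign_iff h x.1 (y.2 - x.2)).1
        ⟨δ, hδ, fun i => by rw [Pi.sub_apply, h2]; exact add_sub_cancel_left _ _⟩
      refine ⟨(true, b), Prod.ext ?_ ?_⟩
      · rw [h1]; simp [proj, move, sgn]
      · simp only [proj, move, edgeLevel, if_true]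
        rw [← hb]; abel
    · have h1' : y.1 = ((x.1 - 1 : ℤ) : ZMod (m * s)) := by
        rw [eq_sub_of_add_eq h1.symm]; simp [proj]
      rw [h1'] at h2
      obtain ⟨b, hb⟩ := (exists_sign_iff h (x.1 - 1) (x.2 - y.2)).1
        ⟨δ, hδ, fun i => by
          rw [Pi.sub_apply, sub_eq_iff_eq_add']
          exact h2 i⟩
      refine ⟨(false, !b), Prod.ext ?_ ?_⟩
      · rw [h1']; simp [proj, move, sgn, sub_eq_add_neg]
      · simp only [proj, move, edgeLevel, Bool.false_eq_true, if_false, sgn_not, neg_smul]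
        rw [← hb]; abel
  · rintro ⟨⟨u, e⟩, rfl⟩
    refine ⟨(proj_move_ne h x _).symm, ?_⟩
    cases u
    · right
      obtain ⟨δ, hδ, h2⟩ := (exists_sign_iff h (x.1 - 1) (sgn (!e) • levelVec r (x.1 - 1))).2
        ⟨_, rfl⟩
      refine ⟨by simp [proj, move, sgn], δ, hδ, fun i => ?_⟩
      have : (proj m (move r x (false, e))).1 = ((x.1 - 1 : ℤ) : ZMod (m * s)) := by
        simp [proj, move, sgn, sub_eq_add_neg]
      rw [this, ← h2]
      simp [proj, move, edgeLevel, sgn_not]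
    · left
      obtain ⟨δ, hδ, h2⟩ := (exists_sign_iff h x.1 (sgn e • levelVec r x.1)).2 ⟨_, rfl⟩
      refine ⟨by simp [proj, move, sgn], δ, hδ, fun i => ?_⟩
      have : (proj m x).1 = ((x.1 : ℤ) : ZMod (m * s)) := rfl
      rw [this, ← h2]
      simp [proj, move, edgeLevel]

theorem move_move_inv (x : ℤ × (Fin s → ZMod n)) (c : Letter) :
    move r (move r x c) (!c.1, !c.2) = x := by
  have : edgeLevel (x.1 + sgn c.1) (!c.1) = edgeLevel x.1 c.1 := by
    cases h : c.1 <;> simp [edgeLevel, sgn]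
    omega
  ext1
  · simp [move, sgn_not]
  · simp [move, sgn_not, this]

/-! ### Words -/

/-- The letters that may follow the letter `c` in a non-backtracking word: first the turn, then the
two straight continuations. -/
def nextLetter (c : Letter) : Fin 3 → Letter := ![(!c.1, c.2), (c.1, true), (c.1, false)]

theorem nextLetter_injective (c : Letter) : Function.Injective (nextLetter c) := by
  revert c; decide

theorem exists_nextLetter_iff (c d : Letter) :
    (∃ i, nextLetter c i = d) ↔ d ≠ (!c.1, !c.2) := by
  revert c d; decide

/-- The words of length `k` that continue the letter `c` without backtracking. -/
def nbWords : ℕ → Letter → List (List Letter)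
  | 0, _ => [[]]
  | k + 1, c => (List.finRange 3).flatMap fun i =>
      (nbWords k (nextLetter c i)).map (nextLetter c i :: ·)

theorem mem_nbWords_succ {k : ℕ} {c : Letter} {w : List Letter} :
    w ∈ nbWords (k + 1) c ↔ ∃ d v, d ≠ (!c.1, !c.2) ∧ v ∈ nbWords k d ∧ w = d :: v := by
  simp only [nbWords, List.mem_flatMap, List.mem_finRange, true_and, List.mem_map]
  constructor
  · rintro ⟨i, v, hv, rfl⟩
    exact ⟨_, v, (exists_nextLetter_iff c _).1 ⟨i, rfl⟩, hv, rfl⟩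
  · rintro ⟨d, v, hd, hv, rfl⟩
    obtain ⟨i, rfl⟩ := (exists_nextLetter_iff c d).2 hd
    exact ⟨i, v, hv, rfl⟩

/-- The end point of the walk described by a word. -/
def run (r : (ZMod n)ˣ) (x : ℤ × (Fin s → ZMod n)) (w : List Letter) : ℤ × (Fin s → ZMod n) :=
  w.foldl (move r) x

theorem run_cons (x : ℤ × (Fin s → ZMod n)) (c : Letter) (w : List Letter) :
    run r x (c :: w) = run r (move r x c) w := rfl

theorem run_append (x : ℤ × (Fin s → ZMod n)) (v w : List Letter) :
    run r x (v ++ w) = run r (run r x v) w := List.foldl_append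

/-- The vertices, without the first one, of the walk described by a word. -/
def trail (m : ℕ) (r : (ZMod n)ˣ) :
    ℤ × (Fin s → ZMod n) → List Letter → List (ZMod (m * s) × (Fin s → ZMod n))
  | _, [] => []
  | x, c :: w => proj m (move r x c) :: trail m r (move r x c) w

theorem trail_injective (h : Admissible m s n r) (x : ℤ × (Fin s → ZMod n)) :
    Function.Injective (trail m r x) := by
  intro v w e
  induction v generalizing x w with
  | nil => cases w with
    | nil => rfl
    | cons c w => simp [trail] at e
  | cons c v ih => cases w with
    | nil => simp [trail] at e
    | cons d w =>
      simp only [trail, List.cons.injEq] at e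
      have := proj_move_injective h x e.1
      subst this
      rw [ih _ e.2]

theorem mem_closings_iff (h : Admissible m s n r) (k : ℕ) (a : ZMod (m * s) × (Fin s → ZMod n))
    (x : ℤ × (Fin s → ZMod n)) (c : Letter) (L : List (ZMod (m * s) × (Fin s → ZMod n))) :
    L ∈ closings (CPMBar m s n r) k a (proj m x) (proj m (move r x c)) ↔
      ∃ w ∈ nbWords k c, proj m (run r (move r x c) w) = a ∧ trail m r (move r x c) w = L := by
  induction k generalizing x c L with
  | zero =>
    constructor
    · rintro ⟨h1, -, h3⟩
      obtain rfl := List.length_eq_zero_iff.1 h1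
      exact ⟨[], by simp [nbWords], h3, rfl⟩
    · rintro ⟨w, hw, h1, rfl⟩
      simp only [nbWords, List.mem_singleton] at hw
      subst hw
      exact ⟨rfl, trivial, h1⟩
  | succ k ih =>
    constructor
    · rintro ⟨h1, h2, h3⟩
      cases L with
      | nil => simp at h1
      | cons y L =>
        obtain ⟨h4, h5, h6⟩ := h2
        obtain ⟨d, rfl⟩ := (adj_proj_iff h _ _).1 h4
        obtain ⟨v, hv, e1, e2⟩ := (ih (move r x c) d L).1 ⟨by simpa using h1, h6,
          by rwa [List.getLastD_cons] at h3⟩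
        refine ⟨d :: v, mem_nbWords_succ.2 ⟨d, v, ?_, hv, rfl⟩, e1, by simp [trail, e2]⟩
        rintro rfl
        exact h5 (by rw [move_move_inv])
    · rintro ⟨w, hw, h1, rfl⟩
      obtain ⟨d, v, hd, hv, rfl⟩ := mem_nbWords_succ.1 hw
      obtain ⟨e1, e2, e3⟩ := (ih (move r x c) d _).2 ⟨v, hv, h1, rfl⟩
      refine ⟨by simp [trail, e1], ⟨(adj_proj_iff h _ _).2 ⟨d, rfl⟩, fun e => ?_, e2⟩, ?_⟩
      · exact hd (proj_move_injective h _ (e.trans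
          (congrArg (proj m) (move_move_inv x c)).symm))
      · rw [trail, List.getLastD_cons]
        exact e3

/-- The edges of the walk of a word from level `l`, as pairs of a lower level and a sign. -/
def crossings : ℤ → List Letter → List (ℤ × ℤ)
  | _, [] => []
  | l, c :: w => (edgeLevel l c.1, sgn c.2) :: crossings (l + sgn c.1) w

/-- The difference of the levels of the two ends of a word. -/
def height (w : List Letter) : ℤ := (w.map fun c => sgn c.1).sum

/-- The displacement of the walk with the given edges, in the coordinate of the class of `ℓ`
modulo `s`. -/
def classSum (s : ℕ) (r : (ZMod n)ˣ) (ℓ : ℤ) (L : List (ℤ × ℤ)) : ZMod n :=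
  (L.map fun p => if (s : ℤ) ∣ p.1 - ℓ then
    (p.2 : ZMod n) * ((r ^ p.1 : (ZMod n)ˣ) : ZMod n) else 0).sum

/-- The word describes closed walks in `CPMBar m s n r`. -/
def ClosedWord (m s : ℕ) (r : (ZMod n)ˣ) (w : List Letter) : Prop :=
  ((m * s : ℕ) : ℤ) ∣ height w ∧ ∀ ℓ : ℤ, classSum s r ℓ (crossings 0 w) = 0

theorem run_eq (x : ℤ × (Fin s → ZMod n)) (w : List Letter) :
    run r x w = (x.1 + height w,
      x.2 + ((crossings x.1 w).map fun p => p.2 • levelVec r p.1).sum) := by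
  induction w generalizing x with
  | nil => simp [run, height, crossings]
  | cons c w ih =>
    rw [run_cons, ih]
    simp [move, height, crossings, add_assoc]

theorem crossings_eq_map (l : ℤ) (w : List Letter) :
    crossings l w = (crossings 0 w).map fun p => (p.1 + l, p.2) := by
  have : ∀ k l : ℤ, crossings (k + l) w = (crossings k w).map fun p => (p.1 + l, p.2) := by
    induction w with
    | nil => intros; rfl
    | cons c w ih =>
      intro k l
      have h1 : edgeLevel (k + l) c.1 = edgeLevel k c.1 + l := by
        cases c.1 <;> simp [edgeLevel]; ring
      have h2 : k + l + sgn c.1 = k + sgn c.1 + l := by ring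
      simp only [crossings, List.map_cons, h1, h2, ih]
  simpa using this 0 l

theorem classSum_shift (ℓ l : ℤ) (L : List (ℤ × ℤ)) :
    classSum s r (ℓ + l) (L.map fun p => (p.1 + l, p.2)) =
      ((r ^ l : (ZMod n)ˣ) : ZMod n) * classSum s r ℓ L := by
  simp only [classSum, List.map_map]
  rw [← List.sum_map_mul_left]
  congr 1
  apply List.map_congr_left
  intro p _
  simp only [Function.comp, add_sub_add_right_eq_sub]
  split_ifs
  · rw [zpow_add]; push_cast; ring
  · simp

theorem levelVec_sum_apply (L : List (ℤ × ℤ)) (i : Fin s) :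
    (L.map fun p => p.2 • levelVec r p.1).sum i = classSum s r (i : ℤ) L := by
  induction L with
  | nil => simp [classSum]
  | cons p L ih =>
    simp only [List.map_cons, List.sum_cons, Pi.add_apply, ih, classSum, add_left_inj]
    have : ((i : ℕ) : ℤ) = p.1 % s ↔ (s : ℤ) ∣ p.1 - (i : ℕ) := by
      rw [eq_comm, ← Int.emod_emod_of_dvd p.1 (dvd_refl (s : ℤ))]
      have hi : ((i : ℕ) : ℤ) % s = (i : ℕ) :=
        Int.emod_eq_of_lt (by positivity) (by exact_mod_cast i.2)
      conv_lhs => rw [← hi]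
      rw [Int.emod_emod_of_dvd p.1 (dvd_refl (s : ℤ)), Int.emod_eq_emod_iff_emod_sub_eq_zero]
      exact (Int.dvd_iff_emod_eq_zero).symm
    simp [levelVec, this]

theorem classSum_congr {ℓ ℓ' : ℤ} (h : (s : ℤ) ∣ ℓ - ℓ') (L : List (ℤ × ℤ)) :
    classSum s r ℓ L = classSum s r ℓ' L := by
  simp only [classSum]
  congr 1
  apply List.map_congr_left
  intro p _
  have : (s : ℤ) ∣ p.1 - ℓ ↔ (s : ℤ) ∣ p.1 - ℓ' := by
    rw [show p.1 - ℓ' = (p.1 - ℓ) + (ℓ - ℓ') by ring]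
    exact (dvd_add_left h).symm
  simp [this]

theorem proj_run_eq_iff (hs : 0 < s) (x : ℤ × (Fin s → ZMod n)) (w : List Letter) :
    proj m (run r x w) = proj m x ↔ ClosedWord m s r w := by
  rw [run_eq, proj, proj, Prod.ext_iff, ClosedWord]
  simp only [Int.cast_add, add_eq_left]
  refine and_congr (ZMod.intCast_zmod_eq_zero_iff_dvd _ _) ?_
  rw [crossings_eq_map x.1 w]
  have key : ∀ ℓ, classSum s r ℓ (crossings 0 w) = 0 ↔
      classSum s r (ℓ + x.1) ((crossings 0 w).map fun p => (p.1 + x.1, p.2)) = 0 := by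
    intro ℓ
    rw [classSum_shift, Units.mul_right_eq_zero]
  constructor
  · intro e ℓ
    rw [key]
    have h0 : 0 ≤ (ℓ + x.1) % s := Int.emod_nonneg _ (by omega)
    have h1 : (ℓ + x.1) % s < s := Int.emod_lt_of_pos _ (by omega)
    have := congrFun e ⟨((ℓ + x.1) % s).toNat, by omega⟩
    rw [levelVec_sum_apply] at this
    refine Eq.trans ?_ this
    apply classSum_congr
    simp only [Int.toNat_of_nonneg h0]
    exact Int.dvd_self_sub_emod
  · intro e
    funext i
    rw [levelVec_sum_apply]
    have := (key ((i : ℤ) - x.1)).1 (e _)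
    simpa using this

theorem closings_run (h : Admissible m s n r) (k : ℕ) (x : ℤ × (Fin s → ZMod n))
    (p : List Letter) (c : Letter) :
    closings (CPMBar m s n r) k (proj m x) (proj m (run r x p)) (proj m (run r x (p ++ [c]))) =
      trail m r (run r x (p ++ [c])) '' {w | w ∈ nbWords k c ∧ ClosedWord m s r (p ++ c :: w)} := by
  ext L
  have e : run r x (p ++ [c]) = move r (run r x p) c := run_append x p [c]
  have hs := h.two_le
  rw [e, mem_closings_iff h]
  constructor
  · rintro ⟨w, hw, h1, rfl⟩
    refine ⟨w, ⟨hw, ?_⟩, rfl⟩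
    rw [← proj_run_eq_iff (by omega) x, run_append, run_cons, h1]
  · rintro ⟨w, ⟨hw, h1⟩, rfl⟩
    rw [← proj_run_eq_iff (by omega) x, run_append, run_cons] at h1
    exact ⟨w, hw, h1, rfl⟩

theorem closings_run_nonempty (h : Admissible m s n r) (k : ℕ) (x : ℤ × (Fin s → ZMod n))
    (p : List Letter) (c : Letter) :
    (closings (CPMBar m s n r) k (proj m x) (proj m (run r x p))
      (proj m (run r x (p ++ [c])))).Nonempty ↔
      ∃ w ∈ nbWords k c, ClosedWord m s r (p ++ c :: w) := by
  rw [closings_run h, Set.image_nonempty]; rfl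

theorem closings_run_subsingleton (h : Admissible m s n r) (k : ℕ) (x : ℤ × (Fin s → ZMod n))
    (p : List Letter) (c : Letter) :
    (closings (CPMBar m s n r) k (proj m x) (proj m (run r x p))
      (proj m (run r x (p ++ [c])))).Subsingleton ↔
      ∀ w ∈ nbWords k c, ∀ w' ∈ nbWords k c, ClosedWord m s r (p ++ c :: w) →
        ClosedWord m s r (p ++ c :: w') → w = w' := by
  rw [closings_run h]
  constructor
  · intro hh w hw w' hw' h1 h2
    exact Set.subsingleton_of_image (trail_injective h _) _ hh ⟨hw, h1⟩ ⟨hw', h2⟩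
  · intro hh
    exact Set.Subsingleton.image (fun w h1 w' h2 => hh w h1.1 w' h2.1 h1.2 h2.2) _

theorem isExtensions_run (h : Admissible m s n r) (x : ℤ × (Fin s → ZMod n))
    (p : List Letter) (c : Letter) :
    IsExtensions (CPMBar m s n r) (proj m (run r x p)) (proj m (run r x (p ++ [c])))
      fun i => proj m (run r x (p ++ [c] ++ [nextLetter c i])) := by
  have e : run r x (p ++ [c]) = move r (run r x p) c := run_append x p [c]
  have e2 : ∀ d, run r x (p ++ [c] ++ [d]) = move r (run r x (p ++ [c])) d :=
    fun d => run_append x _ [d]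
  refine ⟨fun i j hij => ?_, fun w => ?_⟩
  · simp only [e2] at hij
    exact nextLetter_injective c (proj_move_injective h _ hij)
  · simp only [e2]
    rw [adj_proj_iff h]
    constructor
    · rintro ⟨⟨d, rfl⟩, hd⟩
      obtain ⟨i, rfl⟩ := (exists_nextLetter_iff c d).2 (by
        rintro rfl
        exact hd (by rw [e, move_move_inv]))
      exact ⟨i, rfl⟩
    · rintro ⟨i, rfl⟩
      refine ⟨⟨_, rfl⟩, fun hh => ?_⟩
      rw [← move_move_inv (r := r) (run r x p) c, ← e] at hh
      exact (exists_nextLetter_iff c _).1 ⟨i, rfl⟩ (proj_move_injective h _ hh)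

theorem isTwoArc_run (h : Admissible m s n r) (x : ℤ × (Fin s → ZMod n)) (c : Letter) (i : Fin 3) :
    IsTwoArc (CPMBar m s n r) (proj m x) (proj m (run r x [c]))
      (proj m (run r x [c, nextLetter c i])) := by
  have := (isExtensions_run h x [] c).2 (proj m (run r x [c, nextLetter c i]))
  have h2 := this.2 ⟨i, rfl⟩
  exact ⟨(adj_proj_iff h _ _).2 ⟨c, rfl⟩, h2.1, fun e => h2.2 e.symm⟩

end LocalStructure

/-! ### Displacement of a closed word -/

/-- The coefficient of `r ^ j` in the displacement along the given edges. -/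
def coefAt (j : ℤ) (L : List (ℤ × ℤ)) : ℤ := (L.map fun p => if p.1 = j then p.2 else 0).sum

/-- `evalList T [c₀, c₁, …] = c₀ + c₁ T + …`. -/
def evalList {R : Type*} [CommRing R] (T : R) : List ℤ → R
  | [] => 0
  | c :: cs => c + T * evalList T cs

/-- The coefficients at the levels `ℓ - 4 s, ℓ - 3 s, …, ℓ + 4 s`, which include all the levels of
the class of `ℓ` modulo `s` that a word of length 8 can meet. -/
def classPoly (s : ℕ) (ℓ : ℤ) (L : List (ℤ × ℤ)) : List ℤ :=
  (List.range 9).map fun k : ℕ => coefAt (ℓ + s * ((k : ℤ) - 4)) L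

/-- Some class modulo `s` is met by the word in one level only, with a coefficient from `A`. -/
def HasIsolated (s : ℕ) (A : List ℤ) (w : List Letter) : Prop :=
  ∃ p ∈ crossings 0 w, (∀ q ∈ crossings 0 w, q.1 = p.1 ∨ ¬ (s : ℤ) ∣ q.1 - p.1) ∧
    coefAt p.1 (crossings 0 w) ∈ A

instance (s : ℕ) (A : List ℤ) (w : List Letter) : Decidable (HasIsolated s A w) := by
  unfold HasIsolated; infer_instance

section Displacement

variable {m s n : ℕ} {r : (ZMod n)ˣ}

theorem coefAt_cons (j : ℤ) (p : ℤ × ℤ) (L : List (ℤ × ℤ)) :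
    coefAt j (p :: L) = (if p.1 = j then p.2 else 0) + coefAt j L := by
  simp [coefAt]

theorem classSum_cons (ℓ : ℤ) (p : ℤ × ℤ) (L : List (ℤ × ℤ)) :
    classSum s r ℓ (p :: L) = (if (s : ℤ) ∣ p.1 - ℓ then
      (p.2 : ZMod n) * ((r ^ p.1 : (ZMod n)ˣ) : ZMod n) else 0) + classSum s r ℓ L := by
  simp [classSum]

theorem classSum_eq_sum (ℓ : ℤ) (L : List (ℤ × ℤ)) (S : Finset ℤ) (hS : ∀ p ∈ L, p.1 ∈ S) :
    classSum s r ℓ L = ∑ j ∈ S, if (s : ℤ) ∣ j - ℓ then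
      (coefAt j L : ZMod n) * ((r ^ j : (ZMod n)ˣ) : ZMod n) else 0 := by
  induction L with
  | nil => simp [classSum, coefAt]
  | cons p L ih =>
    rw [classSum_cons, ih fun q hq => hS q (List.mem_cons_of_mem _ hq)]
    have : ∀ j ∈ S, (if (s : ℤ) ∣ j - ℓ then
        (coefAt j (p :: L) : ZMod n) * ((r ^ j : (ZMod n)ˣ) : ZMod n) else 0) =
        (if p.1 = j then (if (s : ℤ) ∣ j - ℓ then
          (p.2 : ZMod n) * ((r ^ j : (ZMod n)ˣ) : ZMod n) else 0) else 0) +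
        if (s : ℤ) ∣ j - ℓ then
          (coefAt j L : ZMod n) * ((r ^ j : (ZMod n)ˣ) : ZMod n) else 0 := by
      intro j _
      rw [coefAt_cons]
      split_ifs <;> push_cast <;> ring
    rw [Finset.sum_congr rfl this, Finset.sum_add_distrib, Finset.sum_ite_eq,
      if_pos (hS p List.mem_cons_self)]

theorem classSum_of_isolated (ℓ : ℤ) (L : List (ℤ × ℤ))
    (h : ∀ q ∈ L, q.1 = ℓ ∨ ¬ (s : ℤ) ∣ q.1 - ℓ) :
    classSum s r ℓ L = (coefAt ℓ L : ZMod n) * ((r ^ ℓ : (ZMod n)ˣ) : ZMod n) := by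
  induction L with
  | nil => simp [classSum, coefAt]
  | cons p L ih =>
    rw [classSum_cons, ih fun q hq => h q (List.mem_cons_of_mem _ hq), coefAt_cons]
    rcases h p List.mem_cons_self with e | e
    · simp [e, add_mul]
    · have : p.1 ≠ ℓ := by rintro rfl; simp at e
      simp [e, this]

theorem HasIsolated.exists_dvd {A : List ℤ} {w : List Letter} (h : HasIsolated s A w)
    (hw : ClosedWord m s r w) : ∃ c ∈ A, (n : ℤ) ∣ c := by
  obtain ⟨p, -, h1, h2⟩ := h
  refine ⟨_, h2, ?_⟩
  have := hw.2 p.1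
  rw [classSum_of_isolated _ _ h1, Units.mul_left_eq_zero] at this
  exact (ZMod.intCast_zmod_eq_zero_iff_dvd _ n).1 this

/-- A word that meets each of its levels with the same coefficient, a multiple of `n`, is closed. -/
theorem closedWord_of_coefAt {w : List Letter} (c : ℤ) (hc : (n : ℤ) ∣ c) (h0 : height w = 0)
    (h : ∀ p ∈ crossings 0 w, coefAt p.1 (crossings 0 w) = c) : ClosedWord m s r w := by
  refine ⟨h0 ▸ dvd_zero _, fun ℓ => ?_⟩
  rw [classSum_eq_sum ℓ _ ((crossings 0 w).map Prod.fst).toFinset (fun p hp => by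
    simp only [List.mem_toFinset, List.mem_map]; exact ⟨p, hp, rfl⟩)]
  refine Finset.sum_eq_zero fun j hj => ?_
  simp only [List.mem_toFinset, List.mem_map] at hj
  obtain ⟨p, hp, rfl⟩ := hj
  rw [h p hp, (ZMod.intCast_zmod_eq_zero_iff_dvd _ n).2 hc]
  simp

theorem evalList_intCast (T : ℤ) (cs : List ℤ) :
    evalList (T : ZMod n) cs = ((evalList T cs : ℤ) : ZMod n) := by
  induction cs with
  | nil => simp [evalList]
  | cons c cs ih => simp [evalList, ih]

theorem crossings_bound (l : ℤ) (w : List Letter) :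
    ∀ p ∈ crossings l w, l - w.length ≤ p.1 ∧ p.1 < l + w.length := by
  induction w generalizing l with
  | nil => simp [crossings]
  | cons c w ih =>
    intro p hp
    simp only [crossings, List.mem_cons] at hp
    rcases hp with rfl | hp
    · rcases c with ⟨_ | _, _⟩ <;> simp [edgeLevel] <;> omega
    · have := ih _ p hp
      rcases c with ⟨_ | _, _⟩ <;> simp [sgn] at this ⊢ <;> omega

theorem crossings_sub_bound (l : ℤ) (w : List Letter) :
    ∀ p ∈ crossings l w, ∀ q ∈ crossings l w, q.1 - p.1 < w.length := by
  induction w generalizing l with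
  | nil => simp [crossings]
  | cons c w ih =>
    intro p hp q hq
    simp only [crossings, List.mem_cons] at hp hq
    rcases hp with rfl | hp <;> rcases hq with rfl | hq
    · simp
    · have := crossings_bound _ _ q hq
      rcases c with ⟨_ | _, _⟩ <;> simp [sgn, edgeLevel] at this ⊢ <;> omega
    · have := crossings_bound _ _ p hp
      rcases c with ⟨_ | _, _⟩ <;> simp [sgn, edgeLevel] at this ⊢ <;> omega
    · have := ih _ p hp q hq
      simp; omega

theorem abs_height_le (w : List Letter) : |height w| ≤ w.length := by
  induction w with
  | nil => simp [height]
  | cons c w ih =>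
    have : height (c :: w) = sgn c.1 + height w := by simp [height]
    rw [this, abs_le] at *
    rcases c with ⟨_ | _, _⟩ <;> simp [sgn] <;> omega

/-- For words of length at most 8, all moduli `s ≥ 9` behave alike. -/
theorem HasIsolated.of_nine_le {A : List ℤ} {w : List Letter} (hw : w.length ≤ 8) (hs : 9 ≤ s)
    (h : HasIsolated 9 A w) : HasIsolated s A w := by
  obtain ⟨p, hp, h1, h2⟩ := h
  refine ⟨p, hp, fun q hq => ?_, h2⟩
  by_cases e : q.1 = p.1
  · exact Or.inl e
  right
  intro hd
  have b1 := crossings_sub_bound 0 w p hp q hq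
  have b2 := crossings_sub_bound 0 w q hq p hp
  have := Int.eq_zero_of_abs_lt_dvd hd (by rw [abs_lt]; omega)
  omega

theorem hasIsolated_of_forall {A : List ℤ} {w : List Letter} (hw : w.length ≤ 8) (s₀ : ℕ)
    (hs : s₀ ≤ s)
    (h : ∀ t ∈ List.range 10, s₀ ≤ t → (t : ℤ) ∣ height w → HasIsolated t A w)
    (h₀ : s₀ ≤ 9) (hd : (s : ℤ) ∣ height w) : HasIsolated s A w := by
  rcases Nat.lt_or_ge s 10 with h10 | h10
  · exact h s (List.mem_range.2 h10) hs hd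
  · have b := abs_height_le w
    have h0 := Int.eq_zero_of_abs_lt_dvd hd (by omega)
    exact HasIsolated.of_nine_le hw (by omega) (h 9 (by simp) h₀ (by simp [h0]))

theorem ClosedWord.dvd_height {w : List Letter} (h : ClosedWord m s r w) :
    (s : ℤ) ∣ height w := by
  refine dvd_trans ?_ h.1
  exact_mod_cast Dvd.intro_left m rfl

theorem evalList_range (T : ZMod n) (f : ℕ → ℤ) :
    evalList T ((List.range 9).map f) = ∑ k ∈ Finset.range 9, (f k : ZMod n) * T ^ k := by
  simp only [show List.range 9 = [0, 1, 2, 3, 4, 5, 6, 7, 8] from rfl, List.map_cons,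
    List.map_nil, evalList, Finset.sum_range_succ, Finset.sum_range_zero]
  ring

/-- The displacement of a short word in the class of `ℓ` is, up to a unit, the value of `classPoly`
at `r ^ s`. -/
theorem classSum_eq_evalList (hs : 2 ≤ s) (ℓ : ℤ) (h0 : 0 ≤ ℓ) (h1 : ℓ < s) (L : List (ℤ × ℤ))
    (hL : ∀ p ∈ L, -8 ≤ p.1 ∧ p.1 < 8) :
    classSum s r ℓ L = ((r ^ (ℓ - 4 * s) : (ZMod n)ˣ) : ZMod n) *
      evalList ((r : ZMod n) ^ s) (classPoly s ℓ L) := by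
  rw [classPoly, evalList_range]
  induction L with
  | nil => simp [classSum, coefAt]
  | cons p L ih =>
    rw [classSum_cons, ih fun q hq => hL q (List.mem_cons_of_mem _ hq)]
    simp only [coefAt_cons, Int.cast_add, add_mul, Finset.sum_add_distrib, mul_add]
    congr 1
    obtain ⟨b1, b2⟩ := hL p List.mem_cons_self
    split_ifs with hd
    · obtain ⟨q, hq⟩ := hd
      have hs' : (2 : ℤ) ≤ s := by exact_mod_cast hs
      have q1 : -4 ≤ q := by nlinarith
      have q2 : q ≤ 4 := by nlinarith
      rw [Finset.sum_eq_single (q + 4).toNat]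
      · have e : (((q + 4).toNat : ℕ) : ℤ) = q + 4 := Int.toNat_of_nonneg (by omega)
        have e1 : p.1 = ℓ + s * ((((q + 4).toNat : ℕ) : ℤ) - 4) := by rw [e]; linarith
        rw [if_pos e1]
        have e2 : p.1 = (ℓ - 4 * s) + s * (((q + 4).toNat : ℕ) : ℤ) := by rw [e]; linarith
        rw [e2, zpow_add, zpow_mul, zpow_natCast, zpow_natCast]
        push_cast
        ring
      · intro k _ hk
        rw [if_neg]
        · simp
        · intro e
          apply hk
          have : (s : ℤ) * q = s * ((k : ℤ) - 4) := by linarith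
          have := mul_left_cancel₀ (by omega) this
          omega
      · intro hk
        exact absurd (Finset.mem_range.2 (by omega)) hk
    · rw [Finset.sum_eq_zero, mul_zero]
      intro k _
      rw [if_neg]
      · simp
      · intro e
        exact hd ⟨(k : ℤ) - 4, by linarith⟩

theorem ClosedWord.evalList_eq_zero {w : List Letter} (h : ClosedWord m s r w) (hw : w.length ≤ 8)
    (hs : 2 ≤ s) (ℓ : ℤ) (h0 : 0 ≤ ℓ) (h1 : ℓ < s) :
    evalList ((r : ZMod n) ^ s) (classPoly s ℓ (crossings 0 w)) = 0 := by
  have h2 := h.2 ℓ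
  rw [classSum_eq_evalList hs ℓ h0 h1] at h2
  · rwa [Units.mul_right_eq_zero] at h2
  · intro p hp
    have := crossings_bound 0 w p hp
    omega

theorem length_of_mem_nbWords {k : ℕ} {c : Letter} {w : List Letter} (h : w ∈ nbWords k c) :
    w.length = k := by
  induction k generalizing c w with
  | zero => simp [nbWords] at h; simp [h]
  | succ k ih =>
    obtain ⟨d, v, -, hv, rfl⟩ := mem_nbWords_succ.1 h
    simp [ih hv]

end Displacement

/-! ### Reflections -/

section Reflections

variable {m s n : ℕ} {r : (ZMod n)ˣ}

/-- Negation of the coordinate of the class of `ℓ` modulo `s`. -/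
def negClass (ℓ : ℤ) (v : Fin s → ZMod n) : Fin s → ZMod n :=
  fun i => if (s : ℤ) ∣ (i : ℤ) - ℓ then -v i else v i

theorem negClass_negClass (ℓ : ℤ) (v : Fin s → ZMod n) : negClass ℓ (negClass ℓ v) = v := by
  funext i; simp only [negClass]; split_ifs <;> simp

theorem negClass_add (ℓ : ℤ) (v w : Fin s → ZMod n) :
    negClass ℓ (v + w) = negClass ℓ v + negClass ℓ w := by
  funext i; simp only [negClass, Pi.add_apply]; split_ifs
  · ring
  · rfl

theorem negClass_smul_levelVec (ℓ j : ℤ) (e : Bool) :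
    negClass ℓ (sgn e • levelVec r j : Fin s → ZMod n) =
      sgn (if (s : ℤ) ∣ j - ℓ then !e else e) • levelVec r j := by
  funext i
  simp only [negClass, Pi.smul_apply]
  by_cases hi : (i : ℤ) = j % s
  · have : (s : ℤ) ∣ (i : ℤ) - ℓ ↔ (s : ℤ) ∣ j - ℓ := by
      have h1 : (s : ℤ) ∣ j - i := by rw [hi]; exact Int.dvd_self_sub_emod
      rw [show j - ℓ = (j - i) + (i - ℓ) by ring]
      exact (dvd_add_right h1).symm
    simp only [this]
    split_ifs <;> simp [sgn_not]
  · simp [levelVec, hi]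

theorem negClass_move (ℓ : ℤ) (x : ℤ × (Fin s → ZMod n)) (c : Letter) :
    ((move r x c).1, negClass ℓ (move r x c).2) =
      move r (x.1, negClass ℓ x.2)
        (c.1, if (s : ℤ) ∣ edgeLevel x.1 c.1 - ℓ then !c.2 else c.2) := by
  simp only [move, negClass_add, negClass_smul_levelVec]

theorem exists_proj_eq (h : Admissible m s n r) (y : ZMod (m * s) × (Fin s → ZMod n)) :
    ∃ x, proj m x = y := by
  have : NeZero (m * s) := ⟨h.mul_pos.ne'⟩
  exact ⟨((y.1.val : ℤ), y.2), by simp [proj]⟩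

/-- The reflection of `CPMBar` in a coordinate hyperplane. -/
def flipIso (h : Admissible m s n r) (ℓ : ℤ) : CPMBar m s n r ≃g CPMBar m s n r where
  toFun y := (y.1, negClass ℓ y.2)
  invFun y := (y.1, negClass ℓ y.2)
  left_inv y := by simp [negClass_negClass]
  right_inv y := by simp [negClass_negClass]
  map_rel_iff' := by
    have key : ∀ y z, (CPMBar m s n r).Adj y z →
        (CPMBar m s n r).Adj (y.1, negClass ℓ y.2) (z.1, negClass ℓ z.2) := by
      intro y z hyz
      obtain ⟨x, rfl⟩ := exists_proj_eq h y
      obtain ⟨c, rfl⟩ := (adj_proj_iff h _ _).1 hyz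
      exact (adj_proj_iff h (x.1, negClass ℓ x.2) _).2
        ⟨_, congrArg (proj m) (negClass_move ℓ x c).symm⟩
    intro y z
    refine ⟨fun hyz => ?_, key y z⟩
    have := key _ _ hyz
    simpa [negClass_negClass] using this

theorem flipIso_proj (h : Admissible m s n r) (ℓ : ℤ) (x : ℤ × (Fin s → ZMod n)) :
    flipIso h ℓ (proj m x) = proj m (x.1, negClass ℓ x.2) := rfl

/-- A word all of whose edges lie outside the class of `ℓ` is fixed by the reflection. -/
theorem negClass_run (ℓ : ℤ) (w : List Letter) (x : ℤ × (Fin s → ZMod n))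
    (hx : negClass ℓ x.2 = x.2)
    (hw : ∀ p ∈ crossings x.1 w, ¬ (s : ℤ) ∣ p.1 - ℓ) :
    negClass ℓ (run r x w).2 = (run r x w).2 := by
  induction w generalizing x with
  | nil => exact hx
  | cons c w ih =>
    rw [run_cons]
    have hc := hw (edgeLevel x.1 c.1, sgn c.2) List.mem_cons_self
    refine ih _ ?_ (fun p hp => hw p (List.mem_cons_of_mem _ hp))
    have := congrArg Prod.snd (negClass_move (r := r) ℓ x c)
    simp only [if_neg hc, hx] at this
    exact this

theorem negClass_zero (ℓ : ℤ) : negClass ℓ (0 : Fin s → ZMod n) = 0 := by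
  funext i; simp [negClass]

/-- The reflection in the class of the edge following a word `w` interchanges the two straight
prolongations of `w`, provided that no other edge of `w` is in that class. -/
theorem flipIso_swap (h : Admissible m s n r) (w : List Letter) (u : Bool)
    (hw : ∀ p ∈ crossings 0 w, ¬ (s : ℤ) ∣ p.1 - edgeLevel (height w) u) :
    (∀ v, v <+: w → flipIso h (edgeLevel (height w) u) (proj m (run r 0 v)) =
      proj m (run r 0 v)) ∧
    flipIso h (edgeLevel (height w) u) (proj m (run r 0 (w ++ [(u, true)]))) =
      proj m (run r 0 (w ++ [(u, false)])) := by
  have hfix : ∀ v, v <+: w → negClass (edgeLevel (height w) u)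
      (run r (0 : ℤ × (Fin s → ZMod n)) v).2
      = (run r (0 : ℤ × (Fin s → ZMod n)) v).2 := by
    rintro v ⟨v', rfl⟩
    refine negClass_run _ v _ (negClass_zero _) fun p hp => hw p ?_
    have : ∀ l : ℤ, ∀ p ∈ crossings l v, p ∈ crossings l (v ++ v') := by
      clear hw hp
      induction v with
      | nil => simp [crossings]
      | cons c v ih =>
        intro l p hp
        simp only [crossings, List.cons_append, List.mem_cons] at hp ⊢
        exact hp.imp id (ih _ _)
    exact this 0 p hp
  refine ⟨fun v hv => ?_, ?_⟩
  · rw [flipIso_proj, hfix v hv]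
  · have hl : (run r (0 : ℤ × (Fin s → ZMod n)) w).1 = height w := by rw [run_eq]; simp
    rw [flipIso_proj, run_append, run_append]
    have := negClass_move (r := r) (edgeLevel (height w) u) (run r (0 : ℤ × (Fin s → ZMod n)) w)
      (u, true)
    rw [hfix w (List.prefix_refl w)] at this
    simp only [hl, sub_self, dvd_zero, if_true, Bool.not_true] at this
    rw [show (height w, (run r (0 : ℤ × (Fin s → ZMod n)) w).2) = run r 0 w from
      Prod.ext hl.symm rfl] at this
    exact congrArg (proj m) this

end Reflections

/-! ### Comparing the prolongations of two 2-arcs -/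

/-- The word `p` followed by the letter `c` has a non-backtracking prolongation by `k` letters to a
closed word. -/
def Closable (m s : ℕ) {n : ℕ} (r : (ZMod n)ˣ) (k : ℕ) (p : List Letter) (c : Letter) : Prop :=
  ∃ w ∈ nbWords k c, ClosedWord m s r (p ++ c :: w)

/-- The word `p` followed by the letter `c` has at most one non-backtracking prolongation by `k`
letters to a closed word. -/
def AtMostOnceClosable (m s : ℕ) {n : ℕ} (r : (ZMod n)ˣ) (k : ℕ) (p : List Letter) (c : Letter) :
    Prop :=
  ∀ w ∈ nbWords k c, ∀ w' ∈ nbWords k c, ClosedWord m s r (p ++ c :: w) →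
    ClosedWord m s r (p ++ c :: w') → w = w'

section Comparison

variable {m s n : ℕ} {r : (ZMod n)ˣ}

theorem proj_run_letter_mem (h : Admissible m s n r) (c : Letter) :
    proj m (run r 0 [c]) ∈ (CPMComponent m s n r).supp := by
  have h0 : proj m (0 : ℤ × (Fin s → ZMod n)) ∈ (CPMComponent m s n r).supp := by
    have : proj m (0 : ℤ × (Fin s → ZMod n)) = (0, 0) := by simp [proj]
    rw [this]
    exact SimpleGraph.ConnectedComponent.connectedComponentMk_mem
  exact (SimpleGraph.ConnectedComponent.mem_supp_congr_adj _
    ((adj_proj_iff h _ _).2 ⟨c, rfl⟩)).1 h0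

theorem exists_iso_words (h : Admissible m s n r) (hT : IsTwoArcTransitive (CPM m s n r))
    (c c' : Letter) (i j : Fin 3) :
    ∃ φ : CPMBar m s n r ≃g CPMBar m s n r, φ (proj m 0) = proj m 0 ∧
      φ (proj m (run r 0 [c])) = proj m (run r 0 [c']) ∧
      φ (proj m (run r 0 [c, nextLetter c i])) = proj m (run r 0 [c', nextLetter c' j]) :=
  exists_iso_of_isTwoArcTransitive hT (proj_run_letter_mem h c) (proj_run_letter_mem h c')
    (isTwoArc_run h 0 c i) (isTwoArc_run h 0 c' j)

/-- In a 2-arc-transitive `CPM`, the 2-arcs at the base point have, up to order, the same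
prolongations, as far as a property of their closings is concerned that is invariant under
automorphisms. -/
theorem exists_perm_closings (h : Admissible m s n r) (hT : IsTwoArcTransitive (CPM m s n r))
    (F : Set (List (ZMod (m * s) × (Fin s → ZMod n))) → Prop)
    (hF : ∀ (φ : CPMBar m s n r ≃g CPMBar m s n r) k a u v,
      F (closings (CPMBar m s n r) k (φ a) (φ u) (φ v)) ↔ F (closings (CPMBar m s n r) k a u v))
    (k : ℕ) (c c' : Letter) (i j : Fin 3) :
    ∃ σ : Equiv.Perm (Fin 3), ∀ t,
      F (closings (CPMBar m s n r) k (proj m 0) (proj m (run r 0 [c, nextLetter c i]))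
        (proj m (run r 0 ([c, nextLetter c i] ++ [nextLetter (nextLetter c i) t])))) ↔
      F (closings (CPMBar m s n r) k (proj m 0) (proj m (run r 0 [c', nextLetter c' j]))
        (proj m (run r 0 ([c', nextLetter c' j] ++ [nextLetter (nextLetter c' j) (σ t)])))) := by
  obtain ⟨φ, e0, e1, e2⟩ := exists_iso_words h hT c c' i j
  obtain ⟨σ, hσ⟩ := exists_perm_extensions (isExtensions_run h 0 [c] (nextLetter c i))
    (isExtensions_run h 0 [c'] (nextLetter c' j)) φ e1 e2
  refine ⟨σ, fun t => ?_⟩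
  rw [← hF φ, e0, e2]
  exact iff_of_eq (congrArg F (congrArg _ (hσ t)))

theorem exists_perm_closable (h : Admissible m s n r) (hT : IsTwoArcTransitive (CPM m s n r))
    (k : ℕ) (c c' : Letter) (i j : Fin 3) :
    ∃ σ : Equiv.Perm (Fin 3), ∀ t,
      Closable m s r k [c, nextLetter c i] (nextLetter (nextLetter c i) t) ↔
      Closable m s r k [c', nextLetter c' j] (nextLetter (nextLetter c' j) (σ t)) := by
  obtain ⟨σ, hσ⟩ := exists_perm_closings h hT Set.Nonempty
    (fun φ k a u v => closings_map_nonempty φ k a u v) k c c' i j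
  refine ⟨σ, fun t => ?_⟩
  have := hσ t
  rwa [closings_run_nonempty h, closings_run_nonempty h] at this

/-- For `s ≥ 3` the reflections interchange the two straight prolongations of an upward 2-arc as
well as those of a 2-arc that turns. Hence an invariant property holds for the turning
prolongations of both, or of none, and likewise for the straight ones. -/
theorem closings_iff_of_three_le (h : Admissible m s n r)
    (hT : IsTwoArcTransitive (CPM m s n r)) (hs : 3 ≤ s)
    (F : Set (List (ZMod (m * s) × (Fin s → ZMod n))) → Prop)
    (hF : ∀ (φ : CPMBar m s n r ≃g CPMBar m s n r) k a u v,
      F (closings (CPMBar m s n r) k (φ a) (φ u) (φ v)) ↔ F (closings (CPMBar m s n r) k a u v))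
    (k : ℕ) (i : Fin 2) :
    F (closings (CPMBar m s n r) k (proj m 0) (proj m (run r 0 [(true, true), (false, true)]))
        (proj m (run r 0 ([(true, true), (false, true)] ++
          [nextLetter (false, true) i.castSucc])))) ↔
      F (closings (CPMBar m s n r) k (proj m 0) (proj m (run r 0 [(true, true), (true, true)]))
        (proj m (run r 0 ([(true, true), (true, true)] ++
          [nextLetter (true, true) i.castSucc])))) := by
  obtain ⟨σ, hσ⟩ := exists_perm_closings h hT F hF k (true, true) (true, true) 0 1
  have hsd : ∀ d : ℤ, 0 < |d| → |d| < 3 → ¬ (s : ℤ) ∣ d := fun d h1 h2 hd => by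
    have := Int.eq_zero_of_abs_lt_dvd hd (by omega)
    simp [this] at h1
  have key : ∀ w : List Letter, ∀ u : Bool,
      (∀ p ∈ crossings 0 w, ¬ (s : ℤ) ∣ p.1 - edgeLevel (height w) u) →
      (F (closings (CPMBar m s n r) k (proj m 0) (proj m (run r 0 w))
        (proj m (run r 0 (w ++ [(u, true)])))) ↔
      F (closings (CPMBar m s n r) k (proj m 0) (proj m (run r 0 w))
        (proj m (run r 0 (w ++ [(u, false)]))))) := by
    intro w u hw
    obtain ⟨e1, e2⟩ := flipIso_swap h w u hw
    have e0 := e1 [] List.nil_prefix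
    rw [← hF (flipIso h (edgeLevel (height w) u)), e2, e1 w (List.prefix_refl w)]
    exact iff_of_eq (congrArg F (congrArg (fun a => closings _ k a _ _) e0))
  have := iff_of_perm_of_iff
    (p := fun t => F (closings (CPMBar m s n r) k (proj m 0)
      (proj m (run r 0 [(true, true), (false, true)]))
      (proj m (run r 0 ([(true, true), (false, true)] ++ [nextLetter (false, true) t])))))
    (q := fun t => F (closings (CPMBar m s n r) k (proj m 0)
      (proj m (run r 0 [(true, true), (true, true)]))
      (proj m (run r 0 ([(true, true), (true, true)] ++ [nextLetter (true, true) t])))))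
    σ hσ
    (key [(true, true), (false, true)] false (by
      intro p hp
      simp only [crossings, edgeLevel, sgn, List.mem_cons, List.not_mem_nil, or_false] at hp
      rcases hp with rfl | rfl <;> apply hsd <;> simp [edgeLevel, height, sgn]))
    (key [(true, true), (true, true)] true (by
      intro p hp
      simp only [crossings, edgeLevel, sgn, List.mem_cons, List.not_mem_nil, or_false] at hp
      rcases hp with rfl | rfl <;> apply hsd <;> simp [edgeLevel, height, sgn]))
  fin_cases i
  · exact this.1
  · exact this.2

theorem closable_iff_of_three_le (h : Admissible m s n r)
    (hT : IsTwoArcTransitive (CPM m s n r)) (hs : 3 ≤ s) (k : ℕ) (i : Fin 2) :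
    Closable m s r k [(true, true), (false, true)] (nextLetter (false, true) i.castSucc) ↔
      Closable m s r k [(true, true), (true, true)] (nextLetter (true, true) i.castSucc) := by
  have := closings_iff_of_three_le h hT hs Set.Nonempty
    (fun φ k a u v => closings_map_nonempty φ k a u v) k i
  rwa [closings_run_nonempty h, closings_run_nonempty h] at this

theorem atMostOnceClosable_iff_of_three_le (h : Admissible m s n r)
    (hT : IsTwoArcTransitive (CPM m s n r)) (hs : 3 ≤ s) (k : ℕ) (i : Fin 2) :
    AtMostOnceClosable m s r k [(true, true), (false, true)]
        (nextLetter (false, true) i.castSucc) ↔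
      AtMostOnceClosable m s r k [(true, true), (true, true)]
        (nextLetter (true, true) i.castSucc) := by
  have := closings_iff_of_three_le h hT hs Set.Subsingleton
    (fun φ k a u v => closings_map_subsingleton φ k a u v) k i
  rwa [closings_run_subsingleton h, closings_run_subsingleton h] at this

/-! ### Short closed words for `s ≥ 3` -/

/-- A word that turns all the time and closes up by going around `ℤ_n`. -/
theorem closable_zigzag {k : ℕ} (hk : k ∈ [4, 6, 8]) (hn : n ∣ k) :
    Closable m s r (k - 3) [(true, true), (false, true)] (true, true) := by
  simp only [List.mem_cons, List.not_mem_nil, or_false] at hk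
  rcases hk with rfl | rfl | rfl
  · exact ⟨[(false, true)], by decide,
      closedWord_of_coefAt 4 (by exact_mod_cast hn) (by decide) (by decide)⟩
  · exact ⟨[(false, true), (true, true), (false, true)], by decide,
      closedWord_of_coefAt 6 (by exact_mod_cast hn) (by decide) (by decide)⟩
  · exact ⟨[(false, true), (true, true), (false, true), (true, true), (false, true)], by decide,
      closedWord_of_coefAt 8 (by exact_mod_cast hn) (by decide) (by decide)⟩

/-- Closed 8-walks that exist for all parameters: up to the starting point, they are commutators of
double steps in two adjacent levels. -/
theorem closedWord_generic :
    ClosedWord m s r [(true, true), (true, true), (false, true), (false, false), (true, false),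
      (true, false), (false, false), (false, true)] ∧
    ClosedWord m s r [(true, true), (false, true), (false, true), (true, true), (true, false),
      (false, false), (false, false), (true, false)] ∧
    ClosedWord m s r [(true, true), (false, true), (false, false), (true, false), (true, false),
      (false, false), (false, true), (true, true)] := by
  refine ⟨closedWord_of_coefAt 0 (dvd_zero _) ?_ ?_, closedWord_of_coefAt 0 (dvd_zero _) ?_ ?_,
    closedWord_of_coefAt 0 (dvd_zero _) ?_ ?_⟩ <;> decide

theorem closable_up_up_turn : Closable m s r 5 [(true, true), (true, true)] (false, true) :=
  ⟨[(false, false), (true, false), (true, false), (false, false), (false, true)], by decide,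
    closedWord_generic.1⟩

theorem closable_turn_straight (e : Bool) :
    Closable m s r 5 [(true, true), (false, true)] (false, e) := by
  cases e
  · exact ⟨_, by decide, closedWord_generic.2.2⟩
  · exact ⟨_, by decide, closedWord_generic.2.1⟩

theorem not_closable_up_up_turn_four (hs : 3 ≤ s) (hn : n = 4) :
    ¬ Closable m s r 1 [(true, true), (true, true)] (false, true) := by
  rintro ⟨w, hw, hc⟩
  have key : ∀ w ∈ nbWords 1 (false, true), ∀ t ∈ List.range 10, 3 ≤ t →
      (t : ℤ) ∣ height ([(true, true), (true, true)] ++ (false, true) :: w) →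
      HasIsolated t [1, -1, 2, -2] ([(true, true), (true, true)] ++ (false, true) :: w) := by
    decide +kernel
  obtain ⟨c, hc, hd⟩ := (hasIsolated_of_forall (by simp [length_of_mem_nbWords hw]) 3 hs
    (key w hw) (by norm_num) hc.dvd_height).exists_dvd hc
  rw [hn] at hd
  revert hd
  revert c
  decide

theorem not_closable_up_up_turn_six (hs : 3 ≤ s) (hn : n = 3 ∨ n = 6) :
    ¬ Closable m s r 3 [(true, true), (true, true)] (false, true) := by
  rintro ⟨w, hw, hc⟩
  have key : ∀ w ∈ nbWords 3 (false, true), ∀ t ∈ List.range 10, 3 ≤ t →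
      (t : ℤ) ∣ height ([(true, true), (true, true)] ++ (false, true) :: w) →
      HasIsolated t [1, -1, 2, -2, 4, -4]
        ([(true, true), (true, true)] ++ (false, true) :: w) := by
    decide +kernel
  obtain ⟨c, hc, hd⟩ := (hasIsolated_of_forall (by simp [length_of_mem_nbWords hw]) 3 hs
    (key w hw) (by norm_num) hc.dvd_height).exists_dvd hc
  revert hd
  revert c
  rcases hn with hn | hn <;> rw [hn] <;> decide

/-- Apart from small `n`, no closed 8-walk begins with two turns. For `s ≥ 4` every candidate has an
isolated class; for `s = 3` the displacements in two of the three classes exclude the candidates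
without one. -/
theorem not_closable_zigzag (h : Admissible m s n r) (hs : 3 ≤ s) (h3 : n ≠ 3) (h4 : n ≠ 4)
    (h6 : n ≠ 6) (h8 : n ≠ 8) :
    ¬ Closable m s r 5 [(true, true), (false, true)] (true, true) := by
  have hn : ∀ c ∈ [1, -1, 2, -2, 4, -4, 6, -6, 8, (-8 : ℤ)], ¬ (n : ℤ) ∣ c := by
    have h1 := h.three_le
    intro c hc hd
    have hle : n ≤ 8 := by
      have : n ∣ c.natAbs := Int.natCast_dvd.1 hd
      have h2 := Nat.le_of_dvd (by
        simp only [List.mem_cons, List.not_mem_nil, or_false] at hc; omega) this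
      simp only [List.mem_cons, List.not_mem_nil, or_false] at hc; omega
    revert hc hd
    interval_cases n <;> first | omega | (revert c; decide)
  rintro ⟨w, hw, hc⟩
  have hlen : ([(true, true), (false, true)] ++ (true, true) :: w).length ≤ 8 := by
    simp [length_of_mem_nbWords hw]
  rcases hs.eq_or_lt with rfl | hs4
  · have key : ∀ w ∈ nbWords 5 (true, true),
        (3 : ℤ) ∣ height ([(true, true), (false, true)] ++ (true, true) :: w) →
        HasIsolated 3 [1, -1, 2, -2, 4, -4, 6, -6, 8, -8]
          ([(true, true), (false, true)] ++ (true, true) :: w) ∨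
        ∃ a ∈ [1, -1], ∃ b ∈ [1, -1], ∃ c ∈ [1, -1],
          classPoly 3 0 (crossings 0 ([(true, true), (false, true)] ++ (true, true) :: w)) =
            [0, 0, 0, 0, 3, a, 0, 0, 0] ∧
          classPoly 3 1 (crossings 0 ([(true, true), (false, true)] ++ (true, true) :: w)) =
            [0, 0, 0, 0, b, c, 0, 0, 0] := by
      decide +kernel
    rcases key w hw hc.dvd_height with hk | ⟨a, ha, b, hb, c, hc', e0, e1⟩
    · obtain ⟨c, hc, hd⟩ := hk.exists_dvd hc
      exact hn c hc hd
    · have p0 := hc.evalList_eq_zero hlen (by norm_num) 0 le_rfl (by norm_num)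
      have p1 := hc.evalList_eq_zero hlen (by norm_num) 1 (by norm_num) (by norm_num)
      rw [e0] at p0
      rw [e1] at p1
      simp only [evalList] at p0 p1
      have hu : IsUnit ((r : ZMod n) ^ 3) := (r.isUnit).pow 3
      set T := (r : ZMod n) ^ 3
      have q0 : (3 : ZMod n) + a * T = 0 := by
        have : T ^ 4 * (3 + a * T) = 0 := by
          rw [← p0]; push_cast; ring
        exact (hu.pow 4).mul_right_eq_zero.1 this
      have q1 : (b : ZMod n) + c * T = 0 := by
        have : T ^ 4 * (b + c * T) = 0 := by
          rw [← p1]; push_cast; ring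
        exact (hu.pow 4).mul_right_eq_zero.1 this
      have q2 : ((3 * c - a * b : ℤ) : ZMod n) = 0 := by
        push_cast
        linear_combination (c : ZMod n) * q0 - (a : ZMod n) * q1
      rw [ZMod.intCast_zmod_eq_zero_iff_dvd] at q2
      refine hn _ ?_ q2
      clear q2 q1 q0 p1 p0 e0 e1
      revert a b c
      decide
  · have key : ∀ w ∈ nbWords 5 (true, true), ∀ t ∈ List.range 10, 4 ≤ t →
        (t : ℤ) ∣ height ([(true, true), (false, true)] ++ (true, true) :: w) →
        HasIsolated t [1, -1, 2, -2, 4, -4, 6, -6, 8, -8]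
          ([(true, true), (false, true)] ++ (true, true) :: w) := by
      decide +kernel
    obtain ⟨c, hc, hd⟩ := (hasIsolated_of_forall hlen 4 hs4
      (key w hw) (by norm_num) hc.dvd_height).exists_dvd hc
    exact hn c hc hd

theorem eq_four_of_closable_up_up_up (hs : 4 ≤ s) (hn : n = 8)
    (hc : Closable m s r 5 [(true, true), (true, true)] (true, true)) : s = 4 ∧ m * s ∣ 8 := by
  obtain ⟨w, hw, hc⟩ := hc
  have hlen : ([(true, true), (true, true)] ++ (true, true) :: w).length ≤ 8 := by
    simp [length_of_mem_nbWords hw]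
  have hno : ¬ HasIsolated s [1, -1, 2, -2, 3, -3, 4, -4]
      ([(true, true), (true, true)] ++ (true, true) :: w) := by
    intro hi
    obtain ⟨c, hc, hd⟩ := hi.exists_dvd hc
    subst hn
    revert hd
    revert c
    decide
  rcases hs.eq_or_lt with rfl | hs5
  · have key : ∀ w ∈ nbWords 5 (true, true),
        (4 : ℤ) ∣ height ([(true, true), (true, true)] ++ (true, true) :: w) →
        HasIsolated 4 [1, -1, 2, -2, 3, -3, 4, -4]
          ([(true, true), (true, true)] ++ (true, true) :: w) ∨
        height ([(true, true), (true, true)] ++ (true, true) :: w) = 8 := by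
      decide +kernel
    refine ⟨rfl, ?_⟩
    have e := (key w hw hc.dvd_height).resolve_left hno
    have := hc.1
    rw [e] at this
    exact_mod_cast this
  · have key : ∀ w ∈ nbWords 5 (true, true), ∀ t ∈ List.range 10, 5 ≤ t →
        (t : ℤ) ∣ height ([(true, true), (true, true)] ++ (true, true) :: w) →
        HasIsolated t [1, -1, 2, -2, 3, -3, 4, -4]
          ([(true, true), (true, true)] ++ (true, true) :: w) := by
      decide +kernel
    exact absurd (hasIsolated_of_forall hlen 5 hs5 (key w hw) (by norm_num) hc.dvd_height) hno

theorem eight_dvd_evalList {T : ℤ} {s : ℕ} (hs : 2 ≤ s) {r : (ZMod 8)ˣ}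
    (hT : (r : ZMod 8) ^ s = T) {w : List Letter} (hlen : w.length ≤ 8)
    (h : ClosedWord m s r w) (ℓ : ℤ) (h0 : 0 ≤ ℓ) (h1 : ℓ < s) :
    (8 : ℤ) ∣ evalList T (classPoly s ℓ (crossings 0 w)) := by
  have := h.evalList_eq_zero hlen hs ℓ h0 h1
  rw [hT, evalList_intCast, ZMod.intCast_zmod_eq_zero_iff_dvd] at this
  exact_mod_cast this

/-- For `n = 8` and `s = 3` the only closed 8-walk that begins with two given turns goes around
`ℤ_8`. -/
theorem atMostOnceClosable_zigzag {r : (ZMod 8)ˣ} :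
    AtMostOnceClosable m 3 r 5 [(true, true), (false, true)] (true, true) := by
  have hT : ∃ T ∈ [1, 3, 5, (7 : ℤ)], (r : ZMod 8) ^ 3 = T := by
    revert r; decide
  obtain ⟨T, hT, e⟩ := hT
  have key : ∀ T ∈ [1, 3, 5, (7 : ℤ)], ∀ w ∈ nbWords 5 (true, true),
      (3 : ℤ) ∣ height ([(true, true), (false, true)] ++ (true, true) :: w) →
      (8 : ℤ) ∣ evalList T (classPoly 3 0
        (crossings 0 ([(true, true), (false, true)] ++ (true, true) :: w))) →
      (8 : ℤ) ∣ evalList T (classPoly 3 1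
        (crossings 0 ([(true, true), (false, true)] ++ (true, true) :: w))) →
      (8 : ℤ) ∣ evalList T (classPoly 3 2
        (crossings 0 ([(true, true), (false, true)] ++ (true, true) :: w))) →
      w = [(false, true), (true, true), (false, true), (true, true), (false, true)] := by
    decide +kernel
  have main : ∀ w ∈ nbWords 5 (true, true),
      ClosedWord m 3 r ([(true, true), (false, true)] ++ (true, true) :: w) →
      w = [(false, true), (true, true), (false, true), (true, true), (false, true)] := by
    intro w hw hc
    have hlen : ([(true, true), (false, true)] ++ (true, true) :: w).length ≤ 8 := by
      simp [length_of_mem_nbWords hw]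
    have hd := fun ℓ h0 h1 => eight_dvd_evalList (by norm_num) e hlen hc ℓ h0 h1
    exact key T hT w hw hc.dvd_height (hd 0 (by norm_num) (by norm_num))
      (hd 1 (by norm_num) (by norm_num)) (hd 2 (by norm_num) (by norm_num))
  intro w hw w' hw' hc hc'
  rw [main w hw hc, main w' hw' hc']

theorem atMostOnceClosable_turn_straight {r : (ZMod 8)ˣ} :
    AtMostOnceClosable m 4 r 5 [(true, true), (false, true)] (false, true) := by
  have hT : (r : ZMod 8) ^ 4 = (1 : ℤ) := by
    revert r; decide
  have key : ∀ w ∈ nbWords 5 (false, true),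
      (4 : ℤ) ∣ height ([(true, true), (false, true)] ++ (false, true) :: w) →
      (∀ ℓ ∈ [0, 1, 2, (3 : ℤ)], (8 : ℤ) ∣ evalList 1 (classPoly 4 ℓ
        (crossings 0 ([(true, true), (false, true)] ++ (false, true) :: w)))) →
      w = [(true, true), (true, false), (false, false), (false, false), (true, false)] := by
    decide +kernel
  have main : ∀ w ∈ nbWords 5 (false, true),
      ClosedWord m 4 r ([(true, true), (false, true)] ++ (false, true) :: w) →
      w = [(true, true), (true, false), (false, false), (false, false), (true, false)] := by
    intro w hw hc
    have hlen : ([(true, true), (false, true)] ++ (false, true) :: w).length ≤ 8 := by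
      simp [length_of_mem_nbWords hw]
    refine key w hw hc.dvd_height fun ℓ hℓ => ?_
    simp only [List.mem_cons, List.not_mem_nil, or_false] at hℓ
    exact eight_dvd_evalList (by norm_num) hT hlen hc ℓ (by omega) (by push_cast; omega)
  intro w hw w' hw' hc hc'
  rw [main w hw hc, main w' hw' hc']

theorem not_atMostOnceClosable_up_up_turn {r : (ZMod 8)ˣ} :
    ¬ AtMostOnceClosable m 3 r 5 [(true, true), (true, true)] (false, true) := by
  intro h
  have h1 := fun w hw hc => h _ (by decide : [(false, false), (true, false), (true, false),
    (false, false), (false, true)] ∈ nbWords 5 (false, true)) w hw closedWord_generic.1 hc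
  have hr : ∃ e : Bool, (sgn e : ZMod 8) * ((r ^ (-2 : ℤ) : (ZMod 8)ˣ) : ZMod 8) * 2 +
      ((r ^ (1 : ℤ) : (ZMod 8)ˣ) : ZMod 8) * 2 = 0 := by
    clear h1 h
    revert r; decide
  obtain ⟨e, hr⟩ := hr
  have hh : height ([(true, true), (true, true)] ++ (false, true) ::
      [(false, false), (false, false), (false, e), (true, e), (true, true)]) = 0 := rfl
  have hc : crossings 0 ([(true, true), (true, true)] ++ (false, true) ::
      [(false, false), (false, false), (false, e), (true, e), (true, true)]) =
      [(0, 1), (1, 1), (1, 1), (0, -1), (-1, -1), (-2, sgn e), (-2, sgn e), (-1, 1)] := by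
    cases e <;> decide
  have := h1 [(false, false), (false, false), (false, e), (true, e), (true, true)]
    (by cases e <;> decide) ⟨hh ▸ dvd_zero _, fun ℓ => ?_⟩
  · simp at this
  · have hd : ((3 : ℕ) : ℤ) ∣ -2 - ℓ ↔ ((3 : ℕ) : ℤ) ∣ 1 - ℓ := by push_cast; omega
    rw [hc]
    simp only [classSum, List.map_cons, List.map_nil, List.sum_cons, List.sum_nil, hd]
    split_ifs <;> push_cast <;> first | ring1 | linear_combination hr

theorem not_atMostOnceClosable_up_up_up {r : (ZMod 8)ˣ} (hm : m * 4 ∣ 8) :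
    ¬ AtMostOnceClosable m 4 r 5 [(true, true), (true, true)] (true, true) := by
  intro h
  have hr : r ^ 4 = 1 := by clear h; revert r; decide
  have closed : ∀ e : Bool, ClosedWord m 4 r ([(true, true), (true, true)] ++ (true, true) ::
      [(true, e), (true, false), (true, false), (true, false), (true, !e)]) := by
    intro e
    refine ⟨?_, fun ℓ => ?_⟩
    · have : height ([(true, true), (true, true)] ++ (true, true) ::
          [(true, e), (true, false), (true, false), (true, false), (true, !e)]) = 8 := rfl
      rw [this]; exact_mod_cast hm
    · have key : ∀ j : ℤ, ((4 : ℕ) : ℤ) ∣ j + 4 - ℓ ↔ ((4 : ℕ) : ℤ) ∣ j - ℓ := by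
        intro j; push_cast; omega
      have hp : ∀ j : ℤ, ((r ^ (j + 4) : (ZMod 8)ˣ) : ZMod 8) = ((r ^ j : (ZMod 8)ˣ) : ZMod 8) := by
        intro j
        rw [zpow_add, show r ^ (4 : ℤ) = 1 from by exact_mod_cast hr, mul_one]
      have hc : crossings 0 ([(true, true), (true, true)] ++ (true, true) ::
          [(true, e), (true, false), (true, false), (true, false), (true, !e)]) =
          [(0, 1), (1, 1), (2, 1), (3, sgn e), (0 + 4, -1), (1 + 4, -1), (2 + 4, -1),
            (3 + 4, -sgn e)] := by
        cases e <;> decide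
      rw [hc]
      simp only [classSum, List.map_cons, List.map_nil, List.sum_cons, List.sum_nil, key, hp]
      split_ifs <;> push_cast <;> ring
  have := h _ (by decide) _ (by decide) (closed true) (closed false)
  simp at this

/-- For `s ≥ 3` the graph is never 2-arc-transitive. -/
theorem not_isTwoArcTransitive_of_three_le (h : Admissible m s n r) (hs : 3 ≤ s) :
    ¬ IsTwoArcTransitive (CPM m s n r) := by
  intro hT
  have key : ∀ k, Closable m s r k [(true, true), (false, true)] (true, true) ↔
      Closable m s r k [(true, true), (true, true)] (false, true) :=
    fun k => closable_iff_of_three_le h hT hs k 0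
  by_cases h4 : n = 4
  · exact not_closable_up_up_turn_four hs h4
      ((key 1).1 (closable_zigzag (k := 4) (by decide) (by simp [h4])))
  by_cases h36 : n = 3 ∨ n = 6
  · refine not_closable_up_up_turn_six hs h36
      ((key 3).1 (closable_zigzag (k := 6) (by decide) ?_))
    rcases h36 with rfl | rfl <;> decide
  push Not at h36
  by_cases h8 : n = 8
  · subst h8
    rcases hs.eq_or_lt with rfl | hs4
    · exact not_atMostOnceClosable_up_up_turn
        ((atMostOnceClosable_iff_of_three_le h hT hs 5 0).1 atMostOnceClosable_zigzag)
    · have h1 := (closable_iff_of_three_le h hT hs 5 1).1 (closable_turn_straight true)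
      obtain ⟨rfl, hm⟩ := eq_four_of_closable_up_up_up hs4 rfl h1
      exact not_atMostOnceClosable_up_up_up hm
        ((atMostOnceClosable_iff_of_three_le h hT hs 5 1).1 atMostOnceClosable_turn_straight)
  · exact not_closable_zigzag h hs h36.1 h4 h36.2 h8 ((key 5).2 closable_up_up_turn)

end Comparison

/-! ### Short closed words for `s = 2` -/

/-- Removal of the zeros at both ends of a list of coefficients. -/
def trimZeros (cs : List ℤ) : List ℤ :=
  ((cs.dropWhile (· == 0)).reverse.dropWhile (· == 0)).reverse

/-- The trimmed relations `c₀ + c₁ t + … = 0` that cannot hold for `t = r ^ 2` unless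
`2 r ^ 2 = ±2`. -/
def ExcludedRelation : List ℤ → Prop
  | [c] => c.natAbs ∈ [1, 2, 3, 4, 5, 6, 8]
  | [a, b] => a.natAbs = b.natAbs ∧ a.natAbs ∈ [1, 2]
  | _ => False

instance (cs : List ℤ) : Decidable (ExcludedRelation cs) := by
  rcases cs with _ | ⟨a, _ | ⟨b, _ | ⟨c, cs⟩⟩⟩ <;> unfold ExcludedRelation <;> infer_instance

section TwoClasses

variable {m n : ℕ} {r : (ZMod n)ˣ}

theorem evalList_append_zeros {R : Type*} [CommRing R] (T : R) (cs ds : List ℤ)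
    (h : ∀ d ∈ ds, d = 0) : evalList T (cs ++ ds) = evalList T cs := by
  induction cs with
  | nil =>
    induction ds with
    | nil => rfl
    | cons d ds ih =>
      have := ih fun d hd => h d (List.mem_cons_of_mem _ hd)
      simp only [List.nil_append, evalList] at this ⊢
      rw [this, h d List.mem_cons_self]; simp
  | cons c cs ih => simp [evalList, ih]

theorem evalList_dropWhile {R : Type*} [CommRing R] {T : R} (hT : IsUnit T) (cs : List ℤ)
    (h : evalList T cs = 0) : evalList T (cs.dropWhile (· == 0)) = 0 := by
  induction cs with
  | nil => exact h
  | cons c cs ih =>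
    by_cases hc : c = 0
    · subst hc
      simp only [evalList, Int.cast_zero, zero_add] at h
      simpa using ih (hT.mul_right_eq_zero.1 h)
    · simpa [hc] using h

theorem evalList_trimZeros {R : Type*} [CommRing R] {T : R} (hT : IsUnit T) {cs : List ℤ}
    (h : evalList T cs = 0) : evalList T (trimZeros cs) = 0 := by
  have h1 := evalList_dropWhile hT cs h
  set ds := cs.dropWhile (· == 0)
  have e : ds = trimZeros cs ++ (ds.reverse.takeWhile (· == 0)).reverse := by
    rw [trimZeros, ← List.reverse_append, List.takeWhile_append_dropWhile, List.reverse_reverse]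
  rw [e, evalList_append_zeros] at h1
  · exact h1
  · intro d hd
    simpa using List.mem_takeWhile_imp (List.mem_reverse.1 hd)

/-- The relations `2 r ^ 2 = ±2`, under which there are 6-cycles as in the diamond lattice. -/
def IsDiamond {n : ℕ} (r : (ZMod n)ˣ) : Prop :=
  2 * (r : ZMod n) ^ 2 = 2 ∨ 2 * (r : ZMod n) ^ 2 = -2

theorem isDiamond_of_dvd (h3 : 3 ≤ n) {c : ℕ} (hc : c ∈ [1, 2, 3, 4, 5, 6, 8]) (hd : n ∣ c) :
    IsDiamond r := by
  have hle : n ≤ 8 := by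
    have := Nat.le_of_dvd (by
      simp only [List.mem_cons, List.not_mem_nil, or_false] at hc; omega) hd
    simp only [List.mem_cons, List.not_mem_nil, or_false] at hc; omega
  have h7 : n ≠ 7 := by
    rintro rfl
    revert hd; revert c; decide
  unfold IsDiamond
  clear hd hc
  interval_cases n
  · revert r; decide
  · revert r; decide
  · revert r; decide
  · revert r; decide
  · omega
  · revert r; decide

theorem ExcludedRelation.false (h3 : 3 ≤ n) (hA : ¬ IsDiamond r) {cs : List ℤ}
    (hcs : ExcludedRelation cs) (h : evalList ((r : ZMod n) ^ 2) cs = 0) : False := by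
  rcases cs with _ | ⟨a, _ | ⟨b, _ | ⟨c, cs⟩⟩⟩
  · exact hcs
  · simp only [evalList, mul_zero, add_zero] at h
    rw [ZMod.intCast_zmod_eq_zero_iff_dvd, Int.natCast_dvd] at h
    exact hA (isDiamond_of_dvd h3 hcs h)
  · apply hA
    simp only [evalList, mul_zero, add_zero] at h
    obtain ⟨h1, h2⟩ := hcs
    simp only [List.mem_cons, List.not_mem_nil, or_false] at h2
    have ha : a = 1 ∨ a = -1 ∨ a = 2 ∨ a = -2 := by omega
    have hb : b = a ∨ b = -a := by omega
    unfold IsDiamond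
    rcases hb with rfl | rfl <;> rcases ha with rfl | rfl | rfl | rfl <;> push_cast at h
    · right; linear_combination 2 * h
    · right; linear_combination -2 * h
    · right; linear_combination h
    · right; linear_combination -h
    · left; linear_combination -2 * h
    · left; linear_combination 2 * h
    · left; linear_combination -h
    · left; linear_combination h
  · exact hcs

/-- The trimmed relation that a closed word implies in the class `ℓ ∈ {0, 1}`. -/
def wordRelation (ℓ : ℤ) (w : List Letter) : List ℤ := trimZeros (classPoly 2 ℓ (crossings 0 w))

theorem ClosedWord.wordRelation_eq_zero {w : List Letter} (h : ClosedWord m 2 r w)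
    (hw : w.length ≤ 8) (ℓ : ℤ) (h0 : 0 ≤ ℓ) (h1 : ℓ < 2) :
    evalList ((r : ZMod n) ^ 2) (wordRelation ℓ w) = 0 :=
  evalList_trimZeros (r.isUnit.pow 2) (h.evalList_eq_zero hw le_rfl ℓ h0 (by exact_mod_cast h1))

theorem two_le_of_not_isDiamond (h : Admissible m 2 n r) (hA : ¬ IsDiamond r) : 2 ≤ m := by
  by_contra hm
  have := h.one_le
  obtain rfl : m = 1 := by omega
  apply hA
  rcases h.pow_eq with e | e
  · left; rw [show 1 * 2 = 2 from rfl] at e; rw [e]; ring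
  · right; rw [show 1 * 2 = 2 from rfl] at e; rw [e]; ring

theorem dvd_of_mul_two_dvd {m : ℕ} {a : ℤ} (h : ((m * 2 : ℕ) : ℤ) ∣ 2 * a) : (m : ℤ) ∣ a := by
  have : ((m * 2 : ℕ) : ℤ) = 2 * m := by push_cast; ring
  rw [this] at h
  exact (mul_dvd_mul_iff_left two_ne_zero).1 h

/-- The possible heights of a closed word of length at most 8, and the corresponding `m`. -/
theorem ClosedWord.height_cases {w : List Letter} (h : ClosedWord m 2 r w) (hw : w.length ≤ 8)
    (hm : 2 ≤ m) :
    height w = 0 ∨ (m = 2 ∧ (4 : ℤ) ∣ height w) ∨ (m = 3 ∧ (height w = 6 ∨ height w = -6)) ∨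
      (m = 4 ∧ (height w = 8 ∨ height w = -8)) := by
  obtain ⟨a, ha⟩ := h.dvd_height
  have b := abs_height_le w
  have h1 : (m : ℤ) ∣ a := dvd_of_mul_two_dvd (by have := h.1; rwa [ha] at this)
  rw [ha, abs_le] at b
  push_cast at ha b
  by_cases h0 : a = 0
  · left; rw [ha, h0]; rfl
  right
  have hle : m ≤ 4 := by
    have := Nat.le_of_dvd (by omega) (Int.natCast_dvd.1 h1)
    omega
  have hb : a = 1 ∨ a = -1 ∨ a = 2 ∨ a = -2 ∨ a = 3 ∨ a = -3 ∨ a = 4 ∨ a = -4 := by omega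
  interval_cases m
  · left; refine ⟨rfl, ?_⟩; omega
  · right; left; refine ⟨rfl, ?_⟩; omega
  · right; right; refine ⟨rfl, ?_⟩; omega

theorem not_closable_turn_four (h : Admissible m 2 n r) (hA : ¬ IsDiamond r) :
    ¬ Closable m 2 r 4 [(true, true)] (false, true) := by
  rintro ⟨w, hw, hc⟩
  have hlen : ([(true, true)] ++ (false, true) :: w).length ≤ 8 := by
    simp [length_of_mem_nbWords hw]
  have key : ∀ w ∈ nbWords 4 (false, true),
      (4 : ℤ) ∣ height ([(true, true)] ++ (false, true) :: w) →
      ExcludedRelation (wordRelation 0 ([(true, true)] ++ (false, true) :: w)) ∨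
      ExcludedRelation (wordRelation 1 ([(true, true)] ++ (false, true) :: w)) := by
    decide +kernel
  have key2 : ∀ w ∈ nbWords 4 (false, true),
      |height ([(true, true)] ++ (false, true) :: w)| ≤ 4 := by
    decide +kernel
  have h4 : (4 : ℤ) ∣ height ([(true, true)] ++ (false, true) :: w) := by
    have b := abs_le.1 (key2 w hw)
    rcases hc.height_cases hlen (two_le_of_not_isDiamond h hA) with e | ⟨-, e⟩ | ⟨-, e⟩ | ⟨-, e⟩
    · rw [e]; exact dvd_zero _
    · exact e
    · omega
    · omega
  rcases key w hw h4 with e | e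
  · exact e.false h.three_le hA (hc.wordRelation_eq_zero hlen 0 le_rfl two_pos)
  · exact e.false h.three_le hA (hc.wordRelation_eq_zero hlen 1 zero_le_one one_lt_two)

theorem closable_iff_closable_turn (h : Admissible m 2 n r)
    (hT : IsTwoArcTransitive (CPM m 2 n r)) (k : ℕ) :
    Closable m 2 r k [(true, true)] (false, true) ↔
      Closable m 2 r k [(true, true)] (true, true) := by
  obtain ⟨φ, e0, e1, e2⟩ := exists_iso_words h hT (true, true) (true, true) 0 1
  have := closings_map_nonempty φ k (proj m 0) (proj m (run r 0 [(true, true)]))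
    (proj m (run r 0 [(true, true), nextLetter (true, true) 0]))
  rw [e0, e1, e2] at this
  exact ((closings_run_nonempty h k 0 [(true, true)] (false, true)).symm.trans this.symm).trans
    (closings_run_nonempty h k 0 [(true, true)] (true, true))

theorem closedWord_of_straight {w : List Letter} {cs : List (ℤ × ℤ)}
    (h0 : ((m * 2 : ℕ) : ℤ) ∣ height w) (hc : crossings 0 w = cs)
    (h : (classSum 2 r 0 cs = 0) ∧ (classSum 2 r 1 cs = 0)) : ClosedWord m 2 r w := by
  refine ⟨h0, fun ℓ => ?_⟩
  rw [hc]
  rcases Int.emod_two_eq_zero_or_one ℓ with e | e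
  · rw [classSum_congr (ℓ' := 0) (by push_cast; omega)]; exact h.1
  · rw [classSum_congr (ℓ' := 1) (by push_cast; omega)]; exact h.2

/-- If `m = 3`, a relation `1 ± r ^ 2 ± r ^ 4 = 0` gives 6-cycles around the levels. -/
theorem closable_straight_four {a b : Bool}
    (h : 1 + (sgn a : ZMod n) * (r : ZMod n) ^ 2 + (sgn b : ZMod n) * ((r : ZMod n) ^ 2) ^ 2 = 0) :
    Closable 3 2 r 4 [(true, true)] (true, true) := by
  refine ⟨[(true, a), (true, a), (true, b), (true, b)], by cases a <;> cases b <;> decide,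
    closedWord_of_straight (cs := [(0, 1), (1, 1), (2, sgn a), (3, sgn a), (4, sgn b), (5, sgn b)])
      (by cases a <;> cases b <;> decide) (by cases a <;> cases b <;> decide) ⟨?_, ?_⟩⟩
  · simp [classSum]
    linear_combination h
  · simp [classSum]
    linear_combination (r : ZMod n) * h

/-- The trimmed relations `±(1 ± t ± t ^ 2)`. -/
def IsTernary (cs : List ℤ) : Prop :=
  ∃ a b : Bool, cs = [1, sgn a, sgn b] ∨ cs = [-1, sgn a, sgn b]

instance (cs : List ℤ) : Decidable (IsTernary cs) := by unfold IsTernary; infer_instance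

theorem not_evalList_of_isTernary (h : Admissible m 2 n r) (hA : ¬ IsDiamond r)
    (hT : IsTwoArcTransitive (CPM m 2 n r)) (hm : m = 3) {cs : List ℤ} (hcs : IsTernary cs) :
    evalList ((r : ZMod n) ^ 2) cs ≠ 0 := by
  intro e
  subst hm
  refine not_closable_turn_four h hA ((closable_iff_closable_turn h hT 4).2 ?_)
  obtain ⟨a, b, rfl | rfl⟩ := hcs
  · refine closable_straight_four (a := a) (b := b) ?_
    simp only [evalList] at e
    push_cast at e
    linear_combination e
  · refine closable_straight_four (a := !a) (b := !b) ?_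
    simp only [evalList] at e
    simp only [sgn_not]
    push_cast at e ⊢
    linear_combination -e

/-- The relations `2 + 4 σ r ^ 2 = 0` and `4 + 2 σ r ^ 2 = 0`, `σ = ±1`, under which there are
closed 8-walks that begin with two turns. -/
def IsSpecial {n : ℕ} (r : (ZMod n)ˣ) (e : Bool) : Prop :=
  2 + 4 * (sgn e : ZMod n) * (r : ZMod n) ^ 2 = 0 ∨ 4 + 2 * (sgn e : ZMod n) * (r : ZMod n) ^ 2 = 0

theorem sgn_cases (e : Bool) : sgn e = 1 ∨ sgn e = -1 := by cases e <;> simp [sgn]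

theorem isSpecial_of_mem {cs : List ℤ} {e : Bool}
    (hcs : cs ∈ [[2, 4 * sgn e], [-2, -4 * sgn e], [4, 2 * sgn e], [-4, -2 * sgn e]])
    (h : evalList ((r : ZMod n) ^ 2) cs = 0) : IsSpecial r e := by
  simp only [List.mem_cons, List.not_mem_nil, or_false] at hcs
  rcases hcs with rfl | rfl | rfl | rfl <;> simp only [evalList] at h <;> push_cast at h
  · left; linear_combination h
  · left; linear_combination -h
  · right; linear_combination h
  · right; linear_combination -h

theorem sq_eq_of_two (h : Admissible 2 2 n r) :
    ((r : ZMod n) ^ 2) ^ 2 = 1 ∨ ((r : ZMod n) ^ 2) ^ 2 = -1 := by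
  rw [← pow_mul]
  exact h.pow_eq

theorem natCast_dvd_of_eq_zero {c : ℤ} (h : (c : ZMod n) = 0) : n ∣ c.natAbs := by
  rw [ZMod.intCast_zmod_eq_zero_iff_dvd, Int.natCast_dvd] at h
  exact h

theorem not_five_dvd_of_isSpecial {e : Bool} (hS : IsSpecial r e) : ¬ 5 ∣ n := by
  intro hd
  have key : ∀ (x : ZMod 5) (e : Bool), IsUnit x → 2 + 4 * (sgn e : ZMod 5) * x ^ 2 ≠ 0 ∧
      4 + 2 * (sgn e : ZMod 5) * x ^ 2 ≠ 0 := by decide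
  have hu : IsUnit (ZMod.castHom hd (ZMod 5) r) := r.isUnit.map _
  rcases hS with hS | hS
  · refine (key _ e hu).1 ?_
    have := congrArg (ZMod.castHom hd (ZMod 5)) hS
    simpa only [map_add, map_mul, map_pow, map_ofNat, map_intCast, map_zero] using this
  · refine (key _ e hu).2 ?_
    have := congrArg (ZMod.castHom hd (ZMod 5)) hS
    simpa only [map_add, map_mul, map_pow, map_ofNat, map_intCast, map_zero] using this

theorem not_dvd_thirty_of_isSpecial (h3 : 3 ≤ n) (hA : ¬ IsDiamond r) {e : Bool}
    (hS : IsSpecial r e) : ¬ n ∣ 30 := by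
  intro hd
  have h5 := not_five_dvd_of_isSpecial hS
  have hc : n.Coprime 5 := Nat.Coprime.symm ((Nat.Prime.coprime_iff_not_dvd (by norm_num)).2 h5)
  have : n ∣ 6 := hc.dvd_of_dvd_mul_right (m := 6) (by simpa using hd)
  exact hA (isDiamond_of_dvd h3 (by decide : 6 ∈ _) this)

theorem not_isSpecial_of_two (h : Admissible 2 2 n r) (hA : ¬ IsDiamond r) {e : Bool} :
    ¬ IsSpecial r e := by
  intro hS
  apply not_dvd_thirty_of_isSpecial h.three_le hA hS
  unfold IsSpecial at hS
  have h2 := sq_eq_of_two h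
  set t := (r : ZMod n) ^ 2 with ht
  have h610 : n ∣ 6 ∨ n ∣ 10 := by
    rcases h2 with h2 | h2 <;> rcases hS with hS | hS
    · left
      refine natCast_dvd_of_eq_zero (c := 6) ?_
      rcases sgn_cases e with e | e <;> rw [e] at hS <;> push_cast at hS ⊢
      · linear_combination (2 * t - 1) * hS - 8 * h2
      · linear_combination (-2 * t - 1) * hS - 8 * h2
    · left
      refine natCast_dvd_of_eq_zero (c := -6) ?_
      rcases sgn_cases e with e | e <;> rw [e] at hS <;> push_cast at hS ⊢
      · linear_combination (t - 2) * hS - 2 * h2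
      · linear_combination (-t - 2) * hS - 2 * h2
    · right
      refine natCast_dvd_of_eq_zero (c := -10) ?_
      rcases sgn_cases e with e | e <;> rw [e] at hS <;> push_cast at hS ⊢
      · linear_combination (2 * t - 1) * hS - 8 * h2
      · linear_combination (-2 * t - 1) * hS - 8 * h2
    · right
      refine natCast_dvd_of_eq_zero (c := -10) ?_
      rcases sgn_cases e with e | e <;> rw [e] at hS <;> push_cast at hS ⊢
      · linear_combination (t - 2) * hS - 2 * h2
      · linear_combination (-t - 2) * hS - 2 * h2
  rcases h610 with h | h
  · exact h.trans (by norm_num)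
  · exact h.trans (by norm_num)

theorem not_dvd_ten_of_two (hA : ¬ IsDiamond r) (h : Admissible 2 2 n r) : ¬ n ∣ 10 := by
  intro hd
  have h3 := h.three_le
  have hle := Nat.le_of_dvd (by norm_num) hd
  have h5 := sq_eq_of_two h
  have h1 : n = 5 ∨ n = 10 := by interval_cases n <;> omega
  rcases h1 with rfl | rfl
  · exact hA (isDiamond_of_dvd h3 (by decide : 5 ∈ _) dvd_rfl)
  · unfold IsDiamond at hA
    clear h hd h3 hle
    revert r
    decide

/-- A closed 8-walk that begins with two turns requires a special relation. -/
theorem exists_isSpecial_of_closable (h : Admissible m 2 n r) (hA : ¬ IsDiamond r)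
    (hT : IsTwoArcTransitive (CPM m 2 n r))
    (hc : Closable m 2 r 5 [(true, true), (false, true)] (true, true)) : ∃ e, IsSpecial r e := by
  obtain ⟨w, hw, hc⟩ := hc
  have hlen : ([(true, true), (false, true)] ++ (true, true) :: w).length ≤ 8 := by
    simp [length_of_mem_nbWords hw]
  have hm := two_le_of_not_isDiamond h hA
  have r0 := hc.wordRelation_eq_zero hlen 0 le_rfl two_pos
  have r1 := hc.wordRelation_eq_zero hlen 1 zero_le_one one_lt_two
  have key : ∀ w ∈ nbWords 5 (true, true),
      (fun v => (ExcludedRelation (wordRelation 0 v) ∨ ExcludedRelation (wordRelation 1 v)) ∨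
        (height v = 0 ∧ ∃ e : Bool, wordRelation 0 v ∈
          [[2, 4 * sgn e], [-2, -4 * sgn e], [4, 2 * sgn e], [-4, -2 * sgn e]]) ∨
        ((4 : ℤ) ∣ height v ∧ height v ≠ 0 ∧ |height v| < 8 ∧
          wordRelation 0 v ∈ [[3, 1], [3, -1], [-3, 1], [-3, -1]]) ∨
        ((height v = 6 ∨ height v = -6) ∧ IsTernary (wordRelation 1 v)) ∨
        ((height v ≠ 6 ∧ height v ≠ -6 ∧ ¬ (4 : ℤ) ∣ height v) ∧ |height v| < 8))
        ([(true, true), (false, true)] ++ (true, true) :: w) := by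
    decide +kernel
  have key := key w hw
  beta_reduce at key
  have hh := hc.height_cases hlen hm
  set v := [(true, true), (false, true)] ++ (true, true) :: w
  rcases key with (e | e) | ⟨-, e, he⟩ | ⟨e, e0, e8, he⟩ | ⟨e, he⟩ | ⟨e, e8⟩
  · exact (e.false h.three_le hA r0).elim
  · exact (e.false h.three_le hA r1).elim
  · exact ⟨e, isSpecial_of_mem he r0⟩
  · rw [abs_lt] at e8
    obtain rfl : m = 2 := by omega
    have h2 := sq_eq_of_two h
    have h3 : ((r : ZMod n) ^ 2) ^ 2 = 9 := by
      simp only [List.mem_cons, List.not_mem_nil, or_false] at he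
      generalize (r : ZMod n) ^ 2 = t at *
      rcases he with he | he | he | he <;> rw [he] at r0 <;> simp only [evalList] at r0 <;>
        push_cast at r0
      · linear_combination (t - 3) * r0
      · linear_combination (-t - 3) * r0
      · linear_combination (t + 3) * r0
      · linear_combination (-t + 3) * r0
    rw [h3] at h2
    rcases h2 with h2 | h2
    · have : n ∣ 8 := natCast_dvd_of_eq_zero (c := 8) (by push_cast; linear_combination h2)
      exact (hA (isDiamond_of_dvd h.three_le (by decide : 8 ∈ _) this)).elim
    · have : n ∣ 10 := natCast_dvd_of_eq_zero (c := 10) (by push_cast; linear_combination h2)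
      exact (not_dvd_ten_of_two hA h this).elim
  · have hm3 : m = 3 := by omega
    exact (not_evalList_of_isTernary h hA hT hm3 he r1).elim
  · rw [abs_lt] at e8; omega

/-- A closed 8-walk that begins with three steps straight up requires `m = 2`, a special relation,
or a relation between four powers of `r ^ 2` with coefficients `±1` and `m = 4`. -/
theorem cases_of_closable_straight (h : Admissible m 2 n r) (hA : ¬ IsDiamond r)
    (hT : IsTwoArcTransitive (CPM m 2 n r)) {e : Bool}
    (hc : Closable m 2 r 5 [(true, true), (true, true)] (true, e)) :
    m = 2 ∨ IsSpecial r e ∨ (m = 4 ∧ ∃ b c : Bool,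
      1 + (sgn e : ZMod n) * (r : ZMod n) ^ 2 + (sgn b : ZMod n) * ((r : ZMod n) ^ 2) ^ 2 +
        (sgn c : ZMod n) * ((r : ZMod n) ^ 2) ^ 3 = 0) := by
  obtain ⟨w, hw, hc⟩ := hc
  have hlen : ([(true, true), (true, true)] ++ (true, e) :: w).length ≤ 8 := by
    simp [length_of_mem_nbWords hw]
  have hm := two_le_of_not_isDiamond h hA
  have r0 := hc.wordRelation_eq_zero hlen 0 le_rfl two_pos
  have r1 := hc.wordRelation_eq_zero hlen 1 zero_le_one one_lt_two
  have key : ∀ e, ∀ w ∈ nbWords 5 (true, e),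
      (fun v =>
        (height v = 0 ∧ (ExcludedRelation (wordRelation 0 v) ∨ ExcludedRelation (wordRelation 1 v) ∨
          wordRelation 0 v ∈
            [[2, 4 * sgn e], [-2, -4 * sgn e], [4, 2 * sgn e], [-4, -2 * sgn e]])) ∨
        ((height v = 6 ∨ height v = -6) ∧ (ExcludedRelation (wordRelation 0 v) ∨
          ExcludedRelation (wordRelation 1 v) ∨ IsTernary (wordRelation 0 v) ∨
          IsTernary (wordRelation 1 v))) ∨
        ((height v = 8 ∨ height v = -8) ∧
          ∃ b c : Bool, wordRelation 0 v = [1, sgn e, sgn b, sgn c]) ∨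
        ((height v = 2 ∨ height v = -2) ∨ (height v = 4 ∨ height v = -4)))
        ([(true, true), (true, true)] ++ (true, e) :: w) := by
    decide +kernel
  have key := key e w hw
  beta_reduce at key
  have hh := hc.height_cases hlen hm
  set v := [(true, true), (true, true)] ++ (true, e) :: w
  by_cases h2 : m = 2
  · exact Or.inl h2
  rcases key with ⟨-, he | he | he⟩ | ⟨he6, he | he | he | he⟩ | ⟨he8, b, c, he⟩ | he
  · exact (he.false h.three_le hA r0).elim
  · exact (he.false h.three_le hA r1).elim
  · exact Or.inr (Or.inl (isSpecial_of_mem he r0))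
  · exact (he.false h.three_le hA r0).elim
  · exact (he.false h.three_le hA r1).elim
  · have hm3 : m = 3 := by omega
    exact (not_evalList_of_isTernary h hA hT hm3 he r0).elim
  · have hm3 : m = 3 := by omega
    exact (not_evalList_of_isTernary h hA hT hm3 he r1).elim
  · refine Or.inr (Or.inr ⟨by omega, b, c, ?_⟩)
    rw [he] at r0
    simp only [evalList] at r0
    linear_combination r0
  · omega

end TwoClasses

/-! ### The relation of the short closed words, `s = 2` -/

section Exceptional

variable {m n : ℕ} {r : (ZMod n)ˣ}

theorem closable_turn_of_isSpecial {e : Bool} (hS : IsSpecial r e) :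
    Closable m 2 r 5 [(true, true), (false, true)] (true, true) := by
  rcases hS with hS | hS
  · refine ⟨[(false, true), (false, true), (false, e), (true, e), (true, false)],
      by cases e <;> decide,
      closedWord_of_straight (cs := [(0, 1), (0, 1), (0, 1), (0, 1), (-1, 1), (-2, sgn e),
        (-2, sgn e), (-1, -1)]) ?_ (by cases e <;> decide) ⟨?_, ?_⟩⟩
    · have : height ([(true, true), (false, true)] ++ (true, true) ::
        [(false, true), (false, true), (false, e), (true, e), (true, false)]) = 0 := rfl
      rw [this]; exact dvd_zero _
    · have hx : ((r⁻¹ : (ZMod n)ˣ) : ZMod n) ^ 2 * (r : ZMod n) ^ 2 = 1 := by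
        rw [← mul_pow, Units.inv_mul, one_pow]
      simp only [classSum, List.map_cons, List.map_nil, List.sum_cons, List.sum_nil]
      norm_num
      generalize ((r⁻¹ : (ZMod n)ˣ) : ZMod n) ^ 2 = x at *
      rcases sgn_cases e with e | e <;> rw [e] at hS ⊢ <;> push_cast at hS ⊢
      · linear_combination x * hS - 4 * hx
      · linear_combination -x * hS - 4 * hx
    · simp only [classSum, List.map_cons, List.map_nil, List.sum_cons, List.sum_nil]
      norm_num
  · refine ⟨[(true, true), (true, e), (false, e), (false, false), (false, true)],
      by cases e <;> decide,
      closedWord_of_straight (cs := [(0, 1), (0, 1), (0, 1), (1, 1), (2, sgn e), (2, sgn e),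
        (1, -1), (0, 1)]) ?_ (by cases e <;> decide) ⟨?_, ?_⟩⟩
    · have : height ([(true, true), (false, true)] ++ (true, true) ::
        [(true, true), (true, e), (false, e), (false, false), (false, true)]) = 0 := rfl
      rw [this]; exact dvd_zero _
    · simp [classSum]
      linear_combination hS
    · simp [classSum]

theorem closable_straight_of_two (h : Admissible 2 2 n r) (e : Bool) :
    Closable 2 2 r 5 [(true, true), (true, true)] (true, e) := by
  have key : ∀ f : Bool, ((r : ZMod n) ^ 2) ^ 2 = -sgn f →
      Closable 2 2 r 5 [(true, true), (true, true)] (true, e) := by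
    intro f hf
    refine ⟨[(true, true), (true, f), (true, f), (true, f == e), (true, f)],
      by cases e <;> cases f <;> decide,
      closedWord_of_straight (cs := [(0, 1), (1, 1), (2, sgn e), (3, 1), (4, sgn f), (5, sgn f),
        (6, sgn f * sgn e), (7, sgn f)]) (by cases e <;> cases f <;> decide)
        (by cases e <;> cases f <;> decide) ⟨?_, ?_⟩⟩
    · simp [classSum]
      rcases sgn_cases f with e1 | e1 <;> rw [e1] at hf ⊢ <;> push_cast at hf ⊢
      · linear_combination (1 + sgn e * (r : ZMod n) ^ 2) * hf
      · linear_combination -(1 + sgn e * (r : ZMod n) ^ 2) * hf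
    · simp [classSum]
      rcases sgn_cases f with e1 | e1 <;> rw [e1] at hf ⊢ <;> push_cast at hf ⊢
      · linear_combination (r : ZMod n) * (1 + (r : ZMod n) ^ 2) * hf
      · linear_combination -(r : ZMod n) * (1 + (r : ZMod n) ^ 2) * hf
  rcases sq_eq_of_two h with h2 | h2
  · exact key false (by simp [sgn, h2])
  · exact key true (by simp [sgn, h2])

theorem closable_straight_of_four {e b c : Bool}
    (h : 1 + (sgn e : ZMod n) * (r : ZMod n) ^ 2 + (sgn b : ZMod n) * ((r : ZMod n) ^ 2) ^ 2 +
        (sgn c : ZMod n) * ((r : ZMod n) ^ 2) ^ 3 = 0) :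
    Closable 4 2 r 5 [(true, true), (true, true)] (true, e) := by
  refine ⟨[(true, e), (true, b), (true, b), (true, c), (true, c)],
    by cases e <;> cases b <;> cases c <;> decide,
    closedWord_of_straight (cs := [(0, 1), (1, 1), (2, sgn e), (3, sgn e), (4, sgn b), (5, sgn b),
      (6, sgn c), (7, sgn c)]) (by cases e <;> cases b <;> cases c <;> decide)
      (by cases e <;> cases b <;> cases c <;> decide) ⟨?_, ?_⟩⟩
  · simp [classSum]
    linear_combination h
  · simp [classSum]
    linear_combination (r : ZMod n) * h

/-- Of the two straight prolongations of an upward 2-arc, both lie on closed 8-walks if the 2-arc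
that turns can turn again on such a walk; otherwise exactly one does. -/
theorem closable_straight_count (h : Admissible m 2 n r) (hT : IsTwoArcTransitive (CPM m 2 n r)) :
    (Closable m 2 r 5 [(true, true), (false, true)] (true, true) →
      ∀ e, Closable m 2 r 5 [(true, true), (true, true)] (true, e)) ∧
    (¬ Closable m 2 r 5 [(true, true), (false, true)] (true, true) →
      ∃ e, Closable m 2 r 5 [(true, true), (true, true)] (true, e) ∧
        ¬ Closable m 2 r 5 [(true, true), (true, true)] (true, !e)) := by
  classical
  obtain ⟨σ, hσ⟩ := exists_perm_closable h hT 5 (true, true) (true, true) 0 1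
  have hs := sum_ite_eq_of_perm
    (p := fun t => Closable m 2 r 5 [(true, true), nextLetter (true, true) 0]
      (nextLetter (nextLetter (true, true) 0) t))
    (q := fun t => Closable m 2 r 5 [(true, true), nextLetter (true, true) 1]
      (nextLetter (nextLetter (true, true) 1) t)) σ hσ
  simp only [Fin.sum_univ_three] at hs
  have p1 : Closable m 2 r 5 [(true, true), nextLetter (true, true) 0]
    (nextLetter (nextLetter (true, true) 0) 1) := closable_turn_straight true
  have p2 : Closable m 2 r 5 [(true, true), nextLetter (true, true) 0]
    (nextLetter (nextLetter (true, true) 0) 2) := closable_turn_straight false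
  have q0 : Closable m 2 r 5 [(true, true), nextLetter (true, true) 1]
    (nextLetter (nextLetter (true, true) 1) 0) := closable_up_up_turn
  simp only [if_pos p1, if_pos p2, if_pos q0] at hs
  have e1 : nextLetter (nextLetter (true, true) 0) 0 = (true, true) := rfl
  have e2 : nextLetter (nextLetter (true, true) 1) 1 = (true, true) := rfl
  have e3 : nextLetter (nextLetter (true, true) 1) 2 = (true, false) := rfl
  have e4 : nextLetter (true, true) 0 = (false, true) := rfl
  have e5 : nextLetter (true, true) 1 = (true, true) := rfl
  rw [e1, e2, e3, e4, e5] at hs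
  constructor
  · intro hz e
    rw [if_pos hz] at hs
    by_cases a : Closable m 2 r 5 [(true, true), (true, true)] (true, true) <;>
    by_cases b : Closable m 2 r 5 [(true, true), (true, true)] (true, false) <;>
    simp only [a, b, if_true, if_false] at hs <;> first | omega | skip
    cases e <;> assumption
  · intro hz
    rw [if_neg hz] at hs
    by_cases a : Closable m 2 r 5 [(true, true), (true, true)] (true, true) <;>
    by_cases b : Closable m 2 r 5 [(true, true), (true, true)] (true, false) <;>
    simp only [a, b, if_true, if_false] at hs <;> first | omega | skip
    · exact ⟨true, a, b⟩
    · exact ⟨false, b, a⟩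

theorem dvd_two_of_special_relation {t : ZMod n} (σ b c : ℤ) (hσ : σ = 1 ∨ σ = -1)
    (hb : b = 1 ∨ b = -1) (hc : c = 1 ∨ c = -1)
    (hS : 2 + 4 * (σ : ZMod n) * t = 0 ∨ 4 + 2 * (σ : ZMod n) * t = 0)
    (hP : 1 - (σ : ZMod n) * t + b * t ^ 2 + c * t ^ 3 = 0) (hn : n ∣ 34) : n ∣ 2 := by
  have key : ∀ d : ℤ, (d : ZMod n) = 0 → Nat.gcd 34 d.natAbs = 2 → n ∣ 2 := fun d hd hg => by
    rw [← hg]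
    exact Nat.dvd_gcd hn (natCast_dvd_of_eq_zero hd)
  rcases hS with hS | hS
  · -- multiplication by `-2 σ t` fixes `2`
    refine key (2 * (-12 * σ - 2 * b * σ + c)) ?_ (by
      rcases hσ with rfl | rfl <;> rcases hb with rfl | rfl <;> rcases hc with rfl | rfl <;> decide)
    push_cast
    rcases hσ with rfl | rfl <;> push_cast at hS hP ⊢
    · linear_combination -16 * hP -
        (4 + 2 * b * (1 - 2 * t) - c * (4 * t ^ 2 - 2 * t + 1)) * hS
    · linear_combination 16 * hP +
        (4 + 2 * b * (1 + 2 * t) + c * (4 * t ^ 2 + 2 * t + 1)) * hS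
  · refine key (2 * (3 + 4 * b - 8 * c * σ)) ?_ (by
      rcases hσ with rfl | rfl <;> rcases hb with rfl | rfl <;> rcases hc with rfl | rfl <;> decide)
    push_cast
    rcases hσ with rfl | rfl <;> push_cast at hS hP ⊢
    · linear_combination 2 * hP - (c * t ^ 2 + (b - 2 * c) * t + (-1 - 2 * (b - 2 * c))) * hS
    · linear_combination 2 * hP + (c * t ^ 2 + (b + 2 * c) * t + (1 + 2 * (b + 2 * c))) * hS

theorem not_isSpecial_not (h3 : 3 ≤ n) (hA : ¬ IsDiamond r) {e : Bool} (hS : IsSpecial r e) :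
    ¬ IsSpecial r (!e) := by
  intro hS'
  have key : ∀ c : ℤ, (c : ZMod n) = 0 → c.natAbs ∈ [1, 2, 3, 4, 5, 6, 8] → False :=
    fun c hc h => hA (isDiamond_of_dvd h3 h (natCast_dvd_of_eq_zero hc))
  have hn := not_dvd_thirty_of_isSpecial h3 hA hS
  have key2 : ∀ c : ℤ, (c : ZMod n) = 0 → c.natAbs ∣ 30 → False :=
    fun c hc h => hn ((natCast_dvd_of_eq_zero hc).trans h)
  unfold IsSpecial at hS hS'
  rw [sgn_not] at hS'
  push_cast at hS'
  rcases hS with hS | hS <;> rcases hS' with hS' | hS'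
  · exact key 4 (by push_cast; linear_combination hS + hS') (by decide)
  · exact key2 10 (by push_cast; linear_combination hS + 2 * hS') (by decide)
  · exact key2 10 (by push_cast; linear_combination 2 * hS + hS') (by decide)
  · exact key 8 (by push_cast; linear_combination hS + hS') (by decide)

/-- In a 2-arc-transitive graph, no closed 8-walk begins with two turns. -/
theorem not_closable_turn_turn (h : Admissible m 2 n r) (hA : ¬ IsDiamond r)
    (hT : IsTwoArcTransitive (CPM m 2 n r)) :
    ¬ Closable m 2 r 5 [(true, true), (false, true)] (true, true) := by
  intro hz
  obtain ⟨e, hS⟩ := exists_isSpecial_of_closable h hA hT hz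
  have h30 := not_dvd_thirty_of_isSpecial h.three_le hA hS
  rcases cases_of_closable_straight h hA hT ((closable_straight_count h hT).1 hz (!e)) with
    h2 | hS' | ⟨h4, b, c, hP⟩
  · subst h2
    exact not_isSpecial_of_two h hA hS
  · exact not_isSpecial_not h.three_le hA hS hS'
  · subst h4
    have h8 : ((r : ZMod n) ^ 2) ^ 4 = 1 ∨ ((r : ZMod n) ^ 2) ^ 4 = -1 := by
      have := h.pow_eq
      rwa [← pow_mul]
    unfold IsSpecial at hS
    rw [sgn_not] at hP
    push_cast at hP
    generalize (r : ZMod n) ^ 2 = t at *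
    have hdvd : n ∣ 30 ∨ n ∣ 34 := by
      rcases h8 with h8 | h8 <;> [left; right]
      · refine natCast_dvd_of_eq_zero (c := 30) ?_
        rcases sgn_cases e with e | e <;> rw [e] at hS <;> push_cast at hS ⊢ <;>
          rcases hS with hS | hS
        · linear_combination -32 * h8 - (1 - 2 * t) * (1 + 4 * t ^ 2) * hS
        · linear_combination 2 * h8 - (t - 2) * (t ^ 2 + 4) * hS
        · linear_combination -32 * h8 - (1 + 2 * t) * (1 + 4 * t ^ 2) * hS
        · linear_combination 2 * h8 + (t + 2) * (t ^ 2 + 4) * hS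
      · refine natCast_dvd_of_eq_zero (c := 34) ?_
        rcases sgn_cases e with e | e <;> rw [e] at hS <;> push_cast at hS ⊢ <;>
          rcases hS with hS | hS
        · linear_combination 32 * h8 + (1 - 2 * t) * (1 + 4 * t ^ 2) * hS
        · linear_combination 2 * h8 - (t - 2) * (t ^ 2 + 4) * hS
        · linear_combination 32 * h8 + (1 + 2 * t) * (1 + 4 * t ^ 2) * hS
        · linear_combination 2 * h8 + (t + 2) * (t ^ 2 + 4) * hS
    rcases hdvd with hd | hd
    · exact h30 hd
    · have h2 := dvd_two_of_special_relation (sgn e) (sgn b) (sgn c) (sgn_cases e) (sgn_cases b)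
        (sgn_cases c) hS (by linear_combination hP) hd
      exact h30 (h2.trans (by norm_num))

/-- If exactly one straight prolongation of an upward 2-arc lies on closed 8-walks, the signs of the
relation repeat with period 2, since the relation may be multiplied by powers of `r ^ 2`. -/
theorem exists_relation_of_not_closable (h : Admissible m 2 n r) (hA : ¬ IsDiamond r)
    (hT : IsTwoArcTransitive (CPM m 2 n r)) :
    m = 4 ∧ ∃ e : Bool, (1 + (sgn e : ZMod n) * (r : ZMod n) ^ 2) *
      (1 + ((r : ZMod n) ^ 2) ^ 2) = 0 := by
  have hz := not_closable_turn_turn h hA hT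
  obtain ⟨e, he, hne⟩ := (closable_straight_count h hT).2 hz
  have hns : ∀ f, ¬ IsSpecial r f := fun f hf => hz (closable_turn_of_isSpecial hf)
  rcases cases_of_closable_straight h hA hT he with h2 | hS | ⟨h4, b, c, hP⟩
  · subst h2
    exact (hne (closable_straight_of_two h _)).elim
  · exact (hns e hS).elim
  subst h4
  refine ⟨rfl, e, ?_⟩
  have h8 : ((r : ZMod n) ^ 2) ^ 4 = 1 ∨ ((r : ZMod n) ^ 2) ^ 4 = -1 := by
    have := h.pow_eq
    rwa [← pow_mul]
  have hη : ∃ f, ((r : ZMod n) ^ 2) ^ 4 = sgn f := by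
    rcases h8 with h8 | h8
    · exact ⟨true, by rw [h8]; simp [sgn]⟩
    · exact ⟨false, by rw [h8]; simp [sgn]⟩
  obtain ⟨f, hf⟩ := hη
  have hu : ∀ e' : Bool, (∃ b' c' : Bool, 1 + (sgn e' : ZMod n) * (r : ZMod n) ^ 2 +
      (sgn b' : ZMod n) * ((r : ZMod n) ^ 2) ^ 2 +
      (sgn c' : ZMod n) * ((r : ZMod n) ^ 2) ^ 3 = 0) → e' = e := by
    rintro e' ⟨b', c', hP'⟩
    by_contra hh
    obtain rfl : e' = !e := by cases e <;> cases e' <;> simp at hh ⊢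
    exact hne (closable_straight_of_four hP')
  have hs : ∀ a : Bool, (sgn a : ZMod n) * sgn a = 1 := fun a => by cases a <;> simp [sgn]
  have hm : ∀ a b : Bool, (sgn (a == b) : ZMod n) = sgn a * sgn b := by
    intro a b; cases a <;> cases b <;> simp [sgn]
  have ht : IsUnit ((r : ZMod n) ^ 2) := r.isUnit.pow 2
  generalize (r : ZMod n) ^ 2 = t at *
  have hbt : b = true := by
    have := hu (e == b) ⟨e == c, e == f, by
      simp only [hm]
      refine ht.mul_right_eq_zero.1 ?_
      linear_combination (sgn e : ZMod n) * hP + (sgn e * sgn f : ZMod n) * hf +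
        (sgn e : ZMod n) * hs f - t * hs e⟩
    clear hP
    cases b <;> cases e <;> simp at this ⊢
  have hce : c = e := by
    have := hu (b == c) ⟨b == f, (b == f) == e, by
      simp only [hm]
      refine (ht.pow 2).mul_right_eq_zero.1 ?_
      linear_combination (sgn b : ZMod n) * hP +
        (sgn b * sgn f + sgn b * sgn f * sgn e * t : ZMod n) * hf +
        (sgn b + sgn b * sgn e * t : ZMod n) * hs f - t ^ 2 * hs b⟩
    rw [hbt] at this
    rw [← this]
    simp
  subst hbt hce
  simp only [sgn, if_true] at hP ⊢
  push_cast at hP ⊢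
  linear_combination hP

/-! ### The straight walk that avoids closed 8-walks -/

theorem closable_turn_straight_down (e : Bool) :
    Closable m 2 r 5 [(false, true), (true, true)] (true, e) := by
  cases e
  · exact ⟨[(false, false), (false, false), (true, false), (true, true), (false, true)], by decide,
      closedWord_of_coefAt 0 (dvd_zero _) (by decide) (by decide)⟩
  · exact ⟨[(false, true), (false, false), (true, false), (true, false), (false, false)], by decide,
      closedWord_of_coefAt 0 (dvd_zero _) (by decide) (by decide)⟩

theorem not_closable_turn_turn_down (h : Admissible m 2 n r) (hA : ¬ IsDiamond r)
    (hT : IsTwoArcTransitive (CPM m 2 n r)) :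
    ¬ Closable m 2 r 5 [(false, true), (true, true)] (false, true) := by
  obtain ⟨σ, hσ⟩ := exists_perm_closable h hT 5 (true, true) (false, true) 0 0
  have h0 := mt (hσ 0).2 (not_closable_turn_turn h hA hT)
  rcases (by decide : ∀ i : Fin 3, i = 0 ∨ i = 1 ∨ i = 2) (σ 0) with e | e | e <;> rw [e] at h0
  · exact h0
  · exact (h0 (closable_turn_straight_down true)).elim
  · exact (h0 (closable_turn_straight_down false)).elim

theorem closable_straight_turn (a b : Bool) :
    Closable m 2 r 5 [(true, a), (true, b)] (false, b) := by
  refine ⟨[(false, !a), (true, !a), (true, !b), (false, !b), (false, a)], ?_,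
    closedWord_of_coefAt 0 (dvd_zero _) ?_ ?_⟩ <;> revert a b <;> decide

theorem closable_straight_of_relation {e : Bool}
    (hP : (1 + (sgn e : ZMod n) * (r : ZMod n) ^ 2) * (1 + ((r : ZMod n) ^ 2) ^ 2) = 0)
    (a b : Bool) : Closable 4 2 r 5 [(true, a), (true, b)] (true, e == a) := by
  refine ⟨[(true, e == b), (true, a), (true, b), (true, e == a), (true, e == b)],
    by clear hP; revert e a b; decide,
    closedWord_of_straight (cs := [(0, sgn a), (1, sgn b), (2, sgn e * sgn a), (3, sgn e * sgn b),
      (4, sgn a), (5, sgn b), (6, sgn e * sgn a), (7, sgn e * sgn b)])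
      (by clear hP; revert e a b; decide) (by clear hP; revert e a b; decide) ⟨?_, ?_⟩⟩
  · simp [classSum]
    linear_combination (sgn a : ZMod n) * hP
  · simp [classSum]
    linear_combination (sgn b : ZMod n) * r * hP

/-- Suppose that `z` and `y` are walks in which every step avoids certain closed walks, and that in
`y` this determines each step. Then an automorphism that maps the first three vertices of `z` to
those of `y` maps `z` to `y`. -/
theorem map_walk_eq {V : Type*} {G : SimpleGraph V} (φ : G ≃g G) (k : ℕ) (z y : ℕ → V)
    (h0 : φ (z 0) = y 0) (h1 : φ (z 1) = y 1) (h2 : φ (z 2) = y 2)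
    (hadj : ∀ i, G.Adj (z (i + 2)) (z (i + 3))) (hne : ∀ i, z (i + 3) ≠ z (i + 1))
    (hz : ∀ i, ¬ (closings G k (z i) (z (i + 2)) (z (i + 3))).Nonempty)
    (hy : ∀ i w, G.Adj (y (i + 2)) w → w ≠ y (i + 1) →
      ¬ (closings G k (y i) (y (i + 2)) w).Nonempty → w = y (i + 3)) (i : ℕ) :
    φ (z i) = y i := by
  have key : ∀ i, φ (z i) = y i ∧ φ (z (i + 1)) = y (i + 1) ∧ φ (z (i + 2)) = y (i + 2) := by
    intro i
    induction i with
    | zero => exact ⟨h0, h1, h2⟩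
    | succ i ih =>
      obtain ⟨e0, e1, e2⟩ := ih
      refine ⟨e1, e2, hy i _ ?_ ?_ ?_⟩
      · rw [← e2]; exact φ.map_adj_iff.2 (hadj i)
      · rw [← e1]; exact fun e => hne i (φ.injective e)
      · rw [← e0, ← e2, closings_map_nonempty]; exact hz i
  exact (key i).1

/-- The walk with the letters `c 0, c 1, …`. -/
def walk (r : (ZMod n)ˣ) (c : ℕ → Letter) : ℕ → ℤ × (Fin 2 → ZMod n)
  | 0 => 0
  | k + 1 => move r (walk r c k) (c k)

/-- The letters of the walk that turns all the time. -/
def zigzag (k : ℕ) : Letter := (k % 2 = 0, true)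

/-- The letters of a walk that goes straight up, in which the signs of a class change according
to `e`. -/
def climb (e : Bool) (k : ℕ) : Letter := (true, if e then (k % 4 < 2 : Bool) else true)

theorem climb_add_two (e : Bool) (k : ℕ) : (climb e (k + 2)).2 = !(e == (climb e k).2) := by
  cases e
  · rfl
  · by_cases hk : k % 4 < 2
    · have : ¬ (k + 2) % 4 < 2 := by omega
      simp only [climb, this, hk]; rfl
    · have : (k + 2) % 4 < 2 := by omega
      simp only [climb, this, hk]; rfl

theorem walk_zigzag (k : ℕ) :
    walk r zigzag (2 * k) = (0, (2 * k) • levelVec r 0) := by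
  induction k with
  | zero => simp [walk]; rfl
  | succ k ih =>
    rw [show 2 * (k + 1) = 2 * k + 1 + 1 by ring, walk, walk, ih]
    have h1 : zigzag (2 * k) = (true, true) := by simp [zigzag]
    have h2 : zigzag (2 * k + 1) = (false, true) := by simp [zigzag]
    rw [h1, h2]
    refine Prod.ext (by simp [move, sgn]) ?_
    simp [move, sgn, edgeLevel, add_smul, add_assoc, two_smul]

theorem walk_climb (hr : r ^ 8 = 1) (e : Bool) (q : ℕ) :
    (walk r (climb e) (8 * q)).1 = 8 * q ∧
    (walk r (climb e) (8 * q)).2 0 = q *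
      ((1 - (sgn e : ZMod n) * (r : ZMod n) ^ 2) * (1 + ((r : ZMod n) ^ 2) ^ 2)) := by
  induction q with
  | zero => simp [walk]
  | succ q ih =>
    obtain ⟨i1, i2⟩ := ih
    have hv : ∀ j : ℤ, levelVec r (8 * (q : ℤ) + j) (0 : Fin 2) =
        if j % 2 = 0 then ((r ^ j : (ZMod n)ˣ) : ZMod n) else 0 := by
      intro j
      have h1 : (8 * (q : ℤ) + j) % 2 = j % 2 := by omega
      rw [levelVec, zpow_add, zpow_mul, show r ^ (8 : ℤ) = 1 from by exact_mod_cast hr]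
      simp [h1, eq_comm]
    have hc : ∀ j : ℕ, climb e (8 * q + j) = climb e j := by
      intro j
      have : (8 * q + j) % 4 = j % 4 := by omega
      simp [climb, this]
    have hstep : ∀ j : ℕ, walk r (climb e) (8 * q + (j + 1)) =
      move r (walk r (climb e) (8 * q + j)) (climb e j) := fun j => by
        rw [← hc j]; rfl
    have h1 : ∀ j : ℕ, (walk r (climb e) (8 * q + j)).1 = 8 * q + j := by
      intro j
      induction j with
      | zero => simpa using i1
      | succ j ih => rw [hstep, move, ih]; simp [climb, sgn]; ring
    have h2 : ∀ j : ℕ, (walk r (climb e) (8 * q + (j + 1))).2 0 =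
        (walk r (climb e) (8 * q + j)).2 0 + sgn (climb e j).2 *
          if (j : ℤ) % 2 = 0 then ((r ^ (j : ℤ) : (ZMod n)ˣ) : ZMod n) else 0 := by
      intro j
      rw [hstep, move, h1]
      simp only [Pi.add_apply, Pi.smul_apply, edgeLevel, climb, if_true, hv]
      rw [zsmul_eq_mul]
    rw [show 8 * (q + 1) = 8 * q + 8 by ring]
    refine ⟨by rw [h1]; push_cast; ring, ?_⟩
    have h3 : (walk r (climb e) (8 * q + 8)).2 0 = _ := h2 7
    rw [h3, h2 6, h2 5, h2 4, h2 3, h2 2, h2 1, h2 0]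
    simp only [Nat.add_zero, i2]
    have e8 : (r : ZMod n) ^ 8 = 1 := by
      rw [← Units.val_pow_eq_pow_val, hr]; rfl
    cases e <;> simp [climb, sgn] <;> ring

/-- An automorphism that maps the turning 2-arc to the straight one would map the walk that turns
all the time to the walk that goes straight up avoiding closed 8-walks, but they have different
periods. -/
theorem not_isTwoArcTransitive_of_not_isDiamond (h : Admissible m 2 n r) (hA : ¬ IsDiamond r) :
    ¬ IsTwoArcTransitive (CPM m 2 n r) := by
  intro hT
  obtain ⟨rfl, e, hP⟩ := exists_relation_of_not_closable h hA hT
  obtain ⟨φ, e0, e1, e2⟩ := exists_iso_words h hT (true, true) (true, true) 0 1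
  have hw : ∀ (c : ℕ → Letter) i, walk r c (i + 2) = run r (walk r c i) [c i, c (i + 1)] ∧
      walk r c (i + 3) = run r (walk r c i) ([c i, c (i + 1)] ++ [c (i + 2)]) :=
    fun c i => ⟨rfl, rfl⟩
  have hmap := map_walk_eq φ 5 (fun k => proj 4 (walk r zigzag k))
    (fun k => proj 4 (walk r (climb e) k)) e0
    (e1.trans (by cases e <;> rfl)) (e2.trans (by cases e <;> rfl)) ?_ ?_ ?_ ?_
  rotate_left
  · intro i
    exact (adj_proj_iff h _ _).2 ⟨_, rfl⟩
  · intro i hh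
    have h3 := (move_move_inv (r := r) (walk r zigzag (i + 1)) (zigzag (i + 1)))
    change proj 4 (move r (move r (walk r zigzag (i + 1)) (zigzag (i + 1))) (zigzag (i + 2))) =
      _ at hh
    have := proj_move_injective h _ (hh.trans (congrArg (proj 4) h3.symm))
    simp [zigzag] at this
  · intro i
    obtain ⟨w1, w2⟩ := hw zigzag i
    simp only [w1, w2]
    rw [closings_run_nonempty h]
    rcases Nat.mod_two_eq_zero_or_one i with hi | hi
    · have h1 : (i + 1) % 2 = 1 := by omega
      have h2 : (i + 2) % 2 = 0 := by omega
      simp only [zigzag, hi, h1, h2]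
      exact not_closable_turn_turn h hA hT
    · have h1 : (i + 1) % 2 = 0 := by omega
      have h2 : (i + 2) % 2 = 1 := by omega
      simp only [zigzag, hi, h1, h2]
      exact not_closable_turn_turn_down h hA hT
  · intro i w hadj hne hcl
    obtain ⟨w1, w2⟩ := hw (climb e) i
    obtain ⟨d, rfl⟩ := (adj_proj_iff h _ _).1 hadj
    have hcl' : ¬ Closable 4 2 r 5 [climb e i, climb e (i + 1)] d := by
      rwa [show move r (walk r (climb e) (i + 2)) d =
        run r (walk r (climb e) i) ([climb e i, climb e (i + 1)] ++ [d]) from rfl, w1,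
        closings_run_nonempty h] at hcl
    have hd : d = climb e (i + 2) := by
      have hd0 : d ≠ (!(climb e (i + 1)).1, !(climb e (i + 1)).2) := by
        rintro rfl
        apply hne
        rw [show walk r (climb e) (i + 2) = move r (walk r (climb e) (i + 1)) (climb e (i + 1))
          from rfl, move_move_inv]
      have hd1 : d ≠ (false, (climb e (i + 1)).2) := by
        rintro rfl
        exact hcl' (closable_straight_turn _ _)
      have hd2 : d ≠ (true, e == (climb e i).2) := by
        rintro rfl
        exact hcl' (closable_straight_of_relation hP _ _)
      have h3 : climb e (i + 2) = (true, !(e == (climb e i).2)) :=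
        Prod.ext rfl (climb_add_two e i)
      rw [h3]
      have h4 : (climb e (i + 1)).1 = true := rfl
      rw [h4] at hd0
      clear h4
      generalize (climb e (i + 1)).2 = b at *
      generalize (climb e i).2 = a at *
      clear hcl hcl' hne hadj h3 hP w2 w1
      revert a b e d
      decide
    rw [hd]; rfl
  -- `z` closes up after `L = n` or `L = 2 n` steps, and hence so does its image `y`
  have hclose : ∀ L : ℕ, Even L → n ∣ L → ∃ q, L = 8 * q ∧
      (q : ZMod n) * (2 * (1 + ((r : ZMod n) ^ 2) ^ 2)) = 0 := by
    rintro L ⟨k, rfl⟩ hL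
    have hz : proj 4 (walk r zigzag (k + k)) = proj 4 (0 : ℤ × (Fin 2 → ZMod n)) := by
      rw [← two_mul] at hL ⊢
      rw [walk_zigzag]
      have : (((2 * k : ℕ) : ℕ) : ZMod n) = 0 := (ZMod.natCast_eq_zero_iff _ _).2 hL
      refine Prod.ext rfl (funext fun i => ?_)
      change ((2 * k) • levelVec r 0 : Fin 2 → ZMod n) i = 0
      rw [Pi.smul_apply, nsmul_eq_mul, this, zero_mul]
    have hy := hmap (k + k)
    simp only [hz, e0] at hy
    have h0 := congrArg Prod.fst hy
    have h1 := congrFun (congrArg Prod.snd hy) 0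
    have hlev : ∀ j, (walk r (climb e) j).1 = j := by
      intro j
      induction j with
      | zero => rfl
      | succ j ih => rw [walk, move, ih]; simp [climb, sgn]
    have h8 : 8 ∣ k + k := by
      have : (0 : ZMod (4 * 2)) = (((k + k : ℕ) : ℕ) : ZMod (4 * 2)) := by
        simpa [proj, hlev] using h0
      exact (ZMod.natCast_eq_zero_iff _ _).1 this.symm
    obtain ⟨q, hq⟩ := h8
    refine ⟨q, hq, ?_⟩
    rw [hq] at h1
    have hr : r ^ 8 = 1 := by
      ext
      push_cast
      rcases sgn_cases e with e | e <;> rw [e] at hP <;> push_cast at hP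
      · linear_combination ((r : ZMod n) ^ 2 - 1) * hP
      · linear_combination -(1 + (r : ZMod n) ^ 2) * hP
    have h2 := (walk_climb hr e q).2
    have h3 : (walk r (climb e) (8 * q)).2 0 = 0 := h1.symm
    rw [h3] at h2
    linear_combination (q : ZMod n) * hP - h2
  rcases Nat.even_or_odd n with hn | hn
  · -- the displacement of `y` after `n = 8 q` steps gives `4 ∣ 1 + r ^ 4`, but `r` is odd
    obtain ⟨q, hq, hz⟩ := hclose n hn dvd_rfl
    have h4 : 4 ∣ n := ⟨2 * q, by omega⟩
    have hq0 : q ≠ 0 := by have := h.three_le; omega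
    have hd : (n : ℤ) ∣ q * (2 * (1 + (((r : ZMod n).val : ℤ) ^ 2) ^ 2)) := by
      have : NeZero n := ⟨by have := h.three_le; omega⟩
      rw [← ZMod.intCast_zmod_eq_zero_iff_dvd]
      push_cast
      rw [ZMod.natCast_zmod_val]
      exact hz
    have hd4 : (4 : ℤ) ∣ 1 + (((r : ZMod n).val : ℤ) ^ 2) ^ 2 := by
      obtain ⟨x, hx⟩ := hd
      refine ⟨x, ?_⟩
      have e1 : ((n : ℕ) : ℤ) = 8 * q := by exact_mod_cast hq
      rw [e1] at hx
      have hq1 : (2 * q : ℤ) ≠ 0 := by exact_mod_cast (by omega : 2 * q ≠ 0)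
      apply mul_left_cancel₀ hq1
      linear_combination hx
    have hu : IsUnit (ZMod.castHom h4 (ZMod 4) r) := r.isUnit.map _
    have hv : ZMod.castHom h4 (ZMod 4) r = (((r : ZMod n).val : ℤ) : ZMod 4) := by
      have : NeZero n := ⟨by have := h.three_le; omega⟩
      conv_lhs => rw [← ZMod.natCast_zmod_val (r : ZMod n)]
      rw [map_natCast, Int.cast_natCast]
    have key : ∀ x : ZMod 4, IsUnit x → 1 + (x ^ 2) ^ 2 ≠ 0 := by decide
    apply key _ hu
    rw [hv]
    have := (ZMod.intCast_zmod_eq_zero_iff_dvd _ 4).2 hd4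
    exact_mod_cast this
  · -- the level of `y` has period 8, which does not divide `2 n`
    obtain ⟨q, hq, -⟩ := hclose (2 * n) (even_two_mul n) (dvd_mul_left _ _)
    obtain ⟨a, ha⟩ := hn
    omega

end Exceptional

/-! ### Coverings by the diamond lattice -/

/-- The nodes of the diamond lattice: integral vectors with coordinate sum 0 or 1. -/
def IsNode (a : Fin 4 → ℤ) : Prop := ∑ i, a i = 0 ∨ ∑ i, a i = 1

/-- The neighbour of a node in direction `c`: the unit vector of `c` is added to a node of sum 0 and
subtracted from a node of sum 1. -/
def dstep (a : Fin 4 → ℤ) (c : Fin 4) : Fin 4 → ℤ := a + (1 - 2 * ∑ i, a i) • Pi.single c 1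

/-- `F` restricts to a covering of a connected component of `G` by the diamond lattice. -/
structure IsDiamondCover {V : Type*} (G : SimpleGraph V) (F : (Fin 4 → ℤ) → V) : Prop where
  adj_iff : ∀ a, IsNode a → ∀ y, G.Adj (F a) y ↔ ∃ c, F (dstep a c) = y
  injective : ∀ a, IsNode a → Function.Injective fun c => F (dstep a c)

section Diamond

variable {V W : Type*} {G : SimpleGraph V} {H : SimpleGraph W}

theorem sum_dstep (a : Fin 4 → ℤ) (c : Fin 4) : ∑ i, dstep a c i = 1 - ∑ i, a i := by
  simp only [dstep, Pi.add_apply, Pi.smul_apply, Finset.sum_add_distrib, smul_eq_mul,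
    ← Finset.mul_sum, Finset.sum_pi_single', Finset.mem_univ, if_true]
  ring

theorem IsNode.dstep {a : Fin 4 → ℤ} (h : IsNode a) (c : Fin 4) : IsNode (dstep a c) := by
  unfold IsNode at *
  rw [sum_dstep]
  omega

theorem isNode_zero : IsNode 0 := Or.inl (by simp)

theorem dstep_dstep {a : Fin 4 → ℤ} (c : Fin 4) : dstep (dstep a c) c = a := by
  have h := sum_dstep a c
  rw [dstep, h]
  simp only [dstep]
  module

theorem IsDiamondCover.exists_lift {F : (Fin 4 → ℤ) → V} {F' : (Fin 4 → ℤ) → W}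
    (hF : IsDiamondCover G F) (hF' : IsDiamondCover H F') (C : G.ConnectedComponent)
    (C' : H.ConnectedComponent) {x : Fin 4 → ℤ} (hx : IsNode x) (hC : F x ∈ C.supp)
    (hC' : F' x ∈ C'.supp) (v : C) : ∃ a, IsNode a ∧ F a = v ∧ F' a ∈ C'.supp := by
  obtain ⟨p⟩ : G.Reachable (F x) v.1 := SimpleGraph.ConnectedComponent.exact (hC.trans v.2.symm)
  have : ∀ u v (_ : G.Walk u v), (∃ a, IsNode a ∧ F a = u ∧ F' a ∈ C'.supp) →
      ∃ a, IsNode a ∧ F a = v ∧ F' a ∈ C'.supp := by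
    intro u v p
    induction p with
    | nil => exact id
    | cons hadj _ ih =>
      rintro ⟨a, ha, rfl, haC⟩
      obtain ⟨c, rfl⟩ := (hF.adj_iff a ha _).1 hadj
      exact ih ⟨_, ha.dstep c, rfl, (C'.mem_supp_congr_adj
        ((hF'.adj_iff a ha _).2 ⟨c, rfl⟩)).1 haC⟩
  exact this _ _ p ⟨x, hx, rfl, hC'⟩

/-- Two coverings with the same fibres give isomorphic components. -/
theorem exists_iso_of_covers {F : (Fin 4 → ℤ) → V} {F' : (Fin 4 → ℤ) → W}
    (hF : IsDiamondCover G F) (hF' : IsDiamondCover H F')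
    (hker : ∀ a b, IsNode a → IsNode b → (F a = F b ↔ F' a = F' b))
    (C : G.ConnectedComponent) (C' : H.ConnectedComponent) {x : Fin 4 → ℤ} (hx : IsNode x)
    (hC : F x ∈ C.supp) (hC' : F' x ∈ C'.supp) :
    ∃ ψ : C.toSimpleGraph ≃g C'.toSimpleGraph, ∀ a, IsNode a → ∀ h h',
      ψ ⟨F a, h⟩ = ⟨F' a, h'⟩ := by
  choose f hf1 hf2 hf3 using hF.exists_lift hF' C C' hx hC hC'
  choose g hg1 hg2 hg3 using hF'.exists_lift hF C' C hx hC' hC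
  have key : ∀ a, IsNode a → ∀ h, F' (f ⟨F a, h⟩) = F' a := fun a ha h =>
    (hker _ _ (hf1 _) ha).1 (hf2 _)
  have key' : ∀ a, IsNode a → ∀ h, F (g ⟨F' a, h⟩) = F a := fun a ha h =>
    (hker _ _ (hg1 _) ha).2 (hg2 _)
  refine ⟨⟨⟨fun v => ⟨F' (f v), hf3 v⟩, fun w => ⟨F (g w), hg3 w⟩, fun v => ?_, fun w => ?_⟩, ?_⟩,
    fun a ha h h' => Subtype.ext (key a ha h)⟩
  · exact Subtype.ext ((key' _ (hf1 v) (hf3 v)).trans (hf2 v))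
  · exact Subtype.ext ((key _ (hg1 w) (hg3 w)).trans (hg2 w))
  · intro v w
    change H.Adj (F' (f v)) (F' (f w)) ↔ G.Adj v.1 w.1
    rw [← hf2 v, ← hf2 w, hF'.adj_iff _ (hf1 v), hF.adj_iff _ (hf1 v)]
    exact exists_congr fun c => (hker _ _ ((hf1 v).dstep c) (hf1 w)).symm

/-- The affine map that takes `b` to `b'` and permutes the directions according to `π`. -/
def affine (b b' : Fin 4 → ℤ) (π : Equiv.Perm (Fin 4)) (a : Fin 4 → ℤ) : Fin 4 → ℤ :=
  b' + ((1 - 2 * ∑ i, b i) * (1 - 2 * ∑ i, b' i)) • fun i => (a - b) (π.symm i)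

theorem sum_affine (b b' : Fin 4 → ℤ) (π : Equiv.Perm (Fin 4)) (a : Fin 4 → ℤ) :
    ∑ i, affine b b' π a i = ∑ i, b' i +
      (1 - 2 * ∑ i, b i) * (1 - 2 * ∑ i, b' i) * (∑ i, a i - ∑ i, b i) := by
  simp only [affine, Pi.add_apply, Pi.smul_apply, Finset.sum_add_distrib, smul_eq_mul,
    ← Finset.mul_sum]
  rw [Equiv.sum_comp π.symm (a - b)]
  simp

theorem isNode_affine {b b' a : Fin 4 → ℤ} (hb : IsNode b) (hb' : IsNode b') (ha : IsNode a)
    (π : Equiv.Perm (Fin 4)) : IsNode (affine b b' π a) := by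
  unfold IsNode at *
  rw [sum_affine]
  rcases hb with h1 | h1 <;> rcases hb' with h2 | h2 <;> rw [h1, h2] <;> omega

theorem affine_self (b b' : Fin 4 → ℤ) (π : Equiv.Perm (Fin 4)) : affine b b' π b = b' := by
  funext i
  simp [affine]

theorem affine_dstep {b b' a : Fin 4 → ℤ} (hb : IsNode b) (hb' : IsNode b') (ha : IsNode a)
    (π : Equiv.Perm (Fin 4)) (c : Fin 4) :
    affine b b' π (dstep a c) = dstep (affine b b' π a) (π c) := by
  have hs : (fun i => (Pi.single c (1 : ℤ) : Fin 4 → ℤ) (π.symm i)) = Pi.single (π c) 1 := by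
    funext i
    simp only [Pi.single_apply, Equiv.symm_apply_eq]
  funext i
  have hs' := congrFun hs i
  simp only [dstep, sum_affine]
  simp only [affine, Pi.add_apply, Pi.smul_apply, Pi.sub_apply, smul_eq_mul] at hs' ⊢
  rw [hs']
  rcases hb with h1 | h1 <;> rcases hb' with h2 | h2 <;> rcases ha with h3 | h3 <;>
    rw [h1, h2, h3] <;> ring

theorem affine_sub (b b' a a' : Fin 4 → ℤ) (π : Equiv.Perm (Fin 4)) (i : Fin 4) :
    (affine b b' π a - affine b b' π a') i =
      (1 - 2 * ∑ i, b i) * (1 - 2 * ∑ i, b' i) * (a - a') (π.symm i) := by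
  simp [affine]; ring

/-- If the fibres of a covering are the residue classes modulo an integer, then all symmetries of
the diamond lattice descend, and they are transitive on 2-arcs. -/
theorem isTwoArcTransitive_of_cover {F : (Fin 4 → ℤ) → V} (hF : IsDiamondCover G F) (d : ℤ)
    (hker : ∀ a b, IsNode a → IsNode b →
      (F a = F b ↔ ∑ i, a i = ∑ i, b i ∧ ∀ i, d ∣ (a - b) i))
    (C : G.ConnectedComponent) (hC : F 0 ∈ C.supp) : IsTwoArcTransitive C.toSimpleGraph := by
  have lift : ∀ v ∈ C.supp, ∃ a, IsNode a ∧ F a = v := fun v hv => by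
    obtain ⟨a, ha, e, -⟩ := hF.exists_lift hF C C isNode_zero hC hC ⟨v, hv⟩
    exact ⟨a, ha, e⟩
  rintro ⟨u, hu⟩ ⟨v, hv⟩ ⟨w, hw⟩ ⟨u', hu'⟩ ⟨v', hv'⟩ ⟨w', hw'⟩ ⟨h1, h2, h3⟩ ⟨h1', h2', h3'⟩
  obtain ⟨b, hb, rfl⟩ := lift v hv
  obtain ⟨b', hb', rfl⟩ := lift v' hv'
  obtain ⟨c, rfl⟩ := (hF.adj_iff b hb _).1 (show G.Adj (F b) u from (h1 : G.Adj u (F b)).symm)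
  obtain ⟨e, rfl⟩ := (hF.adj_iff b hb _).1 (show G.Adj (F b) w from h2)
  obtain ⟨c', rfl⟩ := (hF.adj_iff b' hb' _).1
    (show G.Adj (F b') u' from (h1' : G.Adj u' (F b')).symm)
  obtain ⟨e', rfl⟩ := (hF.adj_iff b' hb' _).1 (show G.Adj (F b') w' from h2')
  have hce : c ≠ e := by rintro rfl; exact h3 rfl
  have hce' : c' ≠ e' := by rintro rfl; exact h3' rfl
  have hπ : ∀ c e c' e' : Fin 4, c ≠ e → c' ≠ e' →
      ∃ π : Equiv.Perm (Fin 4), π c = c' ∧ π e = e' := by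
    intro c e c' e' h h'
    refine ⟨(Equiv.swap c c').trans (Equiv.swap (Equiv.swap c c' e) e'), ?_, by simp⟩
    rw [Equiv.trans_apply, Equiv.swap_apply_left, Equiv.swap_apply_of_ne_of_ne]
    · intro hh
      exact h ((Equiv.swap c c').injective (by rw [Equiv.swap_apply_left]; exact hh))
    · exact h'
  obtain ⟨π, hc, he⟩ := hπ c e c' e' hce hce'
  have hF' : IsDiamondCover G (fun a => F (affine b b' π a)) := by
    refine ⟨fun a ha y => ?_, fun a ha c₁ c₂ h => ?_⟩
    · rw [hF.adj_iff _ (isNode_affine hb hb' ha π)]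
      constructor
      · rintro ⟨c, rfl⟩
        exact ⟨π.symm c, by rw [affine_dstep hb hb' ha]; simp⟩
      · rintro ⟨c, rfl⟩
        exact ⟨π c, by rw [affine_dstep hb hb' ha]⟩
    · simp only [affine_dstep hb hb' ha] at h
      exact π.injective (hF.injective _ (isNode_affine hb hb' ha π) h)
  obtain ⟨ψ, hψ⟩ := exists_iso_of_covers hF hF' (fun a a' ha ha' => by
    rw [hker a a' ha ha', hker _ _ (isNode_affine hb hb' ha π) (isNode_affine hb hb' ha' π)]
    rw [sum_affine, sum_affine]
    have hs : (1 - 2 * ∑ i, b i) * (1 - 2 * ∑ i, b' i) = 1 ∨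
        (1 - 2 * ∑ i, b i) * (1 - 2 * ∑ i, b' i) = -1 := by
      rcases hb with h1 | h1 <;> rcases hb' with h2 | h2 <;> rw [h1, h2] <;> simp
    refine and_congr ?_ ?_
    · rcases hs with hs | hs <;> rw [hs] <;> constructor <;> intro h <;> linarith
    · simp only [affine_sub]
      constructor
      · intro h i
        exact (h _).mul_left _
      · intro h i
        have := h (π i)
        rw [Equiv.symm_apply_apply] at this
        rcases hs with hs | hs <;> rw [hs] at this
        · rwa [one_mul] at this
        · rwa [neg_one_mul, dvd_neg] at this) C C hb hv
      (by rw [affine_self]; exact hv')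
  refine ⟨ψ, ?_, ?_, ?_⟩
  · rw [hψ _ (hb.dstep c) _ (by rw [affine_dstep hb hb' hb, affine_self, hc]; exact hu')]
    exact Subtype.ext (by simp only [affine_dstep hb hb' hb, affine_self, hc])
  · rw [hψ _ hb _ (by rw [affine_self]; exact hv')]
    exact Subtype.ext (by simp only [affine_self])
  · rw [hψ _ (hb.dstep e) _ (by rw [affine_dstep hb hb' hb, affine_self, he]; exact hw')]
    exact Subtype.ext (by simp only [affine_dstep hb hb' hb, affine_self, he])

end Diamond

/-! ### The covering of `CPMBar m 2 n r` -/

/-- The presentation `r ^ 2 = ε + κ`, `ε = ±1`, that determines a covering of the graph by the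
diamond lattice. Here `κ` is 0 or `n / 2`. -/
structure Presentation (m n : ℕ) (r : (ZMod n)ˣ) (e : Bool) (κ : ZMod n) : Prop where
  sq_eq : (r : ZMod n) ^ 2 = sgn e + κ
  two_mul : 2 * κ = 0
  mul_self : κ * κ = 0
  even : κ = 0 ∨ Even m

/-- The level of a node. -/
def nodeLevel (a : Fin 4 → ℤ) : ℤ := a 0 + a 1 - a 2 - a 3

/-- The image of a node in `CPMBar m 2 n r`, before reduction of the level. In directions 0 and 1
the first coordinate changes, in directions 2 and 3 the second one; the multiples of `κ` account
for the difference between the steps `r ^ j` and the steps `±1` or `±r`. -/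
def nodePos {n : ℕ} (r : (ZMod n)ˣ) (κ : ZMod n) (a : Fin 4 → ℤ) : ℤ × (Fin 2 → ZMod n) :=
  (nodeLevel a, ![((a 0 - a 1 : ℤ) : ZMod n) + κ * (((nodeLevel a + 1) / 4 : ℤ) : ZMod n),
    (r : ZMod n) * (((a 2 - a 3 : ℤ) : ZMod n) + κ * ((nodeLevel a / 4 : ℤ) : ZMod n))])

section Covering

variable {m n : ℕ} {r : (ZMod n)ˣ} {e : Bool} {κ : ZMod n}

theorem Presentation.mul_two_mul (h : Presentation m n r e κ) (p : ZMod n) : κ * (2 * p) = 0 := by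
  linear_combination p * h.two_mul

theorem Presentation.zpow_eq (h : Presentation m n r e κ) (q : ℤ) :
    ∃ b : Bool, ((r ^ (2 * q) : (ZMod n)ˣ) : ZMod n) = sgn b * (1 + κ * q) := by
  have h4 : r ^ 4 = 1 := by
    ext
    push_cast
    have := h.sq_eq
    have h1 : (sgn e : ZMod n) * sgn e = 1 := by cases e <;> simp [sgn]
    linear_combination ((r : ZMod n) ^ 2 + sgn e + κ) * h.sq_eq + h1 + sgn e * h.two_mul +
      h.mul_self
  rcases Int.even_or_odd' q with ⟨p, rfl | rfl⟩
  · refine ⟨true, ?_⟩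
    have := h.mul_two_mul p
    rw [← mul_assoc, zpow_mul,
      show r ^ (2 * 2 : ℤ) = 1 from by exact_mod_cast h4, one_zpow]
    push_cast
    simp [sgn, this]
  · refine ⟨e, ?_⟩
    have := h.mul_two_mul p
    rw [mul_add, ← mul_assoc, zpow_add, zpow_mul,
      show r ^ (2 * 2 : ℤ) = 1 from by exact_mod_cast h4,
      one_zpow, one_mul, show r ^ (2 * 1 : ℤ) = r ^ 2 from by norm_cast]
    push_cast
    rw [h.sq_eq]
    cases e <;> simp only [sgn] <;> push_cast
    · linear_combination this + h.two_mul
    · linear_combination -this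

theorem Presentation.quarter_add (h : Presentation m n r e κ) (q : ℤ) :
    κ * (((2 * q + 2) / 4 : ℤ) : ZMod n) = κ * (((2 * q + 1) / 4 : ℤ) : ZMod n) + κ * q := by
  rcases Int.even_or_odd' q with ⟨p, rfl | rfl⟩
  · rw [show (2 * (2 * p) + 2) / 4 = p by omega, show (2 * (2 * p) + 1) / 4 = p by omega]
    push_cast
    linear_combination - h.mul_two_mul p
  · rw [show (2 * (2 * p + 1) + 2) / 4 = p + 1 by omega,
      show (2 * (2 * p + 1) + 1) / 4 = p by omega]
    push_cast
    linear_combination - h.mul_two_mul p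

theorem levelVec_even (q : ℤ) {x : ZMod n} (hx : ((r ^ (2 * q) : (ZMod n)ˣ) : ZMod n) = x) :
    (levelVec r (2 * q) : Fin 2 → ZMod n) = ![x, 0] := by
  have : 2 * q % 2 = 0 := by omega
  funext i
  fin_cases i <;> simp [levelVec, this, hx]

theorem levelVec_odd (q : ℤ) {x : ZMod n} (hx : ((r ^ (2 * q) : (ZMod n)ˣ) : ZMod n) = x) :
    (levelVec r (2 * q + 1) : Fin 2 → ZMod n) = ![0, r * x] := by
  have : (2 * q + 1) % 2 = 1 := by omega
  funext i
  fin_cases i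
  · simp [levelVec, this]
  · simp only [levelVec, zpow_add_one, Units.val_mul, hx]
    simp [mul_comm]

/-- The direction `c` leads up from the nodes of sum 0 for `c = 0, 1` and from the nodes of sum 1
for `c = 2, 3`. The signs of the steps depend on the level. -/
theorem Presentation.exists_letters (h : Presentation m n r e κ) {a : Fin 4 → ℤ} (ha : IsNode a) :
    ∃ (u : Bool) (b b' : Bool), ∀ c, nodePos r κ (dstep a c) =
      move r (nodePos r κ a) (![(u, b), (u, !b), (!u, b'), (!u, !b')] c) := by
  have hsum : ∑ i, a i = a 0 + a 1 + a 2 + a 3 := Fin.sum_univ_four a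
  have hs : ∀ b : Bool, (sgn b : ZMod n) * sgn b = 1 := fun b => by cases b <;> simp [sgn]
  have hl : ∀ (f : ℤ) (c : Fin 4), nodeLevel (a + f • Pi.single c 1) =
      nodeLevel a + f * (![1, 1, -1, -1] c) := by
    intro f c
    fin_cases c <;> simp [nodeLevel] <;> ring
  rcases ha with ha | ha
  · obtain ⟨q, hq⟩ : ∃ q, nodeLevel a = 2 * q := ⟨a 0 + a 1, by unfold nodeLevel; omega⟩
    obtain ⟨b, hb⟩ := h.zpow_eq q
    obtain ⟨b', hb'⟩ := h.zpow_eq (q - 1)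
    have hA := h.quarter_add q
    have hB := h.quarter_add (q - 1)
    have v0 := levelVec_even q hb
    have v1 := levelVec_odd (q - 1) hb'
    rw [show 2 * (q - 1) + 2 = 2 * q by ring, show 2 * (q - 1) + 1 = 2 * q - 1 by ring] at hB
    rw [show 2 * (q - 1) + 1 = 2 * q - 1 by ring] at v1
    have hc : ((q - 1 : ℤ) : ZMod n) = q - 1 := by push_cast; rfl
    rw [hc] at hB v1
    have e1 : (2 * q + 1) / 4 = 2 * q / 4 := by omega
    have e2 : 2 * q + 1 + 1 = 2 * q + 2 := by ring
    have e4 : 2 * q + -1 = 2 * q - 1 := by ring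
    have hd : ∀ c, dstep a c = a + (1 : ℤ) • Pi.single c 1 := fun c => by simp [dstep, ha]
    refine ⟨true, b, b', fun c => ?_⟩
    rw [hd, nodePos, hl, hq, move, nodePos, hq]
    rw [e1] at hA
    fin_cases c <;> refine Prod.ext (by simp [sgn]) ?_ <;>
      simp [e1, e2, e4, edgeLevel, sgn_not, -neg_smul, v0, v1]
    · linear_combination hA - (1 + κ * q) * hs b
    · linear_combination hA + (1 + κ * q) * hs b + q * h.two_mul
    · linear_combination -r * hB - r * (1 + κ * (q - 1)) * hs b' - r * (q - 1) * h.two_mul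
    · linear_combination -r * hB + r * (1 + κ * (q - 1)) * hs b'
  · obtain ⟨q, hq⟩ : ∃ q, nodeLevel a = 2 * q + 1 := ⟨a 0 + a 1 - 1, by unfold nodeLevel; omega⟩
    obtain ⟨b, hb⟩ := h.zpow_eq q
    have hA := h.quarter_add q
    have v0 := levelVec_even q hb
    have v1 := levelVec_odd q hb
    have e1 : (2 * q + 1) / 4 = 2 * q / 4 := by omega
    have e2 : 2 * q + 1 + 1 = 2 * q + 2 := by ring
    have e3 : (2 * q + 2 + 1) / 4 = (2 * q + 2) / 4 := by omega
    have hd : ∀ c, dstep a c = a + (-1 : ℤ) • Pi.single c 1 := fun c => by simp [dstep, ha]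
    refine ⟨false, !b, !b, fun c => ?_⟩
    rw [hd, nodePos, hl, hq, move, nodePos, hq]
    rw [e1] at hA
    fin_cases c <;> refine Prod.ext (by simp [sgn]) ?_ <;>
      simp [e1, e2, e3, edgeLevel, sgn_not, -neg_smul, v0, v1]
    · linear_combination -hA + (1 + κ * q) * hs b
    · linear_combination -hA - (1 + κ * q) * hs b - q * h.two_mul
    · linear_combination r * hA + r * (1 + κ * q) * hs b + r * q * h.two_mul
    · linear_combination r * hA - r * (1 + κ * q) * hs b

theorem Presentation.isDiamondCover (h : Presentation m n r e κ) (hA : Admissible m 2 n r) :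
    IsDiamondCover (CPMBar m 2 n r) fun a => proj m (nodePos r κ a) := by
  refine ⟨fun a ha y => ?_, fun a ha c d hcd => ?_⟩
  · obtain ⟨u, b, b', hl⟩ := h.exists_letters ha
    rw [adj_proj_iff hA]
    constructor
    · rintro ⟨l, rfl⟩
      obtain ⟨c, rfl⟩ : ∃ c, ![(u, b), (u, !b), (!u, b'), (!u, !b')] c = l := by
        clear hl; revert u b b' l; decide
      exact ⟨c, by rw [hl]⟩
    · rintro ⟨c, rfl⟩
      exact ⟨_, congrArg (proj m) (hl c).symm⟩
  · obtain ⟨u, b, b', hl⟩ := h.exists_letters ha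
    simp only [hl] at hcd
    have := proj_move_injective hA _ hcd
    clear hcd hl
    revert u b b' c d
    decide

/-- The differences of nodes with the same image under the covering with parameter `κ`. -/
def InFibre (m n : ℕ) (κ : ZMod n) (d : Fin 4 → ℤ) : Prop :=
  ∃ k : ℤ, nodeLevel d = 2 * m * k ∧ ((d 0 - d 1 : ℤ) : ZMod n) + κ * k = 0 ∧
    ((d 2 - d 3 : ℤ) : ZMod n) + κ * k = 0

theorem Presentation.proj_eq_iff (h : Presentation m n r e κ) {a b : Fin 4 → ℤ} (ha : IsNode a)
    (hb : IsNode b) : proj m (nodePos r κ a) = proj m (nodePos r κ b) ↔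
      ∑ i, a i = ∑ i, b i ∧ InFibre m n (κ * (m / 2 : ℕ)) (a - b) := by
  have hsa : ∑ i, a i = a 0 + a 1 + a 2 + a 3 := Fin.sum_univ_four a
  have hsb : ∑ i, b i = b 0 + b 1 + b 2 + b 3 := Fin.sum_univ_four b
  have hsub : nodeLevel (a - b) = nodeLevel a - nodeLevel b := by simp [nodeLevel]; ring
  have hlev : (((nodeLevel a : ℤ) : ZMod (m * 2)) = ((nodeLevel b : ℤ) : ZMod (m * 2))) ↔
      ∃ k : ℤ, nodeLevel (a - b) = 2 * m * k := by
    rw [← sub_eq_zero, ← Int.cast_sub, ZMod.intCast_zmod_eq_zero_iff_dvd, hsub]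
    push_cast
    rw [mul_comm (m : ℤ) 2]
    rfl
  have hquart : ∀ k : ℤ, nodeLevel (a - b) = 2 * m * k → ∀ j : ℤ,
      κ * (((nodeLevel a + j) / 4 : ℤ) : ZMod n) = κ * (((nodeLevel b + j) / 4 : ℤ) : ZMod n) +
        κ * (m / 2 : ℕ) * k := by
    intro k hk j
    rcases h.even with h0 | ⟨p, hp⟩
    · simp [h0]
    · have h1 : m / 2 = p := by omega
      have h2 : nodeLevel a + j = nodeLevel b + j + (p * k) * 4 := by
        rw [hsub] at hk
        have : (m : ℤ) = p + p := by exact_mod_cast hp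
        rw [this] at hk
        linarith
      rw [h2, Int.add_mul_ediv_right _ _ (by norm_num), h1]
      push_cast
      ring
  have hparity : (∃ k : ℤ, nodeLevel (a - b) = 2 * m * k) → ∑ i, a i = ∑ i, b i := by
    rintro ⟨k, hk⟩
    rw [mul_assoc] at hk
    rw [hsub] at hk
    simp only [nodeLevel] at hk
    unfold IsNode at ha hb
    rw [hsa] at ha ⊢
    rw [hsb] at hb ⊢
    clear hlev hquart hsub hsa hsb
    generalize (m : ℤ) * k = w at hk
    rcases ha with ha | ha <;> rcases hb with hb | hb <;> omega
  have hvec : (nodePos r κ a).2 = (nodePos r κ b).2 ↔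
      ((a 0 - a 1 : ℤ) : ZMod n) + κ * (((nodeLevel a + 1) / 4 : ℤ) : ZMod n) =
        ((b 0 - b 1 : ℤ) : ZMod n) + κ * (((nodeLevel b + 1) / 4 : ℤ) : ZMod n) ∧
      ((a 2 - a 3 : ℤ) : ZMod n) + κ * ((nodeLevel a / 4 : ℤ) : ZMod n) =
        ((b 2 - b 3 : ℤ) : ZMod n) + κ * ((nodeLevel b / 4 : ℤ) : ZMod n) := by
    simp only [nodePos]
    constructor
    · intro hh
      refine ⟨congrFun hh 0, ?_⟩
      have := congrFun hh 1
      exact r.isUnit.mul_left_cancel this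
    · rintro ⟨h1, h2⟩
      rw [h1, h2]
  rw [proj, proj, Prod.ext_iff, hvec]
  change ((nodeLevel a : ℤ) : ZMod (m * 2)) = ((nodeLevel b : ℤ) : ZMod (m * 2)) ∧ _ ↔ _
  rw [hlev]
  constructor
  · rintro ⟨⟨k, hk⟩, h1, h2⟩
    refine ⟨hparity ⟨k, hk⟩, k, hk, ?_, ?_⟩
    · have := hquart k hk 1
      simp only [Pi.sub_apply]
      push_cast at h1 ⊢
      linear_combination h1 - this
    · have := hquart k hk 0
      simp only [Pi.sub_apply]
      simp only [add_zero] at this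
      push_cast at h2 ⊢
      linear_combination h2 - this
  · rintro ⟨-, k, hk, h1, h2⟩
    refine ⟨⟨k, hk⟩, ?_, ?_⟩
    · have := hquart k hk 1
      simp only [Pi.sub_apply] at h1
      push_cast at h1 ⊢
      linear_combination h1 + this
    · have := hquart k hk 0
      simp only [Pi.sub_apply] at h2
      simp only [add_zero] at this
      push_cast at h2 ⊢
      linear_combination h2 + this

theorem proj_nodePos_zero : proj m (nodePos r κ 0) = (0, 0) := by
  refine Prod.ext (by simp [proj, nodePos, nodeLevel]) (funext fun i => ?_)
  fin_cases i <;> simp [proj, nodePos, nodeLevel]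

end Covering

section Covering

variable {m n : ℕ} {r : (ZMod n)ˣ}

/-! ### Two-arc-transitive quotients of the diamond lattice -/

theorem conn_mem_zero : ((0, 0) : ZMod (m * 2) × (Fin 2 → ZMod n)) ∈ (CPMComponent m 2 n r).supp :=
  SimpleGraph.ConnectedComponent.connectedComponentMk_mem

theorem inFibre_zero_iff (hm : Odd m) {d : Fin 4 → ℤ} (hd : ∑ i, d i = 0) :
    InFibre m m 0 d ↔ ∀ i, (m : ℤ) ∣ d i := by
  rw [Fin.sum_univ_four] at hd
  have hc : IsCoprime (m : ℤ) 2 := by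
    rw [Int.isCoprime_iff_gcd_eq_one]
    exact_mod_cast hm.coprime_two_right
  simp only [InFibre, zero_mul, add_zero, ZMod.intCast_zmod_eq_zero_iff_dvd, nodeLevel]
  constructor
  · rintro ⟨k, hk, ⟨p, hp⟩, ⟨q, hq⟩⟩
    rw [mul_assoc] at hk
    intro i
    refine hc.dvd_of_dvd_mul_left ?_
    fin_cases i
    · exact ⟨k + p, by simp; linarith⟩
    · exact ⟨k - p, by simp; linarith⟩
    · exact ⟨-k + q, by simp; linarith⟩
    · exact ⟨-k - q, by simp; linarith⟩
  · intro h
    obtain ⟨a, ha⟩ := h 0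
    obtain ⟨b, hb⟩ := h 1
    exact ⟨a + b, by linarith, dvd_sub (h 0) (h 1), dvd_sub (h 2) (h 3)⟩

theorem inFibre_half_iff {d : Fin 4 → ℤ} (hd : ∑ i, d i = 0) :
    InFibre m (2 * m) (m : ZMod (2 * m)) d ↔ ∀ i, (m : ℤ) ∣ d i := by
  rw [Fin.sum_univ_four] at hd
  have hcast : ∀ x k : ℤ, (x : ZMod (2 * m)) + (m : ZMod (2 * m)) * k = 0 ↔
      (2 * m : ℤ) ∣ x + m * k := by
    intro x k
    rw [show (2 * m : ℤ) = ((2 * m : ℕ) : ℤ) by push_cast; rfl,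
      ← ZMod.intCast_zmod_eq_zero_iff_dvd]
    push_cast
    rfl
  simp only [InFibre, hcast, nodeLevel]
  constructor
  · rintro ⟨k, hk, ⟨p, hp⟩, ⟨q, hq⟩⟩
    rw [mul_assoc] at hk hp hq
    intro i
    fin_cases i
    · exact ⟨p, by simp; linarith⟩
    · exact ⟨k - p, by simp; linarith⟩
    · exact ⟨q - k, by simp; linarith⟩
    · exact ⟨-q, by simp; linarith⟩
  · intro h
    obtain ⟨x, hx⟩ := h 0
    obtain ⟨y, hy⟩ := h 1
    obtain ⟨z, hz⟩ := h 2
    obtain ⟨w, hw⟩ := h 3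
    exact ⟨x + y, by linarith, ⟨x, by linarith⟩, ⟨-w, by linarith⟩⟩

theorem sum_sub_eq_zero {a b : Fin 4 → ℤ} (h : ∑ i, a i = ∑ i, b i) : ∑ i, (a - b) i = 0 := by
  simp [h]

theorem isTwoArcTransitive_of_odd (h : Admissible m 2 n r) (hn : n = m) (hodd : Odd n)
    (hr : (r : ZMod n) ^ 2 = 1 ∨ (r : ZMod n) ^ 2 = -1) : IsTwoArcTransitive (CPM m 2 n r) := by
  subst hn
  obtain ⟨e, he⟩ : ∃ e : Bool, (r : ZMod n) ^ 2 = sgn e := by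
    rcases hr with hr | hr
    · exact ⟨true, by simp [sgn, hr]⟩
    · exact ⟨false, by simp [sgn, hr]⟩
  have hP : Presentation n n r e 0 := ⟨by simp [he], by simp, by simp, Or.inl rfl⟩
  refine isTwoArcTransitive_of_cover (hP.isDiamondCover h) n (fun a b ha hb => ?_) _
    (by rw [proj_nodePos_zero]; exact conn_mem_zero)
  rw [hP.proj_eq_iff ha hb, zero_mul]
  exact and_congr_right fun hs => inFibre_zero_iff hodd (sum_sub_eq_zero hs)

theorem isTwoArcTransitive_of_half (h : Admissible m 2 n r) (hn : n = 2 * m) (hm : m % 4 = 2)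
    (hr : 1 + (r : ZMod n) ^ 2 = (m : ZMod n)) :
    IsTwoArcTransitive (CPM m 2 n r) ∧ ∃ F, IsDiamondCover (CPMBar m 2 n r) F ∧ F 0 = (0, 0) ∧
      ∀ a b, IsNode a → IsNode b →
        (F a = F b ↔ ∑ i, a i = ∑ i, b i ∧ ∀ i, (m : ℤ) ∣ (a - b) i) := by
  subst hn
  have h2 : (2 : ZMod (2 * m)) * (m : ZMod (2 * m)) = 0 := by
    have := ZMod.natCast_self (2 * m)
    push_cast at this
    exact this
  obtain ⟨p, hp⟩ : ∃ p, m = 2 * p := ⟨m / 2, by omega⟩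
  obtain ⟨q, hq⟩ : ∃ q, m / 2 = 2 * q + 1 := ⟨m / 4, by omega⟩
  have hP : Presentation m (2 * m) r false (m : ZMod (2 * m)) := by
    refine ⟨?_, h2, ?_, Or.inr ⟨p, by omega⟩⟩
    · simp only [sgn]
      push_cast
      linear_combination hr
    · have : (m : ZMod (2 * m)) = 2 * p := by
        have := congrArg (Nat.cast : ℕ → ZMod (2 * m)) hp
        push_cast at this
        exact this
      linear_combination (m : ZMod (2 * m)) * this + p * h2
  have hker : ∀ a b, IsNode a → IsNode b →
      (proj m (nodePos r (m : ZMod (2 * m)) a) = proj m (nodePos r (m : ZMod (2 * m)) b) ↔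
        ∑ i, a i = ∑ i, b i ∧ ∀ i, (m : ℤ) ∣ (a - b) i) := by
    intro a b ha hb
    rw [hP.proj_eq_iff ha hb, show (m : ZMod (2 * m)) * (m / 2 : ℕ) = m by
      rw [hq]; push_cast; linear_combination (q : ZMod (2 * m)) * h2]
    exact and_congr_right fun hs => inFibre_half_iff (sum_sub_eq_zero hs)
  exact ⟨isTwoArcTransitive_of_cover (hP.isDiamondCover h) m hker _
    (by rw [proj_nodePos_zero]; exact conn_mem_zero), _, hP.isDiamondCover h, proj_nodePos_zero,
    hker⟩

/-! ### The diamond case: existence of a covering -/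

theorem exists_presentation (h : Admissible m 2 n r) (hA : IsDiamond r) :
    ∃ e κ, Presentation m n r e κ ∧
      (κ = 0 ∨ ∃ k : ℕ, n = 2 * k ∧ Even k ∧ κ = k ∧ 4 < n) := by
  by_cases h1 : (r : ZMod n) ^ 2 = 1 ∨ (r : ZMod n) ^ 2 = -1
  · obtain ⟨e, he⟩ : ∃ e : Bool, (r : ZMod n) ^ 2 = sgn e := by
      rcases h1 with hr | hr
      · exact ⟨true, by simp [sgn, hr]⟩
      · exact ⟨false, by simp [sgn, hr]⟩
    exact ⟨e, 0, ⟨by simp [he], by simp, by simp, Or.inl rfl⟩, Or.inl rfl⟩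
  push Not at h1
  have h3 := h.three_le
  have hn4 : n ≠ 4 := by
    rintro rfl
    refine h1.1 ?_
    clear h h1 hA
    revert r; decide
  obtain ⟨e, he⟩ : ∃ e : Bool, 2 * ((r : ZMod n) ^ 2 - sgn e) = 0 := by
    rcases hA with hr | hr
    · exact ⟨true, by simp only [sgn, if_true]; push_cast; linear_combination hr⟩
    · exact ⟨false, by simp [sgn]; linear_combination hr⟩
  have hne : (r : ZMod n) ^ 2 - sgn e ≠ 0 := by
    intro hh
    rcases sgn_cases e with he | he <;> rw [he] at hh <;> push_cast at hh
    · exact h1.1 (by linear_combination hh)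
    · exact h1.2 (by linear_combination hh)
  have hn0 : NeZero n := ⟨by omega⟩
  set κ := (r : ZMod n) ^ 2 - sgn e with hκ
  -- an element of order 2 is `n / 2`
  obtain ⟨hn, hk⟩ : n = 2 * κ.val ∧ κ = (κ.val : ℕ) := by
    have hv : κ = (κ.val : ℕ) := (ZMod.natCast_zmod_val κ).symm
    refine ⟨?_, hv⟩
    have hd : n ∣ 2 * κ.val := by
      rw [← ZMod.natCast_eq_zero_iff]
      push_cast
      rw [← hv]; exact he
    have hlt := κ.val_lt
    have hpos : 0 < κ.val := Nat.pos_of_ne_zero fun h0 => hne ((ZMod.val_eq_zero κ).1 h0)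
    obtain ⟨c, hc⟩ := hd
    have : c = 1 := by nlinarith
    rw [hc, this, mul_one]
  generalize κ.val = k at hn hk
  have hsq : (r : ZMod n) ^ 2 = sgn e + κ := by rw [hκ]; ring
  have hk2 : Even k := by
    by_contra hodd
    rw [Nat.not_even_iff_odd] at hodd
    have h2 : 2 ∣ n := ⟨k, hn⟩
    have := congrArg (ZMod.castHom h2 (ZMod 2)) hsq
    rw [hk] at this
    simp only [map_pow, map_add, map_intCast, map_natCast] at this
    have hu : IsUnit (ZMod.castHom h2 (ZMod 2) r) := r.isUnit.map _
    have hk1 : ((k : ℕ) : ZMod 2) = 1 := by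
      obtain ⟨j, rfl⟩ := hodd
      push_cast
      rw [show (2 : ZMod 2) = 0 from rfl]; simp
    rw [hk1] at this
    have key : ∀ x : ZMod 2, ∀ e : Bool, IsUnit x → x ^ 2 ≠ (sgn e : ZMod 2) + 1 := by decide
    exact key _ e hu this
  have hmul : κ * κ = 0 := by
    obtain ⟨j, rfl⟩ := hk2
    rw [hk]
    have : ((2 * (j + j) : ℕ) : ZMod n) = 0 := by rw [← hn]; exact ZMod.natCast_self n
    push_cast at this ⊢
    linear_combination (j : ZMod n) * this
  refine ⟨e, κ, ⟨hsq, he, hmul, Or.inr ?_⟩, Or.inr ⟨k, hn, hk2, hk, by omega⟩⟩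
  by_contra hodd
  rw [Nat.not_even_iff_odd] at hodd
  obtain ⟨j, rfl⟩ := hodd
  have hs : (sgn e : ZMod n) * sgn e = 1 := by cases e <;> simp [sgn]
  have h4 : ((r : ZMod n) ^ 2) ^ 2 = 1 := by
    rw [hsq]; linear_combination hs + sgn e * he + hmul
  have hpow := h.pow_eq
  rw [show (2 * j + 1) * 2 = 2 * (2 * j) + 2 by ring, pow_add, pow_mul, pow_mul ((r : ZMod n) ^ 2),
    h4, one_pow, one_mul] at hpow
  exact hpow.elim h1.1 h1.2

/-- In the diamond case there is a covering whose fibres are governed by `m`, `n` and a parameter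
`κ` that is 0 or `n / 2`. -/
theorem exists_cover (h : Admissible m 2 n r) (hA : IsDiamond r) :
    ∃ F κ, IsDiamondCover (CPMBar m 2 n r) F ∧ F 0 = (0, 0) ∧
      (∀ a b, IsNode a → IsNode b →
        (F a = F b ↔ ∑ i, a i = ∑ i, b i ∧ InFibre m n κ (a - b))) ∧
      (κ = 0 ∨ ∃ k : ℕ, n = 2 * k ∧ Even k ∧ κ = k ∧ 4 < n ∧ m % 4 = 2 ∧
        ∃ e, (r : ZMod n) ^ 2 = sgn e + k) := by
  obtain ⟨e, κ, hP, hκ⟩ := exists_presentation h hA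
  refine ⟨_, κ * (m / 2 : ℕ), hP.isDiamondCover h, proj_nodePos_zero,
    fun a b ha hb => hP.proj_eq_iff ha hb, ?_⟩
  rcases hκ with rfl | ⟨k, hn, hk, rfl, h4⟩
  · left; simp
  rcases hP.even with h0 | ⟨p, hp⟩
  · left; simp [h0]
  rw [show m / 2 = p by omega]
  rcases Nat.even_or_odd' p with ⟨q, hq | hq⟩
  · left
    rw [hq]; push_cast
    exact hP.mul_two_mul q
  · right
    refine ⟨k, hn, hk, ?_, h4, by omega, e, hP.sq_eq⟩
    rw [hq]; push_cast
    linear_combination hP.mul_two_mul q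

end Covering

/-! ### Closed walks in quotients of the diamond lattice -/

/-- The node reached from `a` along the given directions. -/
def drun (a : Fin 4 → ℤ) (w : List (Fin 4)) : Fin 4 → ℤ := w.foldl dstep a

/-- The alternating sum of the unit vectors of the given directions. -/
def disp : List (Fin 4) → Fin 4 → ℤ
  | [] => 0
  | c :: w => Pi.single c 1 - disp w

/-- The non-backtracking sequences of `k` directions that may follow the direction `c`. -/
def dirWords : ℕ → Fin 4 → List (List (Fin 4))
  | 0, _ => [[]]
  | k + 1, c => ((List.finRange 4).filter (· ≠ c)).flatMap fun d => (dirWords k d).map (d :: ·)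

theorem mem_dirWords_succ {k : ℕ} {c : Fin 4} {w : List (Fin 4)} :
    w ∈ dirWords (k + 1) c ↔ ∃ d v, d ≠ c ∧ v ∈ dirWords k d ∧ w = d :: v := by
  simp only [dirWords, List.mem_flatMap, List.mem_filter, List.mem_finRange, true_and, List.mem_map,
    decide_eq_true_eq]
  constructor
  · rintro ⟨d, hd, v, hv, rfl⟩
    exact ⟨d, v, hd, hv, rfl⟩
  · rintro ⟨d, v, hd, hv, rfl⟩
    exact ⟨d, hd, v, hv, rfl⟩

theorem length_of_mem_dirWords {k : ℕ} {c : Fin 4} {w : List (Fin 4)} (h : w ∈ dirWords k c) :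
    w.length = k := by
  induction k generalizing c w with
  | zero => simp [dirWords] at h; simp [h]
  | succ k ih =>
    obtain ⟨d, v, -, hv, rfl⟩ := mem_dirWords_succ.1 h
    simp [ih hv]

theorem drun_append (a : Fin 4 → ℤ) (v w : List (Fin 4)) : drun a (v ++ w) = drun (drun a v) w :=
  List.foldl_append

theorem IsNode.drun {a : Fin 4 → ℤ} (h : IsNode a) (w : List (Fin 4)) : IsNode (drun a w) := by
  induction w generalizing a with
  | nil => exact h
  | cons c w ih => exact ih (h.dstep c)

theorem drun_eq (a : Fin 4 → ℤ) (w : List (Fin 4)) :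
    drun a w = a + (1 - 2 * ∑ i, a i) • disp w ∧
      (Even w.length → ∑ i, drun a w i = ∑ i, a i) ∧
      (¬ Even w.length → ∑ i, drun a w i = 1 - ∑ i, a i) := by
  induction w generalizing a with
  | nil => simp [drun, disp]
  | cons c w ih =>
    obtain ⟨h1, h2, h3⟩ := ih (dstep a c)
    have e : drun a (c :: w) = drun (dstep a c) w := rfl
    rw [e, sum_dstep] at *
    refine ⟨?_, fun hl => ?_, fun hl => ?_⟩
    · rw [h1, disp, dstep]; module
    · rw [h3 (by simpa [Nat.even_add_one] using hl)]; ring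
    · exact h2 (by simpa [Nat.even_add_one] using hl)

section Diamond

variable {V : Type*} {G : SimpleGraph V} {F : (Fin 4 → ℤ) → V} {m n : ℕ} {κ : ZMod n}

theorem InFibre.neg {d : Fin 4 → ℤ} (h : InFibre m n κ d) : InFibre m n κ (-d) := by
  obtain ⟨k, h1, h2, h3⟩ := h
  refine ⟨-k, ?_, ?_, ?_⟩
  · simp only [nodeLevel, Pi.neg_apply] at *; linarith
  · simp only [Pi.neg_apply]; push_cast at *; linear_combination -h2
  · simp only [Pi.neg_apply]; push_cast at *; linear_combination -h3

theorem closings_succ_nonempty (k : ℕ) (a u v : V) : (closings G (k + 1) a u v).Nonempty ↔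
    ∃ w, G.Adj v w ∧ w ≠ u ∧ (closings G k a v w).Nonempty := by
  constructor
  · rintro ⟨_ | ⟨w, L⟩, h1, h2, h3⟩
    · simp at h1
    · exact ⟨w, h2.1, h2.2.1, L, by simpa using h1, h2.2.2, by rwa [List.getLastD_cons] at h3⟩
  · rintro ⟨w, h1, h2, L, e1, e2, e3⟩
    exact ⟨w :: L, by simp [e1], ⟨h1, h2, e2⟩, by rwa [List.getLastD_cons]⟩

theorem closings_cover (hF : IsDiamondCover G F) (k : ℕ) (v : V) {b : Fin 4 → ℤ} (hb : IsNode b)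
    (c : Fin 4) : (closings G k v (F (dstep b c)) (F b)).Nonempty ↔
      ∃ w ∈ dirWords k c, F (drun b w) = v := by
  induction k generalizing b c with
  | zero =>
    constructor
    · rintro ⟨L, h1, -, h3⟩
      obtain rfl := List.length_eq_zero_iff.1 h1
      exact ⟨[], by simp [dirWords], h3⟩
    · rintro ⟨w, hw, h⟩
      simp only [dirWords, List.mem_singleton] at hw
      subst hw
      exact ⟨[], rfl, trivial, h⟩
  | succ k ih =>
    rw [closings_succ_nonempty]
    constructor
    · rintro ⟨w, h1, h2, h3⟩
      obtain ⟨d, rfl⟩ := (hF.adj_iff b hb _).1 h1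
      obtain ⟨v', hv, e⟩ := (ih (hb.dstep d) d).1 (by rwa [dstep_dstep])
      refine ⟨d :: v', mem_dirWords_succ.2 ⟨d, v', ?_, hv, rfl⟩, e⟩
      rintro rfl
      exact h2 rfl
    · rintro ⟨w, hw, e⟩
      obtain ⟨d, v', hd, hv, rfl⟩ := mem_dirWords_succ.1 hw
      refine ⟨F (dstep b d), (hF.adj_iff b hb _).2 ⟨d, rfl⟩,
        fun hh => hd (hF.injective b hb hh), ?_⟩
      have := (ih (hb.dstep d) d).2 ⟨v', hv, e⟩
      rwa [dstep_dstep] at this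

/-- The sequence `v` of directions followed by the direction `c` has a non-backtracking prolongation
by `k` directions that is closed modulo the fibres. -/
def DirClosable (m n : ℕ) (κ : ZMod n) (k : ℕ) (v : List (Fin 4)) (c : Fin 4) : Prop :=
  ∃ w ∈ dirWords k c, InFibre m n κ (disp (v ++ c :: w))

theorem map_drun_eq_iff (hker : ∀ a b, IsNode a → IsNode b →
      (F a = F b ↔ ∑ i, a i = ∑ i, b i ∧ InFibre m n κ (a - b))) {p : Fin 4 → ℤ} (hp : IsNode p)
    {w : List (Fin 4)} (hw : Even w.length) : F (drun p w) = F p ↔ InFibre m n κ (disp w) := by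
  obtain ⟨h1, h2, -⟩ := drun_eq p w
  rw [hker _ _ (hp.drun w) hp, h2 hw, h1]
  simp only [add_sub_cancel_left, true_and]
  rcases hp with hp | hp <;> rw [hp]
  · simp
  · norm_num
    exact ⟨fun h => by simpa using h.neg, fun h => h.neg⟩

theorem closings_drun (hF : IsDiamondCover G F) (hker : ∀ a b, IsNode a → IsNode b →
      (F a = F b ↔ ∑ i, a i = ∑ i, b i ∧ InFibre m n κ (a - b))) {p : Fin 4 → ℤ} (hp : IsNode p)
    (k : ℕ) (v : List (Fin 4)) (c : Fin 4) (hk : Even (v.length + 1 + k)) :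
    (closings G k (F p) (F (drun p v)) (F (drun p (v ++ [c])))).Nonempty ↔
      DirClosable m n κ k v c := by
  have e : drun p v = dstep (drun p (v ++ [c])) c := by
    rw [drun_append]
    exact (dstep_dstep c).symm
  rw [e, closings_cover hF k _ (hp.drun _)]
  refine exists_congr fun w => and_congr_right fun hw => ?_
  rw [← drun_append, List.append_assoc, List.singleton_append, map_drun_eq_iff hker hp]
  simpa [length_of_mem_dirWords hw, add_assoc, add_comm, add_left_comm] using hk

/-! ### Short closed sequences of directions -/

theorem dirClosable_hexagon {c d x : Fin 4} (h1 : c ≠ d) (h2 : d ≠ x) (h3 : c ≠ x) :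
    DirClosable m n κ 3 [c, d] x := by
  refine ⟨[c, d, x], by revert c d x; decide, 0, ?_⟩
  have : disp ([c, d] ++ x :: [c, d, x]) = 0 := by
    simp only [disp, List.cons_append, List.nil_append]; abel
  rw [this]
  simp [nodeLevel]

theorem InFibre.dvd (hκ : 2 * κ = 0) {d : Fin 4 → ℤ} (h : InFibre m n κ d) :
    n ∣ Nat.gcd (2 * (d 0 - d 1)).natAbs
      (Nat.gcd (2 * (d 2 - d 3)).natAbs (d 0 - d 1 - d 2 + d 3).natAbs) := by
  obtain ⟨k, -, h2, h3⟩ := h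
  push_cast at h2 h3
  refine Nat.dvd_gcd ?_ (Nat.dvd_gcd ?_ ?_) <;> refine natCast_dvd_of_eq_zero ?_ <;> push_cast
  · linear_combination 2 * h2 - k * hκ
  · linear_combination 2 * h3 - k * hκ
  · linear_combination h2 - h3

theorem InFibre.dvd_of_level (hm : 1 ≤ m) {d : Fin 4 → ℤ} (h : InFibre m n κ d)
    (h0 : nodeLevel d = 0) : n ∣ (d 0 - d 1).natAbs ∧ n ∣ (d 2 - d 3).natAbs := by
  obtain ⟨k, h1, h2, h3⟩ := h
  have : k = 0 := by
    rw [h0] at h1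
    rcases mul_eq_zero.1 h1.symm with h | h
    · omega
    · exact h
  subst this
  simp only [Int.cast_zero, mul_zero, add_zero] at h2 h3
  exact ⟨natCast_dvd_of_eq_zero h2, natCast_dvd_of_eq_zero h3⟩

/-- The triple on which membership in a fibre depends. -/
def profile (d : Fin 4 → ℤ) : ℤ × ℤ × ℤ := (nodeLevel d, d 0 - d 1, d 2 - d 3)

theorem inFibre_congr {d d' : Fin 4 → ℤ} (h : profile d = profile d') :
    InFibre m n κ d ↔ InFibre m n κ d' := by
  simp only [profile, Prod.mk.injEq] at h
  simp only [InFibre, h.1, h.2.1, h.2.2]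

/-- `(4, 0, 0)` is the profile of `(1, 1, -1, -1)`, and the fibres are invariant under negation. -/
theorem inFibre_of_profile {d : Fin 4 → ℤ} (h : profile d = (4, 0, 0) ∨ profile d = (-4, 0, 0))
    (hd : InFibre m n κ d) : InFibre m n κ ![1, 1, -1, -1] := by
  rcases h with h | h
  · exact (inFibre_congr (h.trans rfl)).1 hd
  · have e : profile (-d) = profile ![1, 1, -1, -1] := by
      simp only [profile, Prod.mk.injEq, nodeLevel, Pi.neg_apply] at h ⊢
      refine ⟨?_, ?_, ?_⟩ <;> simp <;> omega
    exact (inFibre_congr e).1 hd.neg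

theorem not_dirClosable_turn (hm : 1 ≤ m) (hn : 5 ≤ n) (h6 : n ≠ 6) (hκ : 2 * κ = 0)
    (hE : ¬ InFibre m n κ ![1, 1, -1, -1]) {c d : Fin 4} (hcd : c ≠ d) :
    ¬ DirClosable m n κ 3 [c, d] c := by
  rintro ⟨w, hw, h⟩
  have key : ∀ c d : Fin 4, c ≠ d → ∀ w ∈ dirWords 3 c, (fun v : Fin 4 → ℤ =>
      (profile v = (4, 0, 0) ∨ profile v = (-4, 0, 0)) ∨
      Nat.gcd (2 * (v 0 - v 1)).natAbs
        (Nat.gcd (2 * (v 2 - v 3)).natAbs (v 0 - v 1 - v 2 + v 3).natAbs) ∈ [1, 2, 3, 4, 6] ∨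
      (nodeLevel v = 0 ∧ ((v 0 - v 1).natAbs ∈ [1, 2, 3, 4, 6] ∨
        (v 2 - v 3).natAbs ∈ [1, 2, 3, 4, 6]))) (disp ([c, d] ++ c :: w)) := by
    decide +kernel
  have hno : ∀ k ∈ [1, 2, 3, 4, 6], ¬ n ∣ k := by
    intro k hk hd
    have := Nat.le_of_dvd (by simp at hk; omega) hd
    simp at hk
    have : n = 5 := by omega
    subst this
    omega
  rcases key c d hcd w hw with h1 | h1 | ⟨h0, h1 | h1⟩
  · exact hE (inFibre_of_profile h1 h)
  · exact hno _ h1 (h.dvd hκ)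
  · exact hno _ h1 (h.dvd_of_level hm h0).1
  · exact hno _ h1 (h.dvd_of_level hm h0).2

theorem not_dirClosable_two (h3 : 3 ≤ n) (h4 : n ≠ 4) (hκ : 2 * κ = 0) :
    ¬ DirClosable m n κ 2 [0] 1 := by
  rintro ⟨w, hw, h⟩
  have key : ∀ w ∈ dirWords 2 1, (fun v : Fin 4 → ℤ =>
      Nat.gcd (2 * (v 0 - v 1)).natAbs
        (Nat.gcd (2 * (v 2 - v 3)).natAbs (v 0 - v 1 - v 2 + v 3).natAbs) ∈ [1, 2, 4])
        (disp ([0] ++ 1 :: w)) := by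
    decide +kernel
  have h1 := key w hw
  have h2 := h.dvd hκ
  beta_reduce at h1
  simp only [List.mem_cons, List.not_mem_nil, or_false] at h1
  rcases h1 with h1 | h1 | h1 <;> rw [h1] at h2 <;> have := Nat.le_of_dvd (by norm_num) h2
  · omega
  · omega
  · have : n = 3 := by omega
    subst this
    omega

end Diamond

/-! ### Parameters of the 2-arc-transitive quotients -/

section Diamond

variable {V : Type*} {G : SimpleGraph V} {F : (Fin 4 → ℤ) → V} {m n : ℕ} {κ : ZMod n}

theorem exists_iso_nodes (hF : IsDiamondCover G F) {C : G.ConnectedComponent} (hC : F 0 ∈ C.supp)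
    (hT : IsTwoArcTransitive C.toSimpleGraph) {c d c' d' : Fin 4} (h : c ≠ d) (h' : c' ≠ d') :
    ∃ φ : G ≃g G, φ (F (dstep 0 c)) = F (dstep 0 c') ∧ φ (F 0) = F 0 ∧
      φ (F (dstep 0 d)) = F (dstep 0 d') := by
  have harc : ∀ c d : Fin 4, c ≠ d → IsTwoArc G (F (dstep 0 c)) (F 0) (F (dstep 0 d)) :=
    fun c d h => ⟨((hF.adj_iff 0 isNode_zero _).2 ⟨c, rfl⟩).symm,
      (hF.adj_iff 0 isNode_zero _).2 ⟨d, rfl⟩, fun e => h (hF.injective 0 isNode_zero e)⟩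
  exact exists_iso_of_isTwoArcTransitive hT hC hC (harc c d h) (harc c' d' h')

theorem dirClosable_two_iff (hF : IsDiamondCover G F) (hker : ∀ a b, IsNode a → IsNode b →
      (F a = F b ↔ ∑ i, a i = ∑ i, b i ∧ InFibre m n κ (a - b))) {C : G.ConnectedComponent}
    (hC : F 0 ∈ C.supp) (hT : IsTwoArcTransitive C.toSimpleGraph) {c d c' d' : Fin 4} (h : c ≠ d)
    (h' : c' ≠ d') : DirClosable m n κ 2 [c] d ↔ DirClosable m n κ 2 [c'] d' := by
  obtain ⟨φ, e1, e2, e3⟩ := exists_iso_nodes hF hC hT h h'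
  have key : ∀ c d : Fin 4, (closings G 2 (F (dstep 0 c)) (F 0) (F (dstep 0 d))).Nonempty ↔
      DirClosable m n κ 2 [c] d := by
    intro c d
    rw [← closings_drun hF hker (isNode_zero.dstep c) 2 [c] d ⟨2, rfl⟩]
    have : drun (dstep 0 c) [c] = 0 := dstep_dstep c
    rw [drun_append, this]; rfl
  have := closings_map_nonempty φ 2 (F (dstep 0 c)) (F 0) (F (dstep 0 d))
  rw [e1, e2, e3, key, key] at this
  exact this.symm

theorem not_inFibre_of_ne_four (hF : IsDiamondCover G F) (hker : ∀ a b, IsNode a → IsNode b →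
      (F a = F b ↔ ∑ i, a i = ∑ i, b i ∧ InFibre m n κ (a - b))) {C : G.ConnectedComponent}
    (hC : F 0 ∈ C.supp) (hT : IsTwoArcTransitive C.toSimpleGraph) (h3 : 3 ≤ n) (h4 : n ≠ 4)
    (hκ : 2 * κ = 0) : ¬ InFibre m n κ ![1, 1, -1, -1] := by
  intro h
  refine not_dirClosable_two (m := m) h3 h4 hκ ((dirClosable_two_iff hF hker hC hT
    (by decide : (0 : Fin 4) ≠ 2) (by decide)).1 ⟨[1, 3], by decide, ?_⟩)
  exact (inFibre_congr (by decide)).1 h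

/-- If all prolongations of the sequence `01` of directions can be closed up to a hexagon, then so
can all prolongations of `02`. -/
theorem dirClosable_three_of_forall (hF : IsDiamondCover G F)
    (hker : ∀ a b, IsNode a → IsNode b →
      (F a = F b ↔ ∑ i, a i = ∑ i, b i ∧ InFibre m n κ (a - b))) {C : G.ConnectedComponent}
    (hC : F 0 ∈ C.supp) (hT : IsTwoArcTransitive C.toSimpleGraph)
    (h : ∀ x, x ≠ 1 → DirClosable m n κ 3 [0, 1] x) : DirClosable m n κ 3 [0, 2] 0 := by
  obtain ⟨φ, e1, e2, e3⟩ := exists_iso_nodes hF hC hT (by decide : (0 : Fin 4) ≠ 1)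
    (by decide : (0 : Fin 4) ≠ 2)
  have key : ∀ d x : Fin 4, (closings G 3 (F (dstep 0 0)) (F (dstep 0 d))
      (F (dstep (dstep 0 d) x))).Nonempty ↔ DirClosable m n κ 3 [0, d] x := by
    intro d x
    rw [← closings_drun hF hker (isNode_zero.dstep 0) 3 [0, d] x ⟨3, rfl⟩]
    have : drun (dstep 0 0) [0, d] = dstep 0 d := by
      change dstep (dstep (dstep 0 0) 0) d = _
      rw [dstep_dstep]
    rw [drun_append, this]; rfl
  have hadj : G.Adj (F (dstep 0 1)) (φ.symm (F (dstep (dstep 0 2) 0))) := by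
    rw [← φ.map_adj_iff, e3, φ.apply_symm_apply]
    exact (hF.adj_iff _ (isNode_zero.dstep 2) _).2 ⟨0, rfl⟩
  obtain ⟨x, hx⟩ := (hF.adj_iff _ (isNode_zero.dstep 1) _).1 hadj
  have hx1 : x ≠ 1 := by
    rintro rfl
    rw [dstep_dstep] at hx
    have h1 := congrArg φ hx
    rw [e2, φ.apply_symm_apply] at h1
    have h2 : F (dstep (dstep 0 2) 2) = F (dstep (dstep 0 2) 0) := by rw [dstep_dstep]; exact h1
    exact absurd (hF.injective _ (isNode_zero.dstep 2) h2) (by decide)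
  have h1 := (key 1 x).2 (h x hx1)
  rw [← closings_map_nonempty φ, hx, e1, e3, φ.apply_symm_apply] at h1
  exact (key 2 0).1 h1

/-- If a path lies on a hexagon only when its first and third edge have different directions, then
an automorphism induces the same permutation of the directions at all nodes. -/
theorem map_drun (hF : IsDiamondCover G F) (hker : ∀ a b, IsNode a → IsNode b →
      (F a = F b ↔ ∑ i, a i = ∑ i, b i ∧ InFibre m n κ (a - b)))
    (hturn : ∀ c d : Fin 4, c ≠ d → ¬ DirClosable m n κ 3 [c, d] c) (φ : G ≃g G)
    (π : Fin 4 → Fin 4) (hπ : Function.Injective π) (w : List (Fin 4)) {a a' : Fin 4 → ℤ}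
    (ha : IsNode a) (ha' : IsNode a') (h0 : φ (F a) = F a')
    (h1 : ∀ c, φ (F (dstep a c)) = F (dstep a' (π c))) :
    φ (F (drun a w)) = F (drun a' (w.map π)) := by
  induction w generalizing a a' with
  | nil => exact h0
  | cons b w ih =>
    refine ih (ha.dstep b) (ha'.dstep _) (h1 b) fun c => ?_
    by_cases hcb : c = b
    · subst hcb
      rw [dstep_dstep, dstep_dstep]; exact h0
    have key : ∀ {a : Fin 4 → ℤ}, IsNode a → ∀ b c x : Fin 4,
        (closings G 3 (F (dstep a c)) (F (dstep a b)) (F (dstep (dstep a b) x))).Nonempty ↔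
          DirClosable m n κ 3 [c, b] x := by
      intro a ha b c x
      rw [← closings_drun hF hker (ha.dstep c) 3 [c, b] x ⟨3, rfl⟩]
      have : drun (dstep a c) [c, b] = dstep a b := by
        change dstep (dstep (dstep a c) c) b = _
        rw [dstep_dstep]
      rw [drun_append, this]; rfl
    have hadj : G.Adj (F (dstep a' (π b))) (φ (F (dstep (dstep a b) c))) := by
      rw [← h1, φ.map_adj_iff]
      exact (hF.adj_iff _ (ha.dstep b) _).2 ⟨c, rfl⟩
    obtain ⟨d, hd⟩ := (hF.adj_iff _ (ha'.dstep _) _).1 hadj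
    rw [← hd]
    by_contra hne
    have hdc : d ≠ π c := by rintro rfl; exact hne rfl
    have hdb : d ≠ π b := by
      rintro rfl
      rw [dstep_dstep, ← h0] at hd
      have h2 : F (dstep (dstep a b) b) = F (dstep (dstep a b) c) := by
        rw [dstep_dstep]; exact φ.injective hd
      exact hcb (hF.injective _ (ha.dstep b) h2).symm
    have hgood := (key ha' (π b) (π c) d).2
      (dirClosable_hexagon (fun e => hcb (hπ e)) hdb.symm hdc.symm)
    rw [hd, ← h1, ← h1, closings_map_nonempty] at hgood
    exact hturn c b hcb ((key ha b c c).1 hgood)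

theorem disp_flatten_replicate {v : List (Fin 4)} (hv : Even v.length) (k : ℕ) :
    disp (List.replicate k v).flatten = (k : ℤ) • disp v ∧
      Even (List.replicate k v).flatten.length := by
  have happ : ∀ v w : List (Fin 4), (Even v.length → disp (v ++ w) = disp v + disp w) ∧
      (¬ Even v.length → disp (v ++ w) = disp v - disp w) := by
    intro v w
    induction v with
    | nil => simp [disp]
    | cons c v ih =>
      constructor
      · intro h
        rw [List.cons_append, disp, ih.2 (by simpa [Nat.even_add_one] using h), disp]; abel
      · intro h
        rw [List.cons_append, disp, ih.1 (by simpa [Nat.even_add_one] using h), disp]; abel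
  induction k with
  | zero => simp [disp]
  | succ k ih =>
    rw [List.replicate_succ, List.flatten_cons, (happ _ _).1 hv, ih.1]
    refine ⟨by push_cast; module, ?_⟩
    rw [List.length_append]
    exact hv.add ih.2

theorem inFibre_iff_of_level {d : Fin 4 → ℤ} (hm : 1 ≤ m) (h0 : nodeLevel d = 0) {k : ℕ}
    (h1 : (d 0 - d 1).natAbs = 2 * k) (h2 : (d 2 - d 3).natAbs = 2 * k ∨ d 2 - d 3 = 0) :
    InFibre m n κ d ↔ n ∣ 2 * k := by
  constructor
  · intro h
    have := (h.dvd_of_level hm h0).1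
    rwa [h1] at this
  · intro h
    have key : ∀ x : ℤ, x.natAbs = 2 * k ∨ x = 0 → (x : ZMod n) = 0 := by
      rintro x (hx | rfl)
      · rw [ZMod.intCast_zmod_eq_zero_iff_dvd, Int.natCast_dvd, hx]; exact h
      · simp
    exact ⟨0, by simpa using h0, by simpa using key _ (Or.inl h1), by simpa using key _ h2⟩

/-- For `n ≥ 5`, `n ≠ 6`, an automorphism that fixes the direction 0 and takes 1 to 2 permutes the
directions everywhere in the same way, and hence relates the fibres. -/
theorem inFibre_iff_of_isTwoArcTransitive (hF : IsDiamondCover G F)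
    (hker : ∀ a b, IsNode a → IsNode b →
      (F a = F b ↔ ∑ i, a i = ∑ i, b i ∧ InFibre m n κ (a - b))) {C : G.ConnectedComponent}
    (hC : F 0 ∈ C.supp) (hT : IsTwoArcTransitive C.toSimpleGraph) (hm : 1 ≤ m)
    (hturn : ∀ c d : Fin 4, c ≠ d → ¬ DirClosable m n κ 3 [c, d] c) (k : ℕ) :
    (InFibre m n κ ((k : ℤ) • ![1, 0, -1, 0]) ↔ n ∣ 2 * k) ∧
    (InFibre m n κ ((k : ℤ) • ![1, 1, -1, -1]) ↔ n ∣ 2 * k) := by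
  obtain ⟨φ, e1, e2, e3⟩ := exists_iso_nodes hF hC hT (by decide : (0 : Fin 4) ≠ 1)
    (by decide : (0 : Fin 4) ≠ 2)
  have hπ : ∀ c, ∃ c', φ (F (dstep 0 c)) = F (dstep 0 c') := by
    intro c
    have : G.Adj (F 0) (φ (F (dstep 0 c))) := by
      rw [← e2, φ.map_adj_iff]
      exact (hF.adj_iff 0 isNode_zero _).2 ⟨c, rfl⟩
    obtain ⟨c', hc⟩ := (hF.adj_iff 0 isNode_zero _).1 this
    exact ⟨c', hc.symm⟩
  choose π hπ using hπ
  have hinj : Function.Injective π := fun c d hcd =>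
    hF.injective 0 isNode_zero (φ.injective (by rw [hπ, hπ, hcd]))
  have h0 : π 0 = 0 := hF.injective 0 isNode_zero (by simp only [← hπ]; exact e1)
  have h1 : π 1 = 2 := hF.injective 0 isNode_zero (by simp only [← hπ]; exact e3)
  have key : ∀ v : List (Fin 4), Even v.length →
      (InFibre m n κ ((k : ℤ) • disp (v.map π)) ↔ InFibre m n κ ((k : ℤ) • disp v)) := by
    intro v hv
    obtain ⟨d1, l1⟩ := disp_flatten_replicate hv k
    obtain ⟨d2, l2⟩ := disp_flatten_replicate (v := v.map π) (by simpa using hv) k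
    rw [← d1, ← d2, ← map_drun_eq_iff hker isNode_zero l1, ← map_drun_eq_iff hker isNode_zero l2]
    have := map_drun hF hker hturn φ π hinj (List.replicate k v).flatten isNode_zero isNode_zero
      e2 hπ
    rw [List.map_flatten, List.map_replicate] at this
    rw [← this]
    conv_lhs => rw [← e2]
    exact φ.injective.eq_iff
  constructor
  · have := key [0, 1] ⟨1, rfl⟩
    simp only [List.map_cons, List.map_nil, h0, h1] at this
    rw [show disp [0, 2] = ![1, 0, -1, 0] by decide,
      show disp [0, 1] = ![1, -1, 0, 0] by decide] at this
    rw [this]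
    exact inFibre_iff_of_level hm (by simp [nodeLevel]) (by simp; omega) (Or.inr (by simp))
  · obtain ⟨p, q, hp, hq, hpq⟩ : ∃ p q, π p = 1 ∧ π q = 3 ∧
        ((p = 2 ∧ q = 3) ∨ (p = 3 ∧ q = 2)) := by
      have hb := Finite.injective_iff_bijective.1 hinj
      obtain ⟨p, hp⟩ := hb.2 1
      obtain ⟨q, hq⟩ := hb.2 3
      refine ⟨p, q, hp, hq, ?_⟩
      have a1 : p ≠ 0 := by rintro rfl; rw [h0] at hp; exact absurd hp (by decide)
      have a2 : p ≠ 1 := by rintro rfl; rw [h1] at hp; exact absurd hp (by decide)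
      have a3 : q ≠ 0 := by rintro rfl; rw [h0] at hq; exact absurd hq (by decide)
      have a4 : q ≠ 1 := by rintro rfl; rw [h1] at hq; exact absurd hq (by decide)
      have a5 : p ≠ q := by rintro rfl; rw [hp] at hq; exact absurd hq (by decide)
      clear hp hq
      revert p q; decide
    have := key [0, 1, p, q] ⟨2, rfl⟩
    simp only [List.map_cons, List.map_nil, h0, h1, hp, hq] at this
    rw [show disp [0, 2, 1, 3] = ![1, 1, -1, -1] by decide] at this
    rw [this]
    rcases hpq with ⟨rfl, rfl⟩ | ⟨rfl, rfl⟩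
    · rw [show disp [0, 1, 2, 3] = ![1, -1, 1, -1] by decide]
      exact inFibre_iff_of_level hm (by simp [nodeLevel]) (by simp; omega)
        (Or.inl (by simp; omega))
    · rw [show disp [0, 1, 3, 2] = ![1, -1, -1, 1] by decide]
      exact inFibre_iff_of_level hm (by simp [nodeLevel]) (by simp; omega)
        (Or.inl (by simp; omega))

end Diamond

section Covering

variable {m n : ℕ} {r : (ZMod n)ˣ}

/-- The parameters for which the graph is 2-arc-transitive in the diamond case. -/
theorem parameters_of_isTwoArcTransitive (h : Admissible m 2 n r) (hA : IsDiamond r)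
    (hT : IsTwoArcTransitive (CPM m 2 n r)) :
    (n = 4 ∧ m = 1) ∨
    (n = m ∧ Odd n ∧ ((r : ZMod n) ^ 2 = 1 ∨ (r : ZMod n) ^ 2 = -1)) ∨
    (n = 2 * m ∧ m ≡ 2 [MOD 4] ∧ 1 + (r : ZMod n) ^ 2 = (m : ZMod n)) := by
  obtain ⟨F, κ, hF, hF0, hker, hκ⟩ := exists_cover h hA
  have hC : F 0 ∈ (CPMComponent m 2 n r).supp := by rw [hF0]; exact conn_mem_zero
  have h3 := h.three_le
  have hm := h.one_le
  have h2κ : 2 * κ = 0 := by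
    rcases hκ with rfl | ⟨k, hn, -, rfl, -⟩
    · simp
    · have : ((2 * k : ℕ) : ZMod n) = 0 := by rw [← hn]; exact ZMod.natCast_self n
      exact_mod_cast this
  have hdvd : ∀ {d : Fin 4 → ℤ}, κ = 0 → InFibre m n κ d →
      (2 * m : ℤ) ∣ nodeLevel d ∧ (n : ℤ) ∣ d 0 - d 1 ∧ (n : ℤ) ∣ d 2 - d 3 := by
    rintro d rfl ⟨k, h1, h2, h3⟩
    simp only [zero_mul, add_zero, ZMod.intCast_zmod_eq_zero_iff_dvd] at h2 h3
    exact ⟨⟨k, h1⟩, h2, h3⟩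
  by_cases h4 : n = 4
  · -- the sequence `0101` of directions is closed, and so is some continuation of `02`
    have hκ0 : κ = 0 := hκ.resolve_right (by rintro ⟨k, -, -, -, h5, -⟩; omega)
    have h01 : DirClosable m n κ 2 [0] 1 := by
      refine ⟨[0, 1], by decide, 0, ?_, ?_, ?_⟩
      · rw [show nodeLevel (disp ([0] ++ 1 :: [0, 1])) = 0 by decide]; simp
      · rw [show disp ([0] ++ 1 :: [0, 1]) 0 - disp ([0] ++ 1 :: [0, 1]) 1 = 4 by decide]
        subst h4; simp; rfl
      · rw [show disp ([0] ++ 1 :: [0, 1]) 2 - disp ([0] ++ 1 :: [0, 1]) 3 = 0 by decide]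
        simp
    obtain ⟨w, hw, hf⟩ := (dirClosable_two_iff hF hker hC hT (by decide)
      (by decide : (0 : Fin 4) ≠ 2)).1 h01
    obtain ⟨d1, d2, d3⟩ := hdvd hκ0 hf
    have key : ∀ w ∈ dirWords 2 2, (fun v : Fin 4 → ℤ => (4 : ℤ) ∣ v 0 - v 1 → (4 : ℤ) ∣ v 2 - v 3 →
        nodeLevel v ∈ [4, -4, 2, -2]) (disp ([0] ++ 2 :: w)) := by
      decide +kernel
    rw [h4] at d2 d3
    have hl := key w hw d2 d3
    have hm2 : m ∣ 2 := by
      simp only [List.mem_cons, List.not_mem_nil, or_false] at hl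
      have hm4 : (2 * m : ℤ) ∣ 4 := by
        rcases hl with hl | hl | hl | hl <;> rw [hl] at d1
        · exact d1
        · exact (dvd_neg (α := ℤ)).1 d1
        · exact d1.trans (by norm_num)
        · exact ((dvd_neg (α := ℤ)).1 d1).trans (by norm_num)
      have : 2 * m ∣ 2 * 2 := by exact_mod_cast hm4
      exact Nat.dvd_of_mul_dvd_mul_left two_pos this
    have hr : (r : ZMod n) ^ 2 = 1 := by
      subst h4
      clear * -
      revert r; decide
    rcases (Nat.dvd_prime Nat.prime_two).1 hm2 with rfl | rfl
    · exact Or.inl ⟨h4, rfl⟩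
    · exact Or.inr (Or.inr ⟨h4, rfl, by rw [hr]; norm_num⟩)
  have hE := not_inFibre_of_ne_four hF hker hC hT h3 h4 h2κ
  by_cases h36 : n = 3 ∨ n = 6
  · -- `010101` is closed, so that all prolongations of `01` lie on closed 6-walks
    have hκ0 : κ = 0 := hκ.resolve_right (by
      rintro ⟨k, hn, ⟨j, hj⟩, -, h5, -⟩; omega)
    have hm1 : m ≠ 1 := by
      rintro rfl
      exact hE ⟨2, by simp [nodeLevel], by simp [hκ0], by simp [hκ0]⟩
    have h6 : (n : ℤ) ∣ 6 := by rcases h36 with rfl | rfl <;> norm_num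
    obtain ⟨w, hw, hf⟩ := dirClosable_three_of_forall hF hker hC hT (fun x hx => by
      by_cases hx0 : x = 0
      · subst hx0
        refine ⟨[1, 0, 1], by decide, 0, ?_, ?_, ?_⟩
        · rw [show nodeLevel (disp ([0, 1] ++ 0 :: [1, 0, 1])) = 0 by decide]; simp
        · rw [show disp ([0, 1] ++ 0 :: [1, 0, 1]) 0 - disp ([0, 1] ++ 0 :: [1, 0, 1]) 1 = 6
            by decide, (ZMod.intCast_zmod_eq_zero_iff_dvd _ _).2 h6]
          simp
        · rw [show disp ([0, 1] ++ 0 :: [1, 0, 1]) 2 - disp ([0, 1] ++ 0 :: [1, 0, 1]) 3 = 0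
            by decide]
          simp
      · exact dirClosable_hexagon (by decide) (Ne.symm hx) (Ne.symm hx0))
    obtain ⟨d1, d2, d3⟩ := hdvd hκ0 hf
    have hm2 : ¬ (2 * m : ℤ) ∣ 2 := by
      intro hd
      have : 2 * m ∣ 2 := by exact_mod_cast hd
      have := Nat.le_of_dvd two_pos this
      omega
    rcases h36 with rfl | rfl
    · have key : ∀ w ∈ dirWords 3 0, (fun v : Fin 4 → ℤ => (3 : ℤ) ∣ v 0 - v 1 →
          (3 : ℤ) ∣ v 2 - v 3 → (profile v = (4, 0, 0) ∨ profile v = (-4, 0, 0)) ∨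
          nodeLevel v ∈ [2, -2] ∨ nodeLevel v ∈ [6, -6]) (disp ([0, 2] ++ 0 :: w)) := by
        decide +kernel
      rcases key w hw d2 d3 with hk | hk | hk
      · exact (hE (inFibre_of_profile hk hf)).elim
      · simp only [List.mem_cons, List.not_mem_nil, or_false] at hk
        rcases hk with hk | hk <;> rw [hk] at d1
        · exact (hm2 d1).elim
        · exact (hm2 ((dvd_neg (α := ℤ)).1 d1)).elim
      · simp only [List.mem_cons, List.not_mem_nil, or_false] at hk
        have hm6 : (2 * m : ℤ) ∣ 6 := by
          rcases hk with hk | hk <;> rw [hk] at d1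
          · exact d1
          · exact (dvd_neg (α := ℤ)).1 d1
        have : 2 * m ∣ 2 * 3 := by exact_mod_cast hm6
        have := (Nat.dvd_prime Nat.prime_three).1 (Nat.dvd_of_mul_dvd_mul_left two_pos this)
        obtain rfl := this.resolve_left hm1
        refine Or.inr (Or.inl ⟨rfl, by decide, Or.inl ?_⟩)
        clear * -
        revert r; decide
    · have key : ∀ w ∈ dirWords 3 0, (fun v : Fin 4 → ℤ => (6 : ℤ) ∣ v 0 - v 1 →
          (6 : ℤ) ∣ v 2 - v 3 → (profile v = (4, 0, 0) ∨ profile v = (-4, 0, 0)) ∨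
          nodeLevel v ∈ [2, -2]) (disp ([0, 2] ++ 0 :: w)) := by
        decide +kernel
      rcases key w hw d2 d3 with hk | hk
      · exact (hE (inFibre_of_profile hk hf)).elim
      · simp only [List.mem_cons, List.not_mem_nil, or_false] at hk
        rcases hk with hk | hk <;> rw [hk] at d1
        · exact (hm2 d1).elim
        · exact (hm2 ((dvd_neg (α := ℤ)).1 d1)).elim
  push Not at h36
  have hturn : ∀ c d : Fin 4, c ≠ d → ¬ DirClosable m n κ 3 [c, d] c :=
    fun c d hcd => not_dirClosable_turn hm (by omega) h36.2 h2κ hE hcd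
  -- the translations along `02` and `0213` are compared with those along `01` and `01pq`, where
  -- `{p, q} = {2, 3}`
  have hline := fun k => (inFibre_iff_of_isTwoArcTransitive hF hker hC hT hm hturn k).1
  have hplane := fun k => (inFibre_iff_of_isTwoArcTransitive hF hker hC hT hm hturn k).2
  have hn2m : n ∣ 2 * m := (hplane m).1 ⟨2, by simp [nodeLevel]; ring,
    by simp; linear_combination h2κ,
    by simp; linear_combination h2κ⟩
  rcases hκ with hκ0 | ⟨k, hn, hk, hκk, h5, hm4, e, hr⟩
  · right; left
    have hodd : Odd n := by
      rw [← Nat.not_even_iff_odd]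
      rintro ⟨k, hk⟩
      have := (hdvd hκ0 ((hline k).2 ⟨1, by omega⟩)).2.1
      have h1 : n ∣ k := by simpa [Int.natCast_dvd_natCast] using this
      have := Nat.le_of_dvd (by omega) h1
      omega
    have h2n : Nat.Coprime n 2 := hodd.coprime_two_right
    have hnm : n ∣ m := h2n.dvd_of_dvd_mul_left hn2m
    have hmn : m ∣ n := by
      have := (hdvd hκ0 ((hline n).2 (dvd_mul_left _ _))).1
      have h1 : (2 * m : ℤ) ∣ 2 * n := by
        simpa [nodeLevel, two_mul] using this
      have h2 : 2 * m ∣ 2 * n := by exact_mod_cast h1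
      exact Nat.dvd_of_mul_dvd_mul_left two_pos h2
    refine ⟨Nat.dvd_antisymm hnm hmn, hodd, ?_⟩
    have hu : IsUnit (2 : ZMod n) := by
      have := (ZMod.isUnit_iff_coprime 2 n).2 h2n.symm
      exact_mod_cast this
    rcases hA with hA | hA
    · left; exact hu.mul_left_cancel (by rw [hA]; ring)
    · right; exact hu.mul_left_cancel (by rw [hA]; ring)
  · right; right
    have hmk : m ∣ k := by
      obtain ⟨j, hj, -⟩ := (hline k).2 ⟨1, by omega⟩
      have h1 : (2 * m : ℤ) ∣ 2 * k := ⟨j, by rw [← hj]; simp [nodeLevel]; ring⟩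
      have h2 : 2 * m ∣ 2 * k := by exact_mod_cast h1
      exact Nat.dvd_of_mul_dvd_mul_left two_pos h2
    have hkm : k ∣ m := by
      rw [hn] at hn2m
      exact Nat.dvd_of_mul_dvd_mul_left two_pos hn2m
    obtain rfl := Nat.dvd_antisymm hmk hkm
    refine ⟨hn, hm4, ?_⟩
    cases e
    · rw [hr]; simp [sgn]
    · -- `r ^ 2 = 1 + m` is impossible modulo 4
      exfalso
      have h4n : 4 ∣ n := ⟨m / 2, by omega⟩
      have hr4 := congrArg (ZMod.castHom h4n (ZMod 4)) hr
      simp only [map_pow, map_add, map_intCast, map_natCast] at hr4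
      have hm2 : ((m : ℕ) : ZMod 4) = 2 := by
        rw [show (2 : ZMod 4) = ((2 : ℕ) : ZMod 4) from rfl, ZMod.natCast_eq_natCast_iff]
        exact hm4
      rw [hm2] at hr4
      have key : ∀ x : ZMod 4, IsUnit x → x ^ 2 ≠ (sgn true : ZMod 4) + 2 := by decide
      exact key _ (r.isUnit.map _) hr4

end Covering

/-! ### The 4-cube -/

section Cube

theorem IsTwoArcTransitive.of_iso {V W : Type*} {G : SimpleGraph V} {H : SimpleGraph W}
    (ψ : G ≃g H) (h : IsTwoArcTransitive H) : IsTwoArcTransitive G := by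
  have harc : ∀ {a b c}, IsTwoArc G a b c → IsTwoArc H (ψ a) (ψ b) (ψ c) := fun h =>
    ⟨ψ.map_adj_iff.2 h.1, ψ.map_adj_iff.2 h.2.1, fun e => h.2.2 (ψ.injective e)⟩
  intro a b c a' b' c' h1 h2
  obtain ⟨φ, e1, e2, e3⟩ := h _ _ _ _ _ _ (harc h1) (harc h2)
  exact ⟨(ψ.trans φ).trans ψ.symm, by simp [e1], by simp [e2], by simp [e3]⟩

theorem fourCube_adj_iff (x y : Fin 4 → Bool) :
    fourCube.Adj x y ↔ ∃ c, Function.update x c (!x c) = y := by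
  change hammingDist x y = 1 ↔ _
  revert x y
  decide +kernel

/-- A map from the diamond lattice to the 4-cube under which the four directions at each node
become the four coordinate directions is a covering. -/
theorem isDiamondCover_fourCube {F : (Fin 4 → ℤ) → Fin 4 → Bool}
    (h : ∀ a, IsNode a → ∃ σ : Fin 4 → Fin 4, Function.Bijective σ ∧
      ∀ c, F (dstep a c) = Function.update (F a) (σ c) (!F a (σ c))) :
    IsDiamondCover fourCube F := by
  refine ⟨fun a ha y => ?_, fun a ha c d hcd => ?_⟩
  · obtain ⟨σ, hσ, hc⟩ := h a ha
    rw [fourCube_adj_iff]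
    simp only [hc]
    exact (hσ.2.exists (p := fun c => Function.update (F a) c (!F a c) = y))
  · obtain ⟨σ, hσ, hc⟩ := h a ha
    simp only [hc] at hcd
    have h1 := congrFun hcd (σ c)
    by_contra hne
    have : σ c ≠ σ d := fun e => hne (hσ.1 e)
    simp [Function.update_of_ne this] at h1

theorem fourCube_mem_supp (C : fourCube.ConnectedComponent) (x : Fin 4 → Bool) : x ∈ C.supp := by
  have hstep : ∀ (x : Fin 4 → Bool) c, fourCube.Reachable x (Function.update x c false) := by
    intro x c
    by_cases hx : x c = false
    · rw [← hx, Function.update_eq_self]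
    · refine SimpleGraph.Adj.reachable ((fourCube_adj_iff _ _).2 ⟨c, ?_⟩)
      simp at hx
      simp [hx]
  have h0 : ∀ x : Fin 4 → Bool, fourCube.Reachable x fun _ => false := by
    intro x
    have := (((hstep x 0).trans (hstep _ 1)).trans (hstep _ 2)).trans (hstep _ 3)
    convert this using 1
    funext i
    fin_cases i <;> simp [Function.update]
  obtain ⟨y, rfl⟩ := C.exists_rep
  exact SimpleGraph.ConnectedComponent.sound ((h0 x).trans (h0 y).symm)

/-- A connected component that can be covered by the diamond lattice with the same fibres as the
4-cube is isomorphic to the 4-cube. -/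
theorem nonempty_iso_fourCube {V : Type*} {G : SimpleGraph V} {F : (Fin 4 → ℤ) → V}
    {F' : (Fin 4 → ℤ) → Fin 4 → Bool} (hF : IsDiamondCover G F) (hF' : IsDiamondCover fourCube F')
    (hker : ∀ a b, IsNode a → IsNode b → (F a = F b ↔ F' a = F' b)) (C : G.ConnectedComponent)
    (hC : F 0 ∈ C.supp) : Nonempty (C.toSimpleGraph ≃g fourCube) := by
  obtain ⟨ψ, -⟩ := exists_iso_of_covers hF hF' hker C (fourCube.connectedComponentMk 0) isNode_zero
    hC (fourCube_mem_supp _ _)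
  exact ⟨ψ.trans ⟨Equiv.subtypeUnivEquiv fun x => fourCube_mem_supp _ x, Iff.rfl⟩⟩

theorem isDiamondCover_parity :
    IsDiamondCover fourCube fun a c => decide (a c % 2 = 1) := by
  refine isDiamondCover_fourCube fun a ha =>
    ⟨id, Function.bijective_id, fun c => funext fun i => ?_⟩
  by_cases hi : i = c
  · subst hi
    rcases ha with ha | ha <;> refine Bool.eq_iff_iff.2 ?_ <;> simp [dstep, ha] <;> omega
  · simp [dstep, Function.update_of_ne hi, Pi.single_eq_of_ne hi]

/-- The Cartesian product of two 4-cycles is the 4-cube: the residue of `x` modulo 4 is encoded by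
the parities of `⌊(x + 1) / 2⌋` and `⌊x / 2⌋`. -/
def cubePos (a : Fin 4 → ℤ) : Fin 4 → Bool :=
  ![decide ((a 0 - a 1 + 1) / 2 % 2 = 1), decide ((a 0 - a 1) / 2 % 2 = 1),
    decide ((a 2 - a 3 + 1) / 2 % 2 = 1), decide ((a 2 - a 3) / 2 % 2 = 1)]

theorem isDiamondCover_cubePos : IsDiamondCover fourCube cubePos := by
  refine isDiamondCover_fourCube fun a ha => ?_
  have hs := Fin.sum_univ_four a
  have hx : (a 0 - a 1) % 2 = 0 ∨ (a 0 - a 1) % 2 = 1 := by omega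
  rcases ha with ha | ha <;> rcases hx with hx | hx
  · refine ⟨![0, 1, 2, 3], by decide, fun c => funext fun i => ?_⟩
    have hy : (a 2 - a 3) % 2 = 0 := by omega
    fin_cases c <;> fin_cases i <;> refine Bool.eq_iff_iff.2 ?_ <;>
      simp [dstep, ha, cubePos, Function.update] <;> omega
  · refine ⟨![1, 0, 3, 2], by decide, fun c => funext fun i => ?_⟩
    have hy : (a 2 - a 3) % 2 = 1 := by omega
    fin_cases c <;> fin_cases i <;> refine Bool.eq_iff_iff.2 ?_ <;>
      simp [dstep, ha, cubePos, Function.update] <;> omega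
  · refine ⟨![1, 0, 2, 3], by decide, fun c => funext fun i => ?_⟩
    have hy : (a 2 - a 3) % 2 = 1 := by omega
    fin_cases c <;> fin_cases i <;> refine Bool.eq_iff_iff.2 ?_ <;>
      simp [dstep, ha, cubePos, Function.update] <;> omega
  · refine ⟨![0, 1, 3, 2], by decide, fun c => funext fun i => ?_⟩
    have hy : (a 2 - a 3) % 2 = 0 := by omega
    fin_cases c <;> fin_cases i <;> refine Bool.eq_iff_iff.2 ?_ <;>
      simp [dstep, ha, cubePos, Function.update] <;> omega

theorem cubePos_eq_iff {a b : Fin 4 → ℤ} (ha : IsNode a) (hb : IsNode b) :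
    cubePos a = cubePos b ↔
      ∑ i, a i = ∑ i, b i ∧ InFibre 1 4 (0 : ZMod 4) (a - b) := by
  have hsa := Fin.sum_univ_four a
  have hsb := Fin.sum_univ_four b
  have hcast : ∀ x : ℤ, (x : ZMod 4) = 0 ↔ (4 : ℤ) ∣ x := fun x =>
    ZMod.intCast_zmod_eq_zero_iff_dvd x 4
  simp only [InFibre, zero_mul, add_zero, hcast, nodeLevel, Pi.sub_apply]
  have hbits : cubePos a = cubePos b ↔
      (4 : ℤ) ∣ (a 0 - a 1) - (b 0 - b 1) ∧ (4 : ℤ) ∣ (a 2 - a 3) - (b 2 - b 3) := by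
    constructor
    · intro h
      have h0 := congrFun h 0
      have h1 := congrFun h 1
      have h2 := congrFun h 2
      have h3 := congrFun h 3
      simp [cubePos] at h0 h1 h2 h3
      omega
    · rintro ⟨h1, h2⟩
      funext i
      fin_cases i <;> simp [cubePos] <;> omega
  rw [hbits]
  unfold IsNode at ha hb
  constructor
  · rintro ⟨h1, h2⟩
    have hs : ∑ i, a i = ∑ i, b i := by omega
    refine ⟨hs, a 0 + a 1 - b 0 - b 1, ?_, ?_, ?_⟩
    · push_cast; omega
    · omega
    · omega
  · rintro ⟨-, -, -, h1, h2⟩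
    constructor <;> omega

theorem nonempty_iso_fourCube_one (r : (ZMod 4)ˣ) : Nonempty (CPM 1 2 4 r ≃g fourCube) := by
  have hr : (r : ZMod 4) ^ 2 = 1 := by revert r; decide
  have h : Admissible 1 2 4 r := ⟨le_rfl, le_rfl, by norm_num, Or.inl hr⟩
  have hA : IsDiamond r := Or.inl (by rw [hr]; rfl)
  obtain ⟨F, κ, hF, hF0, hker, hκ⟩ := exists_cover h hA
  obtain rfl : κ = 0 := hκ.resolve_right (by rintro ⟨k, -, -, -, h5, -⟩; omega)
  exact nonempty_iso_fourCube hF isDiamondCover_cubePos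
    (fun a b ha hb => (hker a b ha hb).trans (cubePos_eq_iff ha hb).symm) _
    (by rw [hF0]; exact conn_mem_zero)

theorem cube_two : IsTwoArcTransitive (CPM 2 2 4 1) ∧ Nonempty (CPM 2 2 4 1 ≃g fourCube) := by
  have h : Admissible 2 2 4 (1 : (ZMod 4)ˣ) := ⟨by norm_num, le_rfl, by norm_num, Or.inl (by simp)⟩
  obtain ⟨h1, F, hF, hF0, hker⟩ := isTwoArcTransitive_of_half h rfl rfl (by decide)
  refine ⟨h1, nonempty_iso_fourCube hF isDiamondCover_parity (fun a b ha hb => ?_) _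
    (by rw [hF0]; exact conn_mem_zero)⟩
  rw [hker a b ha hb]
  have hsa := Fin.sum_univ_four a
  have hsb := Fin.sum_univ_four b
  unfold IsNode at ha hb
  constructor
  · rintro ⟨-, h⟩
    funext i
    have := h i
    simp only [Pi.sub_apply] at this
    push_cast at this
    simp; omega
  · intro h
    have hd : ∀ i, (2 : ℤ) ∣ a i - b i := by
      intro i
      have := congrFun h i
      simp at this
      omega
    have h0 := hd 0
    have h1 := hd 1
    have h2 := hd 2
    have h3 := hd 3
    exact ⟨by omega, fun i => by simpa using hd i⟩

end Cube

theorem theorem6 (m s n : ℕ) (hm : 1 ≤ m) (hs : 2 ≤ s) (hn : 3 ≤ n) (r : (ZMod n)ˣ)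
    (hr : (r : ZMod n) ^ (m * s) = 1 ∨ (r : ZMod n) ^ (m * s) = -1) :
    (IsTwoArcTransitive (CPM m s n r) ↔
      s = 2 ∧
        ((n = 4 ∧ m = 1) ∨
         (n = m ∧ Odd n ∧ ((r : ZMod n) ^ 2 = 1 ∨ (r : ZMod n) ^ 2 = -1)) ∨
         (n = 2 * m ∧ m ≡ 2 [MOD 4] ∧ 1 + (r : ZMod n) ^ 2 = (m : ZMod n)))) ∧
    (s = 2 → n = 4 → m = 1 →
      Nonempty (CPM m s n r ≃g CPM 1 2 4 1) ∧
      Nonempty (CPM 1 2 4 1 ≃g CPM 2 2 4 1) ∧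
      Nonempty (CPM 2 2 4 1 ≃g fourCube)) := by
  have h : Admissible m s n r := ⟨hm, hs, hn, hr⟩
  obtain ⟨hT2, ⟨ψ2⟩⟩ := cube_two
  obtain ⟨ψ1⟩ := nonempty_iso_fourCube_one 1
  refine ⟨⟨fun hT => ?_, ?_⟩, ?_⟩
  · rcases hs.eq_or_lt with rfl | hs3
    · refine ⟨rfl, ?_⟩
      by_cases hA : IsDiamond r
      · exact parameters_of_isTwoArcTransitive h hA hT
      · exact (not_isTwoArcTransitive_of_not_isDiamond h hA hT).elim
    · exact (not_isTwoArcTransitive_of_three_le h hs3 hT).elim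
  · rintro ⟨rfl, ⟨rfl, rfl⟩ | ⟨hnm, hodd, h2⟩ | ⟨hnm, hm4, h2⟩⟩
    · obtain ⟨ψ⟩ := nonempty_iso_fourCube_one r
      exact hT2.of_iso (ψ.trans ψ2.symm)
    · exact isTwoArcTransitive_of_odd h hnm hodd h2
    · exact (isTwoArcTransitive_of_half h hnm hm4 h2).1
  · rintro rfl rfl rfl
    obtain ⟨ψ⟩ := nonempty_iso_fourCube_one r
    exact ⟨⟨ψ.trans ψ1.symm⟩, ⟨ψ1.trans ψ2.symm⟩, ⟨ψ2⟩⟩
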